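/- Let $A=\mathbb Z[X]/(X^2)$ with its multiplication $m$ and the comultiplication $\Delta(1)=1\otimes X+X\otimes 1$, $\Delta(X)=X\otimes X$, and let $F$ be the associated $(1+1)$-dimensional TQFT: $F(M)=A^{\otimes\{\text{circles of }M\}}$ for a closed 1-manifold $M$. Let $B^n$ be the set of crossingless matchings of $2n$ points on the line $\{0\}\times\mathbb R$, and for $a\in B^n$ let $W(a)$ be its mirror image in the left half-plane. Khovanov's arc algebra is $H^n=\bigoplus_{a,b\in B^n}F(W(a)b)$, the product $F(W(a)b)\otimes F(W(b)c)\to F(W(a)c)$ being induced by the minimal cobordism that consists of $n$ saddles between the arcs of $b$ and of $W(b)$. Let $\mathcal I_n\cong\mathbb Z^{B^n}$ be the subring spanned by the elementary idempotents $1_a$ (all circles of $W(a)a$ labelled $1$). For an oriented link diagram $L$ with ordered crossings, $n_+$ of them positive and $n_-$ negative, let $CKh(L)=\bigoplus_\rho F(L_\rho)$ be its Khovanov complex. Here $\rho$ runs over the $0/1$-resolutions of the crossings; the differential is the sum of the saddle maps that change one crossing $c$ from $0$ to $1$, each with the sign $(-1)^{\#\{\text{1-resolved crossings before } c\}}$;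 the homological degree is $r-n_-$, where $r$ is the number of 1-resolved crossings, and the intrinsic degree ($q$-degree) is $\deg+r+n_+-2n_-$, with $\deg 1=1$ and $\deg X=-1$. For an oriented tangle diagram $T$ in a half-plane with $2n$ end points on $\{0\}\times\mathbb R$ and with ordered crossings, let $[T]^{Kh}=\bigoplus_{b\in B^n}\bigoplus_\rho F(T_\rho\text{ closed up by }b\text{ in the other half-plane})$, with the differential given by the same formula. Its homological degree is $r-n_-$ and its intrinsic degree is $-(\deg+r+n_+-2n_-)$, shifted up by $n$ if $T$ lies in the left half-plane. Then $[T]^{Kh}$ is a complex of left $H^n$-modules if $T$ lies in $\mathbb R_{\ge0}\times\mathbb R$, and of right $H^n$-modules if $T$ lies in $\mathbb R_{\le0}\times\mathbb R$, where $H^n$ acts through the minimal cobordisms. Let $\widehat D(T_1)$, for $T_1$ in the right half-plane, be the Type D structure over $H^n$ spanned by the elements $x$ of $[T_1]^{Kh}$ given by a resolution $\rho$ and a labelling of the circles of $(T_1)_\rho$ closed up by its own matching of the end points, such that all circles that touch the line are labelled $1$. The operation $\delta:\widehat D(T_1)\to[T_1]^{Kh}\cong H^n\otimes_{\mathcal I_n}\widehat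 D(T_1)$ is the restriction of the differential of $[T_1]^{Kh}$. Let $\widehat A(T_2)$, for $T_2$ in the left half-plane, be the right dg module $[T_2]^{Kh}$, with differential $m_1$ and action $m_2$ of $H^n$. Let $\widehat A(T_2)\boxtimes\widehat D(T_1)$ be $\widehat A(T_2)\otimes_{\mathcal I_n}\widehat D(T_1)$ with the differential $m_1\otimes|\mathrm{id}|+(m_2\otimes\mathrm{id})\circ(\mathrm{id}\otimes\delta)$, where $|\mathrm{id}|$ is multiplication by $(-1)^{\text{homological degree}}$. **Proposition.** Let $n\ge0$, and let $T_1$ and $T_2$ be oriented tangle diagrams in $\mathbb R_{\ge0}\times\mathbb R$ and $\mathbb R_{\le0}\times\mathbb R$ respectively, with the same $2n$ end points on $\{0\}\times\mathbb R$ and with orderings of their crossings. Assume that their orientations are consistent, so that their horizontal concatenation is an oriented link diagram $L$ in $\mathbb R^2$, and order the crossings of $L$ such that those of $T_1$ come before those of $T_2$. Then there is an isomorphism of abelian groups $$CKh(L)\;\cong\;\widehat A(T_2)\boxtimes\widehat D(T_1)$$ that commutes with the differentials, preserves the homological grading and negates the intrinsic grading: for all $q,h\in\mathbb Z$ it maps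 the summand of $CKh(L)$ in bidegree $(q,h)$ onto the summand of $\widehat A(T_2)\boxtimes\widehat D(T_1)$ in bidegree $(-q,h)$. -/

import Mathlib

open scoped DirectSum TensorProduct

noncomputable section

namespace Khov

/-! ### Circles, the Frobenius algebra, and saddles

A closed 1-manifold is given by a finite set `V` of points on it and a relation `r` on `V`
saying which points are joined by an arc; its circles are the classes of the equivalence relation
generated by `r`.  (Every circle carries a point.)  The group assigned to it is the tensor power
`A ^ ⊗ {circles}` of `A = ℤ[X]/(X ^ 2)`, with its basis of labellings of the circles by
`X ^ 0 = 1` (the sign `+`) and `X ^ 1 = X` (the sign `-`). -/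

section Saddle

variable {V : Type}

/-- Labellings of the circles: the label `e : Fin 2` stands for `X ^ e`. -/
abbrev Lab (r : V → V → Prop) : Type := Quot r → Fin 2

/-- The free abelian group on the labellings of the circles. -/
abbrev F (r : V → V → Prop) : Type := Lab r →₀ ℤ

/-- The circle through the point `v`. -/
abbrev circ (r : V → V → Prop) (v : V) : Quot r := Quot.mk r v

/-- The sum of the degrees of the labels, where `1` has degree `1` and `X` has degree `-1`. -/
def labDeg {r : V → V → Prop} (σ : Lab r) : ℤ := ∑ᶠ c : Quot r, (1 - 2 * ((σ c : ℕ) : ℤ))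

/-- Coefficient of `X ^ c` in `m (X ^ a ⊗ X ^ b)`. -/
def mCoeff (a b c : Fin 2) : ℤ := if (a : ℕ) + b = c then 1 else 0

/-- Coefficient of `X ^ b ⊗ X ^ c` in `Δ (X ^ a)`:
`Δ 1 = 1 ⊗ X + X ⊗ 1` and `Δ X = X ⊗ X`. -/
def comCoeff (a b c : Fin 2) : ℤ := if (b : ℕ) + c = a + 1 then 1 else 0

open Classical in
/-- Matrix coefficient of the map induced by one saddle, from the 1-manifold `r` to the 1-manifold
`r'`.  The saddle replaces two strands of `r` by two strands of `r'` with the same four ends;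
`p` and `q` are two of the four ends, lying on different strands both in `r` and in `r'`.
If the saddle merges two circles the map is `m`, if it splits a circle the map is `Δ`, and
it is the identity on the labels of the other circles. -/
def saddleCoeff (r r' : V → V → Prop) (p q : V) (σ : Lab r) (σ' : Lab r') : ℤ :=
  if ∀ v, circ r v ≠ circ r p → circ r v ≠ circ r q → σ (circ r v) = σ' (circ r' v) then
    if circ r p ≠ circ r q ∧ circ r' p = circ r' q then
      mCoeff (σ (circ r p)) (σ (circ r q)) (σ' (circ r' p))
    else if circ r p = circ r q ∧ circ r' p ≠ circ r' q then
      comCoeff (σ (circ r p)) (σ' (circ r' p)) (σ' (circ r' q))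
    else 0
  else 0

/-- The linear map of free abelian groups with a given matrix (row of `x` = image of `x`). -/
def matMap {S T : Type} [Finite T] (c : S → T → ℤ) : (S →₀ ℤ) →ₗ[ℤ] (T →₀ ℤ) :=
  Finsupp.linearCombination ℤ fun x => Finsupp.equivFunOnFinite.symm (c x)

end Saddle

/-! ### Crossingless matchings and the arc algebra -/

/-- The set `B^n` of crossingless matchings of `2 * n` points on a line. -/
structure Matching (n : ℕ) where
  partner : Fin (2 * n) → Fin (2 * n)
  invol : ∀ i, partner (partner i) = i
  ne_self : ∀ i, partner i ≠ i
  noncrossing : ∀ i j, i < j → j < partner i → ¬ partner i < partner j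

section Arc

variable {n : ℕ} {V : Type}

/-- Close up a 1-manifold with boundary (points `V`, relation `s`, boundary points `bd`)
by the arcs of the matching `b`. -/
def closeUp (s : V → V → Prop) (bd : Fin (2 * n) → V) (b : Matching n) : V → V → Prop :=
  fun u v => s u v ∨ ∃ j, u = bd j ∧ v = bd (b.partner j)

/-- The 1-manifold `W(a) b`, with points the `2 * n` points of the line. -/
def arcRel (a b : Matching n) : Fin (2 * n) → Fin (2 * n) → Prop :=
  closeUp (fun i j => j = a.partner i) id b

/-- The summand `1_a H^n 1_b = F(W(a) b)` of the arc algebra `H^n = ⨁ a b, 1_a H^n 1_b`. -/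
abbrev H (a b : Matching n) : Type := F (arcRel a b)

/-- Stages of the minimal cobordism from `(S b) ⊔ (W(b) c)` to `S c`, where `S` is the 1-manifold
with boundary `(V, s, bd)`.  At stage `k` the arcs of `b` and `W(b)` with lower end point below
`k` have been replaced by pairs of horizontal segments. -/
def stageRel (s : V → V → Prop) (bd : Fin (2 * n) → V) (b c : Matching n) (k : ℕ) :
    V ⊕ Fin (2 * n) → V ⊕ Fin (2 * n) → Prop
  | .inl u, .inl v => s u v ∨
      ∃ j, k ≤ ((min j (b.partner j) : Fin (2 * n)) : ℕ) ∧ u = bd j ∧ v = bd (b.partner j)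
  | .inr i, .inr j => j = c.partner i ∨
      (k ≤ ((min i (b.partner i) : Fin (2 * n)) : ℕ) ∧ j = b.partner i)
  | .inl u, .inr j => u = bd j ∧ ((min j (b.partner j) : Fin (2 * n)) : ℕ) < k
  | .inr _, .inl _ => False

variable [Finite V]

open Classical in
/-- From stage `k` to stage `k + 1`: a saddle if `k` is the lower end point of an arc of `b`,
and the identity otherwise. -/
def stepMap (s : V → V → Prop) (bd : Fin (2 * n) → V) (b c : Matching n) (k : ℕ) :
    F (stageRel s bd b c k) →ₗ[ℤ] F (stageRel s bd b c (k + 1)) :=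
  matMap fun σ σ' =>
    if h : ∃ j : Fin (2 * n), (j : ℕ) = k ∧ j < b.partner j then
      saddleCoeff _ _ (Sum.inl (bd h.choose)) (Sum.inr (b.partner h.choose)) σ σ'
    else if ∀ v, σ (circ _ v) = σ' (circ _ v) then 1 else 0

/-- The composition of the first `k` steps. -/
def runMap (s : V → V → Prop) (bd : Fin (2 * n) → V) (b c : Matching n) :
    (k : ℕ) → F (stageRel s bd b c 0) →ₗ[ℤ] F (stageRel s bd b c k)
  | 0 => LinearMap.id
  | k + 1 => stepMap s bd b c k ∘ₗ runMap s bd b c k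

open Classical in
/-- The map `F(S b) ⊗ F(W(b) c) → F(S c)` induced by the minimal cobordism: first
identify `F(S b) ⊗ F(W(b) c)` with `F` of the disjoint union, then do the `n` saddles, then identify
the result with `F(S c)`. -/
def actMap (s : V → V → Prop) (bd : Fin (2 * n) → V) (b c : Matching n) :
    F (closeUp s bd b) →ₗ[ℤ] H b c →ₗ[ℤ] F (closeUp s bd c) :=
  Finsupp.linearCombination ℤ fun σ : Lab (closeUp s bd b) =>
    matMap (fun (l : Lab (stageRel s bd b c (2 * n))) (σ' : Lab (closeUp s bd c)) =>
        if ∀ v : V, σ' (circ _ v) = l (circ _ (Sum.inl v)) then 1 else 0)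
      ∘ₗ runMap s bd b c (2 * n)
      ∘ₗ matMap (fun (τ : Lab (arcRel b c)) (l : Lab (stageRel s bd b c 0)) =>
        if (∀ v : V, l (circ _ (Sum.inl v)) = σ (circ _ v)) ∧
            ∀ i, l (circ _ (Sum.inr i)) = τ (circ _ i) then 1 else 0)

/-- The multiplication `1_a H^n 1_b ⊗ 1_b H^n 1_c → 1_a H^n 1_c` of the arc algebra. -/
def mulH (a b c : Matching n) : H a b →ₗ[ℤ] H b c →ₗ[ℤ] H a c :=
  actMap (fun i j => j = a.partner i) id b c

/-- The elementary idempotent `1_a` of `H^n`: all circles of `W(a) a` are labelled `+`. -/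
def oneH (a : Matching n) : H a a := Finsupp.single (fun _ => 0) 1

/-- The (intrinsic) grading of `H^n`: in `H^n` and in its modules `1` has degree `-1` and `X` has
degree `1`, and `F(W(a) b)` is shifted up by `n`. -/
def degH {a b : Matching n} (σ : Lab (arcRel a b)) : ℤ := n - labDeg σ

end Arc

/-! ### Tangle diagrams -/

/-- Tangle diagrams in a half-plane with `m` end points on the boundary line, in generic position
with respect to the horizontal coordinate, up to planar isotopy.  Sweep the half-plane by a
vertical line, from infinity towards the boundary line; the strands that meet the sweeping line
are numbered `0, 1, …` upwards.  The line passes through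
* `cup i`: an arc appears, whose two ends become the strands `i` and `i + 1`;
* `cap i`: the strands `i` and `i + 1` are joined by an arc and disappear;
* `cross i rising`: the strands `i` and `i + 1` cross; `rising = true` says that the over-strand is
  the one with positive slope in the plane.
The same words describe diagrams in the right half-plane (swept from right to left)
and in the left half-plane (swept from left to right). -/
inductive Tangle : ℕ → Type
  | empty : Tangle 0
  | cup {m : ℕ} (i : Fin (m + 1)) (T : Tangle m) : Tangle (m + 2)
  | cap {m : ℕ} (i : Fin (m + 1)) (T : Tangle (m + 2)) : Tangle m
  | cross {m : ℕ} (i : Fin (m + 1)) (rising : Bool) (T : Tangle (m + 2)) : Tangle (m + 2)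

/-- The combinatorial content of a diagram: a finite set `V` of points on its strands, crossings `X`,
the arcs between points (`turn`: the arc has a vertical tangent, so it turns back horizontally;
`thru`: it runs through horizontally), the four ends of each crossing (at its near or far side,
lower or upper), whether the over-strand of a crossing has positive slope, and the end points. -/
structure Code (m : ℕ) where
  V : Type
  X : Type
  finV : Finite V
  finX : Finite X
  turn : V → V → Prop
  thru : V → V → Prop
  nearLo : X → V
  nearHi : X → V
  farLo : X → V
  farHi : X → V
  rising : X → Bool
  bd : Fin m → V

attribute [instance] Code.finV Code.finX

namespace Code

/-- The diagram without points. -/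
def empty : Code 0 where
  V := Empty
  X := Empty
  finV := inferInstance
  finX := inferInstance
  turn _ _ := False
  thru _ _ := False
  nearLo := Empty.elim
  nearHi := Empty.elim
  farLo := Empty.elim
  farHi := Empty.elim
  rising := Empty.elim
  bd := Fin.elim0

/-- A new arc; its ends are inserted into the list of end points at the places `i`, `i + 1`. -/
def cup {m : ℕ} (i : Fin (m + 1)) (C : Code m) : Code (m + 2) where
  V := C.V ⊕ Fin 2
  X := C.X
  finV := inferInstance
  finX := inferInstance
  turn u v := (∃ u' v', u = .inl u' ∧ v = .inl v' ∧ C.turn u' v') ∨ (u = .inr 0 ∧ v = .inr 1)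
  thru u v := ∃ u' v', u = .inl u' ∧ v = .inl v' ∧ C.thru u' v'
  nearLo x := .inl (C.nearLo x)
  nearHi x := .inl (C.nearHi x)
  farLo x := .inl (C.farLo x)
  farHi x := .inl (C.farHi x)
  rising := C.rising
  bd := Fin.insertNth (α := fun _ => C.V ⊕ Fin 2) i.castSucc (.inr 0)
    (Fin.insertNth (α := fun _ => C.V ⊕ Fin 2) i (.inr 1) fun j => .inl (C.bd j))

/-- The end points `i` and `i + 1` are joined and removed from the list of end points. -/
def cap {m : ℕ} (i : Fin (m + 1)) (C : Code (m + 2)) : Code m where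
  V := C.V
  X := C.X
  finV := inferInstance
  finX := inferInstance
  turn u v := C.turn u v ∨ (u = C.bd i.castSucc ∧ v = C.bd i.succ)
  thru := C.thru
  nearLo := C.nearLo
  nearHi := C.nearHi
  farLo := C.farLo
  farHi := C.farHi
  rising := C.rising
  bd j := C.bd (i.castSucc.succAbove (i.succAbove j))

/-- A new crossing between the strands `i` and `i + 1`; its near ends are the new end points. -/
def cross {m : ℕ} (i : Fin (m + 1)) (rising : Bool) (C : Code (m + 2)) : Code (m + 2) where
  V := C.V ⊕ Fin 2
  X := Option C.X
  finV := inferInstance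
  finX := inferInstance
  turn u v := ∃ u' v', u = .inl u' ∧ v = .inl v' ∧ C.turn u' v'
  thru u v := ∃ u' v', u = .inl u' ∧ v = .inl v' ∧ C.thru u' v'
  nearLo x := x.elim (.inr 0) fun y => .inl (C.nearLo y)
  nearHi x := x.elim (.inr 1) fun y => .inl (C.nearHi y)
  farLo x := x.elim (.inl (C.bd i.castSucc)) fun y => .inl (C.farLo y)
  farHi x := x.elim (.inl (C.bd i.succ)) fun y => .inl (C.farHi y)
  rising x := x.elim rising C.rising
  bd j := if j = i.castSucc then .inr 0 else if j = i.succ then .inr 1 else .inl (C.bd j)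

end Code

/-- The combinatorial content of a tangle diagram. -/
def Tangle.code : {m : ℕ} → Tangle m → Code m
  | _, .empty => Code.empty
  | _, .cup i T => Code.cup i T.code
  | _, .cap i T => Code.cap i T.code
  | _, .cross i rising T => Code.cross i rising T.code

/-- An orientation of a diagram: `dir v` says whether the strand through `v` runs from left to
right in the plane at `v`.  The two strands of a crossing join `nearLo` to `farHi` and
`nearHi` to `farLo`. -/
structure Orientation {m : ℕ} (C : Code m) where
  dir : C.V → Bool
  turn : ∀ u v, C.turn u v → dir u ≠ dir v
  thru : ∀ u v, C.thru u v → dir u = dir v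
  strand : ∀ x, dir (C.nearLo x) = dir (C.farHi x)
  strand' : ∀ x, dir (C.nearHi x) = dir (C.farLo x)

/-- An oriented diagram with an ordering of its crossings. -/
structure Diagram (m : ℕ) where
  code : Code m
  ori : Orientation code
  ord : LinearOrder code.X

namespace Diagram

/-- The underlying code of the horizontal concatenation of a diagram `D₂` in the left half-plane and
a diagram `D₁` in the right half-plane. -/
def glueCode {m : ℕ} (D₂ D₁ : Diagram m) : Code 0 where
  V := D₂.code.V ⊕ D₁.code.V
  X := Lex (D₁.code.X ⊕ D₂.code.X)
  finV := inferInstance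
  finX := inferInstanceAs (Finite (D₁.code.X ⊕ D₂.code.X))
  turn u v := (∃ u' v', u = .inl u' ∧ v = .inl v' ∧ D₂.code.turn u' v') ∨
    (∃ u' v', u = .inr u' ∧ v = .inr v' ∧ D₁.code.turn u' v')
  thru u v := (∃ u' v', u = .inl u' ∧ v = .inl v' ∧ D₂.code.thru u' v') ∨
    (∃ u' v', u = .inr u' ∧ v = .inr v' ∧ D₁.code.thru u' v') ∨
    (∃ j, u = .inl (D₂.code.bd j) ∧ v = .inr (D₁.code.bd j))
  nearLo x := (ofLex x).elim (fun y => .inr (D₁.code.nearLo y)) fun y => .inl (D₂.code.nearLo y)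
  nearHi x := (ofLex x).elim (fun y => .inr (D₁.code.nearHi y)) fun y => .inl (D₂.code.nearHi y)
  farLo x := (ofLex x).elim (fun y => .inr (D₁.code.farLo y)) fun y => .inl (D₂.code.farLo y)
  farHi x := (ofLex x).elim (fun y => .inr (D₁.code.farHi y)) fun y => .inl (D₂.code.farHi y)
  rising x := (ofLex x).elim D₁.code.rising D₂.code.rising
  bd := Fin.elim0

/-- The horizontal concatenation `L` of `D₂` (left half-plane) and `D₁` (right half-plane), whose
orientations agree at the end points; the crossings of `D₁` come before those of `D₂`. -/
def glue {m : ℕ} (D₂ D₁ : Diagram m)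
    (h : ∀ j, D₂.ori.dir (D₂.code.bd j) = D₁.ori.dir (D₁.code.bd j)) : Diagram 0 where
  code := glueCode D₂ D₁
  ori :=
    { dir := Sum.elim D₂.ori.dir D₁.ori.dir
      turn := by
        rintro _ _ (⟨u, v, rfl, rfl, k⟩ | ⟨u, v, rfl, rfl, k⟩)
        · exact D₂.ori.turn u v k
        · exact D₁.ori.turn u v k
      thru := by
        rintro _ _ (⟨u, v, rfl, rfl, k⟩ | ⟨u, v, rfl, rfl, k⟩ | ⟨j, rfl, rfl⟩)
        · exact D₂.ori.thru u v k
        · exact D₁.ori.thru u v k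
        · exact h j
      strand := by
        rintro (x | x)
        · exact D₁.ori.strand x
        · exact D₂.ori.strand x
      strand' := by
        rintro (x | x)
        · exact D₁.ori.strand' x
        · exact D₂.ori.strand' x }
  ord :=
    letI := D₁.ord
    letI := D₂.ord
    inferInstanceAs (LinearOrder (Lex (D₁.code.X ⊕ D₂.code.X)))

/-! ### The cube of resolutions -/

variable {m : ℕ} (D : Diagram m)

/-- A resolution; `true` means the 1-resolution. -/
abbrev Res : Type := D.code.X → Bool

/-- The flat tangle `D_ρ`.  The 0-resolution of a crossing joins the two regions swept out by the
over-strand when it is turned counterclockwise.  So if the over-strand has positive slope, then the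
0-resolution joins the two near ends and the two far ends, and the 1-resolution joins the
lower ends and the upper ends; otherwise it is the other way round. -/
def resRel (ρ : D.Res) (u v : D.code.V) : Prop :=
  D.code.turn u v ∨ D.code.thru u v ∨
  (∃ x, D.code.rising x ≠ ρ x ∧
    ((u = D.code.nearLo x ∧ v = D.code.nearHi x) ∨ (u = D.code.farLo x ∧ v = D.code.farHi x))) ∨
  (∃ x, D.code.rising x = ρ x ∧
    ((u = D.code.nearLo x ∧ v = D.code.farLo x) ∨ (u = D.code.nearHi x ∧ v = D.code.farHi x)))

/-- A crossing is positive if its 0-resolution respects the orientation. The resolution that joins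
near ends to near ends respects the orientation iff the two near ends have opposite directions. -/
def Positive (x : D.code.X) : Prop :=
  D.code.rising x = true ↔ D.ori.dir (D.code.nearLo x) ≠ D.ori.dir (D.code.nearHi x)

/-- The number `n₊` of positive crossings. -/
def nPos : ℕ := Nat.card {x // D.Positive x}

/-- The number `n₋` of negative crossings. -/
def nNeg : ℕ := Nat.card {x // ¬ D.Positive x}

/-- The number of 1-resolutions in `ρ`. -/
def weight (ρ : D.Res) : ℕ := Nat.card {x // ρ x = true}

/-- The number of 1-resolutions in `ρ` at crossings earlier than `x`. -/
def before (ρ : D.Res) (x : D.code.X) : ℕ := Nat.card {y // D.ord.lt y x ∧ ρ y = true}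

/-- Homological degree of a resolution. -/
def hDeg (ρ : D.Res) : ℤ := D.weight ρ - D.nNeg

/-- Generators of the cube complex, for closed 1-manifolds `R ρ` obtained from the `D_ρ`. -/
abbrev CubeGen (R : D.Res → D.code.V → D.code.V → Prop) : Type := Σ ρ : D.Res, Lab (R ρ)

/-- The `q`-degree of a generator in Khovanov homology: with `r` the weight of the resolution, it is
the degree of the labelling plus `r + n₊ - 2 n₋`. -/
def qDeg {R : D.Res → D.code.V → D.code.V → Prop} (x : D.CubeGen R) : ℤ :=
  labDeg x.2 + D.weight x.1 + D.nPos - 2 * D.nNeg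

open Classical in
/-- Matrix coefficient of the differential: change one crossing from the 0- to the 1-resolution,
with the sign `(-1) ^ (number of earlier crossings with the 1-resolution)`. -/
def cubeCoeff (R : D.Res → D.code.V → D.code.V → Prop) (x y : D.CubeGen R) : ℤ :=
  ∑ᶠ c : D.code.X, if x.1 c = false ∧ y.1 = Function.update x.1 c true then
    (-1) ^ D.before x.1 c *
      saddleCoeff (R x.1) (R y.1) (D.code.nearLo c) (D.code.farHi c) x.2 y.2 else 0

/-- The differential of the cube complex. -/
def cubeD (R : D.Res → D.code.V → D.code.V → Prop) :
    (D.CubeGen R →₀ ℤ) →ₗ[ℤ] (D.CubeGen R →₀ ℤ) :=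
  matMap (D.cubeCoeff R)

end Diagram

/-- The summand in bidegree `p` of a free abelian group with a basis of given bidegrees. -/
def basisGr {G : Type} (deg : G → ℤ × ℤ) (p : ℤ × ℤ) : Submodule ℤ (G →₀ ℤ) :=
  Finsupp.supported ℤ ℤ {x | deg x = p}

/-! ### The Khovanov complex of a link diagram -/

section CKh

variable (L : Diagram 0)

/-- The Khovanov complex of a link diagram, as an abelian group. -/
abbrev CKh : Type := L.CubeGen L.resRel →₀ ℤ

/-- The differential of the Khovanov complex. -/
def CKh.d : CKh L →ₗ[ℤ] CKh L := L.cubeD L.resRel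

/-- The bigrading (intrinsic, homological) of the Khovanov complex. -/
def CKh.gr : ℤ × ℤ → Submodule ℤ (CKh L) := basisGr fun x => (L.qDeg x, L.hDeg x.1)

end CKh

/-! ### The complex of a tangle, the Type A structure and the Type D structure -/

section Tangles

variable {n : ℕ} (D : Diagram (2 * n))

/-- The flat tangle `D_ρ`, closed up by the matching `b` in the other half-plane. -/
def clRel (b : Matching n) (ρ : D.Res) : D.code.V → D.code.V → Prop :=
  closeUp (D.resRel ρ) D.code.bd b

/-- Generators of the summand of `[D]^{Kh}` at the idempotent `1_b`. -/
abbrev TGen (b : Matching n) : Type := D.CubeGen (clRel D b)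

/-- The summand at the idempotent `1_b` (that is, `1_b [D]^{Kh}` for `D` in the right half-plane and
`[D]^{Kh} 1_b` for `D` in the left half-plane) of the complex
`[D]^{Kh} = ⨁ b, ⨁ ρ, F(D_ρ closed by b)`. -/
abbrev TKh (b : Matching n) : Type := TGen D b →₀ ℤ

/-- The differential of `[D]^{Kh}`. -/
def TKh.d (b : Matching n) : TKh D b →ₗ[ℤ] TKh D b := D.cubeD (clRel D b)

/-- The right action of `H^n` on `[D]^{Kh}`, for `D` in the left half-plane. -/
def TKh.act (b c : Matching n) : TKh D b →ₗ[ℤ] H b c →ₗ[ℤ] TKh D c :=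
  Finsupp.linearCombination ℤ fun x : TGen D b =>
    Finsupp.lmapDomain ℤ ℤ (Sigma.mk (β := fun ρ => Lab (clRel D c ρ)) x.1)
      ∘ₗ actMap (D.resRel x.1) D.code.bd b c (Finsupp.single x.2 1)

/-- The bigrading of the right module `[D]^{Kh}`, for `D` in the left half-plane. The intrinsic
degree is the negative of the `q`-degree, shifted up by `n`. -/
def grA (b : Matching n) : ℤ × ℤ → Submodule ℤ (TKh D b) :=
  basisGr fun x => (n - D.qDeg x, D.hDeg x.1)

/-- Generators `1 · x` of the Type D structure with idempotent `b`: a resolution whose matching of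
the end points is `b`, and a labelling of the circles of `D_ρ` closed up by `b` for which the
circles that touch the boundary line are labelled `+`. -/
def DGen (b : Matching n) : Type :=
  {x : TGen D b //
    (∀ j, circ (D.resRel x.1) (D.code.bd j) = circ (D.resRel x.1) (D.code.bd (b.partner j))) ∧
    ∀ j, x.2 (circ _ (D.code.bd j)) = 0}

/-- The underlying group of the Type D structure, at the idempotent `b`. -/
abbrev DMod (b : Matching n) : Type := DGen D b →₀ ℤ

/-- Bidegree of a generator of the Type D structure; it is the one of `1 · x` in the left module
`[D]^{Kh}`, in which the intrinsic degree is the negative of the `q`-degree. -/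
def degD {b : Matching n} (x : DGen D b) : ℤ × ℤ := (-D.qDeg x.1, D.hDeg x.1.1)

/-- The bigrading of the Type D structure. -/
def grD (b : Matching n) : ℤ × ℤ → Submodule ℤ (DMod D b) := basisGr (degD D)

/-- The map `|id|` on the Type D structure, multiplication by `(-1) ^ (homological degree)`. -/
def signD (b : Matching n) : DMod D b →ₗ[ℤ] DMod D b :=
  Finsupp.linearCombination ℤ fun x : DGen D b =>
    Finsupp.single x (((degD D x).2.negOnePow : ℤˣ) : ℤ)

/-- The inclusion of the Type D structure into `[D]^{Kh}`. -/
def inclD (b : Matching n) : DMod D b →ₗ[ℤ] TKh D b := Finsupp.lmapDomain ℤ ℤ Subtype.val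

/-- The generator `y` of `1_b [D]^{Kh}` is the product `h · x`, where `h` is the basis element `τ` of
`1_b H^n 1_c`: the circles of `y` that touch the boundary line are labelled as in `τ`, and the free
circles as in `x`. -/
def IsProd {b c : Matching n} (y : TGen D b) (τ : Lab (arcRel b c)) (x : DGen D c) : Prop :=
  x.1.1 = y.1 ∧ (∀ j, y.2 (circ _ (D.code.bd j)) = τ (circ _ j)) ∧
    ∀ v, (∀ j, circ (D.resRel y.1) v ≠ circ (D.resRel y.1) (D.code.bd j)) →
      y.2 (circ _ v) = x.1.2 (circ _ v)

open Classical in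
/-- The identification `[D]^{Kh} ≅ H^n ⊗ (Type D structure)`, the tensor product being over the
idempotent ring: the generator `h · x` goes to `h ⊗ x`. -/
def splitD (b : Matching n) : TKh D b →ₗ[ℤ] ⨁ c, H b c ⊗[ℤ] DMod D c :=
  Finsupp.linearCombination ℤ fun y : TGen D b =>
    ∑ᶠ z : (Σ c : Matching n, Lab (arcRel b c) × DGen D c),
      if IsProd D y z.2.1 z.2.2 then
        DirectSum.lof ℤ (Matching n) (fun c => H b c ⊗[ℤ] DMod D c) z.1
          (Finsupp.single z.2.1 1 ⊗ₜ[ℤ] Finsupp.single z.2.2 1)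
      else 0

/-- The Type D operation `δ`, the restriction of the differential of `[D]^{Kh}`. -/
def deltaD (b : Matching n) : DMod D b →ₗ[ℤ] ⨁ c, H b c ⊗[ℤ] DMod D c :=
  splitD D b ∘ₗ TKh.d D b ∘ₗ inclD D b

end Tangles

/-! ### The box tensor product

Over the idempotent ring `R = ℤ ^ ι`, right and left modules are families of abelian groups
`M i = M e_i` and `N i = e_i N`, and `M ⊗_R N = ⨁ i, M i ⊗ N i`. -/

section Box

open Classical in
/-- The differential `(m₁ ⊗ |id|) + (m₂ ⊗ id) ∘ (id ⊗ δ)` of `A ⊠ N`, for a right dg module `A`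
(a Type A structure with `m_k = 0` for `k ≥ 3`) and a Type D structure `N` over an algebra with
components `B i j = e_i B e_j`. -/
def boxD {ι : Type} {A N : ι → Type} {B : ι → ι → Type}
    [∀ i, AddCommGroup (A i)] [∀ i, AddCommGroup (N i)] [∀ i j, AddCommGroup (B i j)]
    (m₁ : ∀ i, A i →ₗ[ℤ] A i) (m₂ : ∀ i j, A i →ₗ[ℤ] B i j →ₗ[ℤ] A j)
    (sgn : ∀ i, N i →ₗ[ℤ] N i) (δ : ∀ i, N i →ₗ[ℤ] ⨁ j, B i j ⊗[ℤ] N j) :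
    (⨁ i, A i ⊗[ℤ] N i) →ₗ[ℤ] ⨁ i, A i ⊗[ℤ] N i :=
  DirectSum.toModule ℤ ι _ fun i =>
    DirectSum.lof ℤ ι (fun i => A i ⊗[ℤ] N i) i ∘ₗ TensorProduct.map (m₁ i) (sgn i) +
    DirectSum.toModule ℤ ι (M := fun j => A i ⊗[ℤ] (B i j ⊗[ℤ] N j)) (⨁ i, A i ⊗[ℤ] N i) (fun j =>
        DirectSum.lof ℤ ι (fun i => A i ⊗[ℤ] N i) j
          ∘ₗ LinearMap.rTensor (N j) (TensorProduct.lift (m₂ i j))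
          ∘ₗ (TensorProduct.assoc ℤ (A i) (B i j) (N j)).symm.toLinearMap)
      ∘ₗ (TensorProduct.directSumRight ℤ ℤ (A i) fun j => B i j ⊗[ℤ] N j).toLinearMap
      ∘ₗ LinearMap.lTensor (A i) (δ i)

open Classical in
/-- The bigrading of `A ⊠ N`. -/
def boxGr {ι : Type} {A N : ι → Type}
    [∀ i, AddCommGroup (A i)] [∀ i, AddCommGroup (N i)]
    (gA : ∀ i, ℤ × ℤ → Submodule ℤ (A i)) (gN : ∀ i, ℤ × ℤ → Submodule ℤ (N i)) (p : ℤ × ℤ) :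
    Submodule ℤ (⨁ i, A i ⊗[ℤ] N i) :=
  Submodule.span ℤ {z | ∃ (i : ι) (p₁ p₂ : ℤ × ℤ) (a : A i) (x : N i), p₁ + p₂ = p ∧
    a ∈ gA i p₁ ∧ x ∈ gN i p₂ ∧ z = DirectSum.lof ℤ ι (fun i => A i ⊗[ℤ] N i) i (a ⊗ₜ[ℤ] x)}

variable {n : ℕ} (D₂ D₁ : Diagram (2 * n))

/-- `Â(D₂) ⊠ D̂(D₁)` as an abelian group. -/
abbrev Pairing : Type := ⨁ b : Matching n, TKh D₂ b ⊗[ℤ] DMod D₁ b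

/-- The differential of `Â(D₂) ⊠ D̂(D₁)`. -/
def Pairing.d : Pairing D₂ D₁ →ₗ[ℤ] Pairing D₂ D₁ :=
  boxD (TKh.d D₂) (TKh.act D₂) (signD D₁) (deltaD D₁)

/-- The bigrading of `Â(D₂) ⊠ D̂(D₁)`. -/
def Pairing.gr : ℤ × ℤ → Submodule ℤ (Pairing D₂ D₁) := boxGr (grA D₂) (grD D₁)

end Box

end Khov

end

/-! A resolution of `L` is a pair of resolutions `ρ₁` of `T₁` and `ρ₂` of `T₂`. By planarity the
flat tangle `(T₁)_ρ₁` joins the end points in pairs along a crossingless matching `b`, and apart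
from these arcs it consists of free circles. So the circles of `L_ρ` are the circles of `(T₂)_ρ₂`
closed up by `b`, together with the free circles of `(T₁)_ρ₁`. A labelling of `L_ρ` is the same
thing as a generator of the Type A side at the idempotent `b` and a generator of the Type D side at
`b`, on which the circles touching the line carry the redundant label `1`. This is
`glueGen_bijective`; both complexes are free on these generators, and it remains to compare matrix
coefficients.

A crossing of `T₂` gives a saddle that does not see the free circles of `T₁`, so it reproduces `m₁`
(`saddleCoeff_left`). The signs differ: the cube sign contains `(-1) ^ r₁`, whereas `|id|` is `(-1)
^ (r₁ - n₋(T₁))`. The factor `(-1) ^ (n₋(T₁) * r₂)` on generators repairs this (`left_coeff`).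

A crossing of `T₁` has to reproduce `δ` followed by the action of `H^n` (`rightSum_eq_saddleCoeff`).
If the saddle merges or splits with at most one component touching the line on the side where there
are two, the matching `b` stays the same, and `δ` produces either `1_b` or a dot `X` on one circle
of `W(b) b`; the claim then reduces to `m` and `Δ` being maps of `A`-modules. If two arcs of
`(T₁)_ρ₁` are reconnected, `b` changes by a surgery to `b'`, `δ` produces the labelling of `W(b) b'`
by `1`, and this element acts by the saddle between the two arcs.

To evaluate these actions (`actMap_dot`, `actMap_surgery`) the minimal cobordism is followed saddle
by saddle. Every saddle but at most one merges a circle labelled `1` that is still confined to the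
right part, and so changes nothing (`stepMap_stageLab`). The remaining saddle is the multiplication
by `X` or the genuine saddle.

The topology of tangles enters through three facts, proved along the inductive construction of a
diagram: components of a resolution pair up the end points (`Tangle.good`, `Code.res_pair`), this
pairing is crossingless (`Tangle.res_nonCrossing`), and changing the resolution of one crossing
switches two strands (`Code.isSaddle`).

For the gradings, the `n` circles touching the line contribute `n` to the degree of a Type D
generator although their labels are already recorded on the left; this cancels the shift by `n` of
the Type A side (`qDeg_glueGen`). -/

noncomputable section

namespace Khov

/-! ### Circles as classes of a generated equivalence relation; adding an edge -/

section Circles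

variable {V W E α : Type} {r r' r'' : V → V → Prop}

theorem circ_lift (f : V → α) (h : ∀ u v, r u v → f u = f v) {u v : V}
    (e : circ r u = circ r v) : f u = f v :=
  congrArg (Quot.lift f h) e

theorem circ_of {u v : V} (h : r u v) : circ r u = circ r v := Quot.sound h

theorem circ_map {R : W → W → Prop} (φ : V → W)
    (h : ∀ u v, r u v → circ R (φ u) = circ R (φ v)) {u v : V}
    (e : circ r u = circ r v) : circ R (φ u) = circ R (φ v) :=
  circ_lift (fun u => circ R (φ u)) h e

/-- Two relations generate the same equivalence relation. -/
def Same (r r' : V → V → Prop) : Prop := ∀ u v, circ r u = circ r v ↔ circ r' u = circ r' v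

theorem Same.symm (h : Same r r') : Same r' r := fun u v => (h u v).symm

theorem Same.trans (h : Same r r') (h' : Same r' r'') : Same r r'' :=
  fun u v => (h u v).trans (h' u v)

theorem same_of (h : ∀ u v, r u v → circ r' u = circ r' v)
    (h' : ∀ u v, r' u v → circ r u = circ r v) : Same r r' :=
  fun _ _ => ⟨circ_map id h, circ_map id h'⟩

/-- The relation `r` with one more edge. -/
def addE (r : V → V → Prop) (a b : V) : V → V → Prop := fun u v => r u v ∨ (u = a ∧ v = b)

theorem circ_addE {a b u v : V} : circ (addE r a b) u = circ (addE r a b) v ↔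
    circ r u = circ r v ∨ (circ r u = circ r a ∧ circ r v = circ r b) ∨
      (circ r u = circ r b ∧ circ r v = circ r a) := by
  classical
  constructor
  · intro h
    -- Collapsing the class of `b` onto that of `a` is an invariant of the enlarged relation.
    have := circ_lift (fun u => if circ r u = circ r b then circ r a else circ r u)
      (by
        rintro u v (h | ⟨rfl, rfl⟩)
        · simp only [circ_of h]
        · simp) h
    grind
  · have hm : ∀ {u v}, circ r u = circ r v → circ (addE r a b) u = circ (addE r a b) v :=
      fun h => circ_map (R := addE r a b) id (fun u v h => circ_of (Or.inl h)) h
    have hab : circ (addE r a b) a = circ (addE r a b) b := circ_of (Or.inr ⟨rfl, rfl⟩)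
    rintro (h | ⟨h, h'⟩ | ⟨h, h'⟩)
    · exact hm h
    · rw [hm h, hm h', hab]
    · rw [hm h, hm h', hab]

theorem Same.addE (h : Same r r') (a b : V) : Same (addE r a b) (addE r' a b) := by
  intro u v
  rw [circ_addE, circ_addE, h u v, h u a, h v b, h u b, h v a]

/-- Each class that contains an end point from `P` contains exactly two of them. -/
def Good (r : V → V → Prop) (e : E → V) (P : Set E) : Prop :=
  ∀ i ∈ P, ∃ i' ∈ P, i' ≠ i ∧ ∀ k ∈ P, circ r (e i) = circ r (e k) ↔ k = i ∨ k = i'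

theorem Good.congr {e : E → V} {P : Set E} (h : Good r e P) (hs : Same r r') : Good r' e P := by
  intro i hi
  obtain ⟨i', hi', hne, hk⟩ := h i hi
  exact ⟨i', hi', hne, fun k hkP => (hs _ _).symm.trans (hk k hkP)⟩

/-- Joining two ends of different components leaves their two mates as the ends of the new
component. If the two ends are mates of each other, a closed circle arises and the other pairs are
unaffected. -/
theorem Good.addE {e : E → V} {P : Set E} (h : Good r e P) {i₁ i₂ : E} (h₁ : i₁ ∈ P) (h₂ : i₂ ∈ P)
    (hne : i₁ ≠ i₂) : Good (addE r (e i₁) (e i₂)) e (P \ {i₁, i₂}) := by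
  rintro i ⟨hi, hi'⟩
  simp only [Set.mem_insert_iff, Set.mem_singleton_iff, not_or] at hi'
  obtain ⟨a, ha, hai, hak⟩ := h i hi
  obtain ⟨m₁, hm₁, hne₁, hmk₁⟩ := h i₁ h₁
  obtain ⟨m₂, hm₂, hne₂, hmk₂⟩ := h i₂ h₂
  simp only [Set.mem_sdiff, Set.mem_insert_iff, Set.mem_singleton_iff, not_or, circ_addE]
  by_cases ha₁ : a = i₁
  · refine ⟨m₂, ⟨hm₂, ?_, hne₂⟩, ?_, ?_⟩ <;> grind
  by_cases ha₂ : a = i₂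
  · refine ⟨m₁, ⟨hm₁, hne₁, ?_⟩, ?_, ?_⟩ <;> grind
  refine ⟨a, ⟨ha, ha₁, ha₂⟩, hai, ?_⟩
  grind

end Circles

/-! ### Labellings and the matrix coefficients of a saddle -/

section Labels

variable {V W : Type} {r r' : V → V → Prop}

theorem lab_ext {σ τ : Lab r} (h : ∀ v, σ (circ r v) = τ (circ r v)) : σ = τ := by
  funext c
  induction c using Quot.ind with
  | mk v => exact h v

/-- The labelling with a given value at each point. -/
def labOf (r : V → V → Prop) (f : V → Fin 2) : Lab r := fun c => f c.out

theorem labOf_circ {f : V → Fin 2} (h : ∀ u v, r u v → f u = f v) (v : V) :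
    labOf r f (circ r v) = f v :=
  circ_lift f h (Quot.out_eq (circ r v))

theorem matMap_single {S T : Type} [Finite T] (c : S → T → ℤ) (x : S) (y : T) :
    matMap c (Finsupp.single x 1) y = c x y := by
  simp [matMap]

theorem matMap_single_eq {S T : Type} [Finite T] [DecidableEq T] (c : S → T → ℤ) (x : S) (y : T)
    (h : ∀ z, c x z = if z = y then 1 else 0) :
    matMap c (Finsupp.single x 1) = Finsupp.single y 1 := by
  ext z
  rw [matMap_single, h, Finsupp.single_apply]
  simp [eq_comm]

theorem matMap_single_sum {S T : Type} [Fintype T] (c : S → T → ℤ) (x : S) :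
    matMap c (Finsupp.single x 1) = ∑ y, c x y • Finsupp.single y (1 : ℤ) := by
  classical
  ext z
  rw [matMap_single, Finsupp.finsetSum_apply]
  simp [Finsupp.single_apply]

open Classical in
theorem saddleCoeff_merge {p q : V} (h : circ r p ≠ circ r q) (h' : circ r' p = circ r' q)
    (σ : Lab r) (σ' : Lab r') : saddleCoeff r r' p q σ σ' =
      if (∀ v, circ r v ≠ circ r p → circ r v ≠ circ r q → σ (circ r v) = σ' (circ r' v)) ∧
        (σ (circ r p) : ℕ) + σ (circ r q) = σ' (circ r' p) then 1 else 0 := by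
  unfold saddleCoeff mCoeff
  simp only [if_pos (show circ r p ≠ circ r q ∧ circ r' p = circ r' q from ⟨h, h'⟩), ite_and]

open Classical in
theorem saddleCoeff_split {p q : V} (h : circ r p = circ r q) (h' : circ r' p ≠ circ r' q)
    (σ : Lab r) (σ' : Lab r') : saddleCoeff r r' p q σ σ' =
      if (∀ v, circ r v ≠ circ r p → circ r v ≠ circ r q → σ (circ r v) = σ' (circ r' v)) ∧
        (σ' (circ r' p) : ℕ) + σ' (circ r' q) = σ (circ r p) + 1 then 1 else 0 := by
  unfold saddleCoeff comCoeff
  simp only [if_neg (show ¬(circ r p ≠ circ r q ∧ circ r' p = circ r' q) from fun k => k.1 h),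
    if_pos (show circ r p = circ r q ∧ circ r' p ≠ circ r' q from ⟨h, h'⟩), ite_and]

theorem saddleCoeff_zero {p q : V} (h : circ r p = circ r q ↔ circ r' p = circ r' q)
    (σ : Lab r) (σ' : Lab r') : saddleCoeff r r' p q σ σ' = 0 := by
  unfold saddleCoeff
  simp only [if_neg (show ¬(circ r p ≠ circ r q ∧ circ r' p = circ r' q) from
      fun k => k.1 (h.2 k.2)),
    if_neg (show ¬(circ r p = circ r q ∧ circ r' p ≠ circ r' q) from fun k => k.2 (h.1 k.1)),
    ite_self]

/-- The coefficient of a saddle depends only on the classes of the two marked points. -/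
theorem saddleCoeff_mark {p q p₁ q₁ : V}
    (h : (circ r p₁ = circ r p ∧ circ r q₁ = circ r q) ∨
      (circ r p₁ = circ r q ∧ circ r q₁ = circ r p))
    (h' : (circ r' p₁ = circ r' p ∧ circ r' q₁ = circ r' q) ∨
      (circ r' p₁ = circ r' q ∧ circ r' q₁ = circ r' p)) (σ : Lab r) (σ' : Lab r') :
    saddleCoeff r r' p₁ q₁ σ σ' = saddleCoeff r r' p q σ σ' := by
  have e : circ r p₁ = circ r q₁ ↔ circ r p = circ r q := by
    rcases h with ⟨h, k⟩ | ⟨h, k⟩ <;> rw [h, k]; exact eq_comm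
  have e' : circ r' p₁ = circ r' q₁ ↔ circ r' p = circ r' q := by
    rcases h' with ⟨h', k'⟩ | ⟨h', k'⟩ <;> rw [h', k']; exact eq_comm
  by_cases k : circ r p = circ r q <;> by_cases k' : circ r' p = circ r' q
  · rw [saddleCoeff_zero (by grind), saddleCoeff_zero (by grind)]
  · rw [saddleCoeff_split (by grind) (by grind), saddleCoeff_split k k']
    congr 1
    rw [eq_iff_iff]
    rcases h with ⟨h, k⟩ | ⟨h, k⟩ <;> rcases h' with ⟨h', k'⟩ | ⟨h', k'⟩ <;> grind
  · rw [saddleCoeff_merge (by grind) (by grind), saddleCoeff_merge k k']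
    congr 1
    rw [eq_iff_iff]
    rcases h with ⟨h, k⟩ | ⟨h, k⟩ <;> rcases h' with ⟨h', k'⟩ | ⟨h', k'⟩ <;> grind
  · rw [saddleCoeff_zero (by grind), saddleCoeff_zero (by grind)]

theorem saddleCoeff_comm {p q : V} (σ : Lab r) (σ' : Lab r') :
    saddleCoeff r r' p q σ σ' = saddleCoeff r r' q p σ σ' :=
  saddleCoeff_mark (Or.inr ⟨rfl, rfl⟩) (Or.inr ⟨rfl, rfl⟩) σ σ'

/-- The coefficient sees only which marked points share a circle, their four labels, and the
agreement of all other labels. This allows saddles on manifolds with different point sets to be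
compared: a stage of the cobordism, a closed-up tangle, a glued manifold. -/
theorem saddleCoeff_congr {R R' : W → W → Prop} {p q : V} {P Q : W} {σ : Lab r} {σ' : Lab r'}
    {τ : Lab R} {τ' : Lab R'} (hpq : circ r p = circ r q ↔ circ R P = circ R Q)
    (hpq' : circ r' p = circ r' q ↔ circ R' P = circ R' Q)
    (hp : σ (circ r p) = τ (circ R P)) (hq : σ (circ r q) = τ (circ R Q))
    (hp' : σ' (circ r' p) = τ' (circ R' P)) (hq' : σ' (circ r' q) = τ' (circ R' Q))
    (hrest : (∀ v, circ r v ≠ circ r p → circ r v ≠ circ r q → σ (circ r v) = σ' (circ r' v)) ↔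
      ∀ w, circ R w ≠ circ R P → circ R w ≠ circ R Q → τ (circ R w) = τ' (circ R' w)) :
    saddleCoeff r r' p q σ σ' = saddleCoeff R R' P Q τ τ' := by
  classical
  unfold saddleCoeff
  simp only [ne_eq, hpq, hpq', hp, hq, hp', hq'] at hrest ⊢
  simp only [hrest]

open Classical in
/-- A saddle that merges two circles sends a labelling to at most one labelling. -/
theorem saddleCoeff_merge_eq {p q : V} (h : circ r p ≠ circ r q) (h' : Same r' (addE r p q))
    {σ : Lab r} {κ : Lab r'}
    (hκ : ∀ v, circ r v ≠ circ r p → circ r v ≠ circ r q → σ (circ r v) = κ (circ r' v))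
    (hs : (σ (circ r p) : ℕ) + σ (circ r q) = κ (circ r' p)) (σ' : Lab r') :
    saddleCoeff r r' p q σ σ' = if σ' = κ then 1 else 0 := by
  have hc : ∀ u v, circ r' u = circ r' v ↔ _ := fun u v => (h' u v).trans circ_addE
  have hpq : circ r' p = circ r' q := (hc p q).2 (Or.inr (Or.inl ⟨rfl, rfl⟩))
  rw [saddleCoeff_merge h hpq, hs]
  congr 1
  rw [eq_iff_iff]
  constructor
  · rintro ⟨h1, h2⟩
    refine lab_ext fun v => ?_
    have e : κ (circ r' p) = σ' (circ r' p) := Fin.ext h2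
    by_cases hv : circ r v = circ r p
    · rw [(hc v p).2 (Or.inl hv), e]
    by_cases hv' : circ r v = circ r q
    · rw [(hc v p).2 (Or.inr (Or.inr ⟨hv', rfl⟩)), e]
    rw [← h1 v hv hv', hκ v hv hv']
  · rintro rfl
    exact ⟨hκ, rfl⟩

/-- This is `X * X = 0`: the exponent `1 + 1` is not a value of `Fin 2`. -/
theorem saddleCoeff_merge_eq_zero {p q : V} (h : circ r p ≠ circ r q) (h' : Same r' (addE r p q))
    {σ : Lab r} (hp : σ (circ r p) = 1) (hq : σ (circ r q) = 1) (σ' : Lab r') :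
    saddleCoeff r r' p q σ σ' = 0 := by
  rw [saddleCoeff_merge h ((h' p q).2 (circ_addE.2 (Or.inr (Or.inl ⟨rfl, rfl⟩)))), hp, hq]
  refine if_neg fun hc => ?_
  have := hc.2
  simp at this
  omega

theorem rest_of_saddleCoeff_ne_zero {p q : V} {σ : Lab r} {σ' : Lab r'}
    (h : saddleCoeff r r' p q σ σ' ≠ 0) :
    ∀ v, circ r v ≠ circ r p → circ r v ≠ circ r q → σ (circ r v) = σ' (circ r' v) := by
  by_contra hc
  exact h (if_neg hc)

end Labels

/-! ### The stages of the minimal cobordism when `b` and `c` commute -/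

section Stages

variable {n : ℕ} {V α : Type} {s : V → V → Prop} {bd : Fin (2 * n) → V} {b c : Matching n}

/-- The lower end point of the arc through `j`. -/
abbrev low (b : Matching n) (j : Fin (2 * n)) : ℕ := ((min j (b.partner j) : Fin (2 * n)) : ℕ)

theorem low_partner (b : Matching n) (j : Fin (2 * n)) : low b (b.partner j) = low b j := by
  simp only [low, b.invol, min_comm]

theorem low_eq_iff {b : Matching n} {i j : Fin (2 * n)} :
    low b i = low b j ↔ i = j ∨ i = b.partner j := by
  constructor
  · intro h
    have h' : min i (b.partner i) = min j (b.partner j) := Fin.ext h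
    rcases min_choice i (b.partner i) with hi | hi <;>
      rcases min_choice j (b.partner j) with hj | hj <;> rw [hi, hj] at h'
    · exact Or.inl h'
    · exact Or.inr h'
    · exact Or.inr (by rw [← h', b.invol])
    · exact Or.inl (by rw [← b.invol i, h', b.invol])
  · rintro (rfl | rfl)
    · rfl
    · exact low_partner b j

theorem low_of_lt {b : Matching n} {j : Fin (2 * n)} (h : j < b.partner j) : low b j = j := by
  simp only [low, min_eq_left h.le]

theorem low_lt (b : Matching n) (j : Fin (2 * n)) : low b j < 2 * n := Fin.is_lt _

theorem partner_inj {b : Matching n} {i j : Fin (2 * n)} (h : b.partner i = b.partner j) : i = j := by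
  rw [← b.invol i, h, b.invol]

/-- A function on the points of `S` and one on the end points give a function on the points of
stage `k` of the minimal cobordism. -/
def stageFun (b c : Matching n) (bd : Fin (2 * n) → V) (k : ℕ) (f : V → α) (t : Fin (2 * n) → α) :
    V ⊕ Fin (2 * n) → α
  | .inl v => f v
  -- As `b` and `c` commute, the circle of `W(b) c` through `i` meets only the arcs of `b` through
  -- `i` and `c.partner i`. If one of them has been replaced, a horizontal segment connects the
  -- circle to the left part and its label is read off there; otherwise the circle is untouched and
  -- keeps its label from `t`.
  | .inr i => if low b i < k then f (bd i) else
      if low b (c.partner i) < k then f (bd (c.partner i)) else t i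

/-- The conditions under which `stageFun` is constant on the circles of stage `k`. -/
structure StageOK (s : V → V → Prop) (b c : Matching n) (bd : Fin (2 * n) → V) (k : ℕ) (f : V → α)
    (t : Fin (2 * n) → α) : Prop where
  rel : ∀ u v, s u v → f u = f v
  -- In the second alternative the arc of `b` on the left may be gone, but the path through the arcs
  -- of `c` and the surviving arc of `W(b)` at `c.partner j` still connects the two points.
  arcb : ∀ j, k ≤ low b j ∨ k ≤ low b (c.partner j) → f (bd j) = f (bd (b.partner j))
  arcc : ∀ j, low b j < k → low b (c.partner j) < k → f (bd j) = f (bd (c.partner j))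
  tb : ∀ j, t j = t (b.partner j)
  tc : ∀ j, t j = t (c.partner j)

theorem StageOK.stageFun_eq (hbc : ∀ i, b.partner (c.partner i) = c.partner (b.partner i)) {k : ℕ}
    {f : V → α} {t : Fin (2 * n) → α} (h : StageOK s b c bd k f t) (x y : V ⊕ Fin (2 * n))
    (hxy : stageRel s bd b c k x y) : stageFun b c bd k f t x = stageFun b c bd k f t y := by
  rcases x with u | i <;> rcases y with v | j
  · rcases hxy with hxy | ⟨j, hj, rfl, rfl⟩
    · exact h.rel u v hxy
    · exact h.arcb j (Or.inl hj)
  · obtain ⟨rfl, hj⟩ := hxy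
    simp only [stageFun, if_pos hj]
  · exact hxy.elim
  · have h1 := h.arcb (c.partner i)
    have h2 := h.arcc i
    have h3 := h.tb i
    have h4 := h.tc i
    rcases hxy with rfl | ⟨hk, rfl⟩
    · simp only [stageFun, c.invol]
      grind
    · simp only [stageFun, low_partner, ← hbc, c.invol] at h1 ⊢
      grind

/-- As long as both arcs of `b` on a circle of `W(b) c` are intact, no segment leads from this
circle to the left part, so it consists of at most four points on the right. -/
theorem stage_circ_inr (hbc : ∀ i, b.partner (c.partner i) = c.partner (b.partner i)) {k : ℕ}
    {j : Fin (2 * n)} (hj : k ≤ low b j) (hcj : k ≤ low b (c.partner j)) {x : V ⊕ Fin (2 * n)}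
    (hx : circ (stageRel s bd b c k) x = circ _ (Sum.inr j)) :
    x = .inr j ∨ x = .inr (b.partner j) ∨ x = .inr (c.partner j) ∨
      x = .inr (c.partner (b.partner j)) := by
  -- Membership in the four-point orbit is a `Prop`-valued invariant of the relation.
  have h := circ_lift (fun x => x = .inr j ∨ x = .inr (b.partner j) ∨ x = .inr (c.partner j) ∨
      x = .inr (c.partner (b.partner j))) ?_ hx
  · exact (iff_of_eq h).2 (Or.inl rfl)
  · have hj' := low_partner b j
    have hcj' := low_partner b (c.partner j)
    have hb := b.invol
    have hc := c.invol
    rintro (u | i) (v | i') hxy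
    · simp
    · obtain ⟨rfl, h⟩ := hxy
      simp only [reduceCtorEq, Sum.inr.injEq, false_or, eq_iff_iff, false_iff, not_or]
      change low b i' < k at h
      grind
    · exact hxy.elim
    · simp only [Sum.inr.injEq, eq_iff_iff]
      rcases hxy with rfl | ⟨-, rfl⟩ <;> grind

/-- A step of the minimal cobordism at which the arc on the right closes up on its own. -/
theorem stage_same (hbc : ∀ i, b.partner (c.partner i) = c.partner (b.partner i)) {k : ℕ}
    {j : Fin (2 * n)} (hj : low b j = k) (hcj : k ≤ low b (c.partner j)) :
    Same (stageRel s bd b c (k + 1))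
      (addE (stageRel s bd b c k) (Sum.inl (bd j)) (Sum.inr (b.partner j))) := by
  have e1 : ∀ i, circ (stageRel s bd b c (k + 1)) (Sum.inr i) = circ _ (Sum.inr (c.partner i)) :=
    fun i => circ_of (Or.inl rfl)
  have e2 : ∀ i, k + 1 ≤ low b i → circ (stageRel s bd b c (k + 1)) (Sum.inr i) =
      circ _ (Sum.inr (b.partner i)) := fun i hi => circ_of (Or.inr ⟨hi, rfl⟩)
  have e3 : ∀ i, low b i < k + 1 → circ (stageRel s bd b c (k + 1)) (Sum.inl (bd i)) =
      circ _ (Sum.inr i) := fun i hi => circ_of ⟨rfl, hi⟩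
  -- After the saddle, `j` and `b.partner j` are still connected on the right: directly by an arc of
  -- `c`, or through the other arc of `b` on this circle, which has not been replaced yet.
  have e4 : circ (stageRel s bd b c (k + 1)) (Sum.inr j) = circ _ (Sum.inr (b.partner j)) := by
    by_cases h : c.partner j = b.partner j
    · rw [e1, h]
    · have : k + 1 ≤ low b (c.partner j) := by
        rcases hcj.lt_or_eq with h' | h'
        · exact h'
        · rcases low_eq_iff.1 (h'.symm.trans hj.symm) with h' | h'
          · exact absurd h' (c.ne_self j)
          · exact absurd h' h
      rw [e1, e2 _ this, hbc, ← e1]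
  have e5 : circ (stageRel s bd b c (k + 1)) (Sum.inl (bd j)) =
      circ _ (Sum.inl (bd (b.partner j))) := by
    rw [e3 j (by omega), e4, e3 (b.partner j) (by rw [low_partner]; omega)]
  have hk : ∀ i, low b i = k → i = j ∨ i = b.partner j :=
    fun i hi => low_eq_iff.1 (hi.trans hj.symm)
  set R := addE (stageRel s bd b c k) (Sum.inl (bd j)) (Sum.inr (b.partner j)) with hR
  have a0 : ∀ x y, stageRel s bd b c k x y → circ R x = circ R y := fun x y h => circ_of (Or.inl h)
  have a1 : circ R (Sum.inl (bd j)) = circ R (Sum.inr (b.partner j)) := circ_of (Or.inr ⟨rfl, rfl⟩)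
  have a2 : circ R (Sum.inr j) = circ R (Sum.inr (b.partner j)) := a0 _ _ (Or.inr ⟨hj.ge, rfl⟩)
  have a3 : circ R (Sum.inl (bd j)) = circ R (Sum.inl (bd (b.partner j))) :=
    a0 _ _ (Or.inr ⟨j, hj.ge, rfl, rfl⟩)
  refine same_of ?_ ?_
  · rintro (u | i) (v | i') h
    · rcases h with h | ⟨i, hi, rfl, rfl⟩
      · exact a0 _ _ (Or.inl h)
      · exact a0 _ _ (Or.inr ⟨i, by omega, rfl, rfl⟩)
    · obtain ⟨rfl, hi⟩ := h
      rcases (Nat.lt_succ_iff.1 hi).lt_or_eq with h | h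
      · exact a0 _ _ ⟨rfl, h⟩
      · rcases hk i' h with rfl | rfl
        · rw [a1, a2]
        · rw [← a3, a1]
    · exact h.elim
    · rcases h with rfl | ⟨hi, rfl⟩
      · exact a0 _ _ (Or.inl rfl)
      · exact a0 _ _ (Or.inr ⟨by omega, rfl⟩)
  · rintro (u | i) (v | i') (h | ⟨h, h'⟩)
    · rcases h with h | ⟨i, hi, rfl, rfl⟩
      · exact circ_of (Or.inl h)
      · rcases (show k ≤ low b i from hi).lt_or_eq with h | h
        · exact circ_of (Or.inr ⟨i, h, rfl, rfl⟩)
        · rcases hk i h.symm with rfl | rfl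
          · exact e5
          · rw [b.invol]; exact e5.symm
    · cases h'
    · obtain ⟨rfl, hi⟩ := h
      exact e3 _ (Nat.lt_succ_of_lt hi)
    · cases h; cases h'
      rw [e5]
      exact e3 _ (by rw [low_partner]; omega)
    · exact h.elim
    · cases h
    · rcases h with rfl | ⟨hi, rfl⟩
      · exact e1 i
      · rcases (show k ≤ low b i from hi).lt_or_eq with h | h
        · exact e2 i h
        · rcases hk i h.symm with rfl | rfl
          · exact e4
          · rw [b.invol]; exact e4.symm
    · cases h

end Stages

/-! ### The action of `1_b` and of a dot on one circle of `W(b) b` -/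

section Action

variable {n : ℕ} {V : Type} {s : V → V → Prop} {bd : Fin (2 * n) → V}
  {b c : Matching n}

theorem closeUp_arc (j : Fin (2 * n)) :
    circ (closeUp s bd b) (bd j) = circ _ (bd (b.partner j)) :=
  circ_of (Or.inr ⟨j, rfl, rfl⟩)

/-- The labelling of the circles of stage `k` given by a function on the points of `S` and one on
the end points. -/
abbrev stageLab (s : V → V → Prop) (b c : Matching n) (bd : Fin (2 * n) → V) (k : ℕ)
    (f : V → Fin 2) (t : Fin (2 * n) → Fin 2) : Lab (stageRel s bd b c k) :=
  labOf _ (stageFun b c bd k f t)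

theorem stageLab_circ (hbc : ∀ i, b.partner (c.partner i) = c.partner (b.partner i)) {k : ℕ}
    {f : V → Fin 2} {t : Fin (2 * n) → Fin 2} (h : StageOK s b c bd k f t) (x : V ⊕ Fin (2 * n)) :
    stageLab s b c bd k f t (circ _ x) = stageFun b c bd k f t x :=
  labOf_circ (h.stageFun_eq hbc) x

theorem exists_low (b : Matching n) (i : Fin (2 * n)) : ∃ j : Fin (2 * n), (j : ℕ) = low b i ∧ j < b.partner j ∧
    (j = i ∨ j = b.partner i) := by
  rcases lt_or_gt_of_ne (b.ne_self i) with h | h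
  · refine ⟨b.partner i, ?_, ?_, Or.inr rfl⟩
    · simp only [low, min_eq_right h.le]
    · rwa [b.invol]
  · exact ⟨i, by simp only [low, min_eq_left h.le], h, Or.inl rfl⟩

theorem stageOK_zero (σ : Lab (closeUp s bd b)) (τ : Lab (arcRel b c)) :
    StageOK s b c bd 0 (fun v => σ (circ _ v)) fun i => τ (circ _ i) where
  rel _ _ h := congrArg σ (circ_of (Or.inl h))
  arcb j _ := congrArg σ (closeUp_arc j)
  arcc j h := absurd h (by omega)
  tb j := congrArg τ (circ_of (Or.inl rfl))
  tc j := congrArg τ (circ_of (Or.inr ⟨j, rfl, rfl⟩))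

theorem stageOK_self (k : ℕ) (σ : Lab (closeUp s bd b)) (τ : Lab (arcRel b b)) :
    StageOK s b b bd k (fun v => σ (circ _ v)) fun i => τ (circ _ i) where
  rel _ _ h := congrArg σ (circ_of (Or.inl h))
  arcb j _ := congrArg σ (closeUp_arc j)
  arcc j _ _ := congrArg σ (closeUp_arc j)
  tb _ := congrArg τ (circ_of (Or.inl rfl))
  tc _ := congrArg τ (circ_of (Or.inl rfl))

theorem stage_of_closeUp {k : ℕ} {u v : V} (h : circ (closeUp s bd b) u = circ (closeUp s bd b) v) :
    circ (stageRel s bd b b k) (Sum.inl u) = circ _ (Sum.inl v) := by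
  refine circ_map Sum.inl ?_ h
  rintro u v (h | ⟨j, rfl, rfl⟩)
  · exact circ_of (Or.inl h)
  · by_cases hk : k ≤ low b j
    · exact circ_of (Or.inr ⟨j, hk, rfl, rfl⟩)
    · have e : ∀ i, low b i < k → circ (stageRel s bd b b k) (Sum.inl (bd i)) = circ _ (Sum.inr i) :=
        fun i hi => circ_of ⟨rfl, hi⟩
      rw [e j (not_le.1 hk), e (b.partner j) (by rw [low_partner]; exact not_le.1 hk)]
      exact circ_of (Or.inl rfl)

variable [Finite V]

theorem stepMap_apply {k : ℕ} {j : Fin (2 * n)} (hj : (j : ℕ) = k) (hlt : j < b.partner j)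
    (σ : Lab (stageRel s bd b c k)) (σ' : Lab (stageRel s bd b c (k + 1))) :
    stepMap s bd b c k (Finsupp.single σ 1) σ' =
      saddleCoeff _ _ (Sum.inl (bd j)) (Sum.inr (b.partner j)) σ σ' := by
  have h : ∃ j : Fin (2 * n), (j : ℕ) = k ∧ j < b.partner j := ⟨j, hj, hlt⟩
  have hc : h.choose = j := Fin.ext (h.choose_spec.1.trans hj.symm)
  rw [stepMap, matMap_single, dif_pos h, hc]

/-- Such a step merges a circle that lies entirely on the right and is labelled `1`. Multiplication
by the unit changes no label, so the same pair `(f, t)` describes the labelling at the next stage.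
If `k` is not the lower end of an arc, the two stages have the same labels anyway. -/
theorem stepMap_stageLab (hbc : ∀ i, b.partner (c.partner i) = c.partner (b.partner i)) {k : ℕ}
    {f : V → Fin 2} {t : Fin (2 * n) → Fin 2} (h : StageOK s b c bd k f t)
    (h' : StageOK s b c bd (k + 1) f t)
    (hstep : ∀ j : Fin (2 * n), (j : ℕ) = k → j < b.partner j → k ≤ low b (c.partner j) ∧ t j = 0) :
    stepMap s bd b c k (Finsupp.single (stageLab s b c bd k f t) 1) =
      Finsupp.single (stageLab s b c bd (k + 1) f t) 1 := by
  classical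
  have hl := stageLab_circ hbc h
  have hl' := stageLab_circ hbc h'
  by_cases hj : ∃ j : Fin (2 * n), (j : ℕ) = k ∧ j < b.partner j
  · obtain ⟨j, hj, hlt⟩ := hj
    obtain ⟨hcj, ht⟩ := hstep j hj hlt
    have hlow : low b j = k := (low_of_lt hlt).trans hj
    have hlow' := low_partner b j
    have hlow'' := low_partner b (c.partner j)
    have hq : stageFun b c bd k f t (Sum.inr (b.partner j)) = 0 := by
      rw [stageFun, if_neg (by omega), ← hbc, if_neg (by omega), ← h.tb, ht]
    have e1 : circ (stageRel s bd b c k) (Sum.inr j) = circ _ (Sum.inr (b.partner j)) :=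
      circ_of (Or.inr ⟨hlow.ge, rfl⟩)
    have e2 : ∀ i, circ (stageRel s bd b c k) (Sum.inr i) = circ _ (Sum.inr (c.partner i)) :=
      fun i => circ_of (Or.inl rfl)
    have hne : circ (stageRel s bd b c k) (Sum.inl (bd j)) ≠ circ _ (Sum.inr (b.partner j)) := by
      intro he
      have := stage_circ_inr hbc hlow.ge hcj (he.trans e1.symm)
      simp at this
    ext μ
    rw [stepMap_apply hj hlt, saddleCoeff_merge_eq hne (stage_same hbc hlow hcj)
      (κ := stageLab s b c bd (k + 1) f t), Finsupp.single_apply]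
    · simp only [eq_comm]
    · rintro (v | i) hp hq
      · rw [hl, hl']; rfl
      · rw [hl, hl']
        have h1 : low b i ≠ k := by
          intro hi
          rcases low_eq_iff.1 (hi.trans hlow.symm) with rfl | rfl
          · exact hq e1
          · exact hq rfl
        have h2 : low b (c.partner i) ≠ k := by
          intro hi
          rcases low_eq_iff.1 (hi.trans hlow.symm) with hi | hi
          · exact hq (by rw [e2, hi, e1])
          · exact hq (by rw [e2, hi])
        have h3 : low b i < k + 1 ↔ low b i < k := by omega
        have h4 : low b (c.partner i) < k + 1 ↔ low b (c.partner i) < k := by omega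
        simp only [stageFun, h3, h4]
    · rw [hl, hl', hl, hq]; rfl
  · have hno : ∀ i, low b i ≠ k := by
      intro i hi
      obtain ⟨j, h1, h2, -⟩ := exists_low b i
      exact hj ⟨j, h1.trans hi, h2⟩
    have hfun : stageFun b c bd k f t = stageFun b c bd (k + 1) f t := by
      funext x
      rcases x with v | i
      · rfl
      · have h1 := hno i
        have h2 := hno (c.partner i)
        have h3 : low b i < k + 1 ↔ low b i < k := by omega
        have h4 : low b (c.partner i) < k + 1 ↔ low b (c.partner i) < k := by omega
        simp only [stageFun, h3, h4]
    refine matMap_single_eq _ _ _ fun μ => ?_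
    rw [dif_neg hj]
    congr 1
    rw [eq_iff_iff]
    constructor
    · intro hv
      exact lab_ext fun v => by rw [← hv, hl, hl', hfun]
    · rintro rfl v
      rw [hl, hl', hfun]

/-- Iterates `stepMap_stageLab` over a range of unit steps. Linear combinations are needed because
the genuine saddle of a surgery can produce several labellings, which are then carried through the
remaining steps. -/
theorem runMap_stageLab (hbc : ∀ i, b.partner (c.partner i) = c.partner (b.partner i))
    {x : F (stageRel s bd b c 0)} {ι : Type} [Fintype ι] {a : ι → ℤ} {f : ι → V → Fin 2}
    {t : Fin (2 * n) → Fin 2} {m : ℕ}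
    (hx : runMap s bd b c m x = ∑ i, a i • Finsupp.single (stageLab s b c bd m (f i) t) 1)
    {m' : ℕ} (hm : m ≤ m') (h : ∀ i k, m ≤ k → k ≤ m' → StageOK s b c bd k (f i) t)
    (hstep : ∀ k, m ≤ k → k < m' → ∀ j : Fin (2 * n), (j : ℕ) = k → j < b.partner j →
      k ≤ low b (c.partner j) ∧ t j = 0) :
    runMap s bd b c m' x = ∑ i, a i • Finsupp.single (stageLab s b c bd m' (f i) t) 1 := by
  induction m', hm using Nat.le_induction with
  | base => exact hx
  | succ k hk ih =>
    rw [runMap, LinearMap.comp_apply, ih (fun i l h1 h2 => h i l h1 (h2.trans k.le_succ))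
      (fun l h1 h2 => hstep l h1 (h2.trans k.lt_succ_self)), map_sum]
    refine Finset.sum_congr rfl fun i _ => ?_
    rw [map_smul, stepMap_stageLab hbc (h i k hk k.le_succ) (h i (k + 1) (hk.trans k.le_succ) le_rfl)
      (hstep k hk k.lt_succ_self)]

/-- The first map in `actMap`. -/
abbrev actInit (s : V → V → Prop) (bd : Fin (2 * n) → V) (b c : Matching n)
    (σ : Lab (closeUp s bd b)) (τ : Lab (arcRel b c)) : F (stageRel s bd b c 0) :=
  Finsupp.single (stageLab s b c bd 0 (fun v => σ (circ _ v)) fun i => τ (circ _ i)) 1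

/-- Reduces the action to `runMap`: at stage `0` the labels are the given pair, and at stage `2 * n`
every arc has been replaced, so the labels on the left determine the whole labelling. -/
theorem actMap_single (hbc : ∀ i, b.partner (c.partner i) = c.partner (b.partner i))
    (σ : Lab (closeUp s bd b)) (τ : Lab (arcRel b c))
    {ι : Type} [Fintype ι] {a : ι → ℤ} {σ' : ι → Lab (closeUp s bd c)}
    (h : runMap s bd b c (2 * n) (actInit s bd b c σ τ) = ∑ i, a i • Finsupp.single
      (stageLab s b c bd (2 * n) (fun v => σ' i (circ _ v)) fun i => τ (circ _ i)) 1) :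
    actMap s bd b c (Finsupp.single σ 1) (Finsupp.single τ 1) = ∑ i, a i • Finsupp.single (σ' i) 1 := by
  classical
  have h0 : (matMap (fun (τ : Lab (arcRel b c)) (l : Lab (stageRel s bd b c 0)) =>
        if (∀ v : V, l (circ _ (Sum.inl v)) = σ (circ _ v)) ∧
            ∀ i, l (circ _ (Sum.inr i)) = τ (circ _ i) then 1 else 0)) (Finsupp.single τ 1) =
      actInit s bd b c σ τ := by
    have hl := stageLab_circ hbc (stageOK_zero (s := s) (bd := bd) σ τ)
    refine matMap_single_eq _ _ _ fun l => ?_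
    congr 1
    rw [eq_iff_iff]
    constructor
    · rintro ⟨h1, h2⟩
      refine lab_ext ?_
      rintro (v | i)
      · rw [hl, h1]; rfl
      · rw [hl, h2]; simp [stageFun]
    · rintro rfl
      exact ⟨fun v => hl _, fun i => (hl _).trans (by simp [stageFun])⟩
  have hend : ∀ i, StageOK s b c bd (2 * n) (fun v => σ' i (circ _ v)) fun i => τ (circ _ i) := by
    intro i
    refine ⟨fun u v h => congrArg (σ' i) (circ_of (Or.inl h)), fun j hj => ?_,
      fun j _ _ => congrArg (σ' i) (closeUp_arc j),
      (stageOK_zero σ τ).tb, (stageOK_zero σ τ).tc⟩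
    have := low_lt b j
    have := low_lt b (c.partner j)
    omega
  rw [actMap, Finsupp.linearCombination_single, one_smul, LinearMap.comp_apply, LinearMap.comp_apply]
  erw [h0]
  rw [h, map_sum]
  refine Finset.sum_congr rfl fun i _ => ?_
  rw [map_smul]
  congr 1
  have hl := stageLab_circ hbc (hend i)
  refine matMap_single_eq _ _ _ fun σ'' => ?_
  congr 1
  rw [eq_iff_iff]
  constructor
  · intro hv
    exact lab_ext fun v => by rw [hv, hl]; rfl
  · rintro rfl v
    rw [hl]; rfl

theorem runMap_zero_actInit (σ : Lab (closeUp s bd b)) (τ : Lab (arcRel b c)) :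
    runMap s bd b c 0 (actInit s bd b c σ τ) = ∑ _i : Unit, (1 : ℤ) •
      Finsupp.single (stageLab s b c bd 0 (fun v => σ (circ _ v)) fun i => τ (circ _ i)) 1 := by
  simp [runMap]

/-- The idempotent `1_b` acts as the identity. -/
theorem actMap_one (σ : Lab (closeUp s bd b)) {τ : Lab (arcRel b b)} (hτ : ∀ i, τ (circ _ i) = 0) :
    actMap s bd b b (Finsupp.single σ 1) (Finsupp.single τ 1) = Finsupp.single σ 1 := by
  have h := runMap_stageLab (fun _ => rfl) (runMap_zero_actInit σ τ) (Nat.zero_le (2 * n))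
    (fun _ k _ _ => stageOK_self k σ τ)
    (fun k _ _ j hj hlt => ⟨by rw [low_partner, low_of_lt hlt, hj], hτ j⟩)
  rw [actMap_single (fun _ => rfl) σ τ (σ' := fun _ => σ) h]
  simp

open Classical in
/-- Multiplication by `X ^ t` on one arc. -/
theorem actMap_dot (σ σ' : Lab (closeUp s bd b)) {τ : Lab (arcRel b b)} (j : Fin (2 * n)) (t : Fin 2)
    (hτ : ∀ i, τ (circ _ i) = if i = j ∨ i = b.partner j then t else 0) :
    actMap s bd b b (Finsupp.single σ 1) (Finsupp.single τ 1) σ' =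
      if (∀ v, circ (closeUp s bd b) v ≠ circ _ (bd j) → σ (circ _ v) = σ' (circ _ v)) ∧
        (σ (circ _ (bd j)) : ℕ) + t = σ' (circ _ (bd j)) then 1 else 0 := by
  obtain rfl | rfl : t = 0 ∨ t = 1 := by omega
  · rw [actMap_one σ (by simpa using hτ), Finsupp.single_apply]
    congr 1
    rw [eq_iff_iff]
    constructor
    · rintro rfl; simp
    · rintro ⟨h1, h2⟩
      refine lab_ext fun v => ?_
      by_cases hv : circ (closeUp s bd b) v = circ _ (bd j)
      · rw [hv]; exact Fin.ext h2
      · exact h1 v hv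
  -- The saddle of an arc takes place at the stage numbered by its lower end.
  wlog hlt : j < b.partner j generalizing j
  · have hb : circ (closeUp s bd b) (bd (b.partner j)) = circ _ (bd j) :=
      (closeUp_arc j).symm
    rw [this (b.partner j) (by simp only [hτ, b.invol, or_comm, implies_true]), hb]
    rw [b.invol]
    exact lt_of_le_of_ne (not_lt.1 hlt) (b.ne_self j)
  have hlow := low_of_lt hlt
  have hb : circ (closeUp s bd b) (bd (b.partner j)) = circ _ (bd j) :=
    (closeUp_arc j).symm
  -- All steps other than the one at `j` merge a circle labelled `1`.
  have hτ' : ∀ k, k ≠ (j : ℕ) → ∀ i : Fin (2 * n), (i : ℕ) = k → i < b.partner i →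
      k ≤ low b (b.partner i) ∧ τ (circ _ i) = 0 := by
    intro k hk i hi hilt
    refine ⟨by rw [low_partner, low_of_lt hilt, hi], ?_⟩
    rw [hτ, if_neg]
    rintro (rfl | rfl)
    · exact hk hi.symm
    · rw [b.invol] at hilt
      exact lt_asymm hlt hilt
  have h1 := runMap_stageLab (fun _ => rfl) (runMap_zero_actInit σ τ) (Nat.zero_le (j : ℕ))
    (fun _ k _ _ => stageOK_self k σ τ) (fun k _ hk => hτ' k hk.ne)
  have hl := stageLab_circ (fun _ => rfl) (stageOK_self (j : ℕ) σ τ)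
  -- The only possible result of multiplying the circle through `bd j` by `X`. It occurs if this
  -- circle was labelled `1`, and the product vanishes if it was labelled `X`.
  let σ₁ : Lab (closeUp s bd b) := fun x => if x = circ _ (bd j) then 1 else σ x
  have hl₁ := stageLab_circ (fun _ => rfl) (stageOK_self ((j : ℕ) + 1) σ₁ τ)
  have e1 : circ (stageRel s bd b b j) (Sum.inr j) = circ _ (Sum.inr (b.partner j)) :=
      circ_of (Or.inl rfl)
  have hne : circ (stageRel s bd b b j) (Sum.inl (bd j)) ≠ circ _ (Sum.inr (b.partner j)) := by
    intro he
    have := stage_circ_inr (fun _ => rfl) hlow.ge (by rw [low_partner, hlow]) (he.trans e1.symm)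
    simp at this
  have hsame := stage_same (s := s) (bd := bd) (b := b) (c := b) (fun _ => rfl) hlow
    (by rw [low_partner, hlow])
  have hq : stageFun b b bd j (fun v => σ (circ _ v)) (fun i => τ (circ _ i))
      (Sum.inr (b.partner j)) = 1 := by
    have := low_partner b j
    rw [stageFun, if_neg (by omega), b.invol, if_neg (by omega), hτ, if_pos (Or.inr rfl)]
  have h2 : runMap s bd b b (j + 1) (actInit s bd b b σ τ) = ∑ _i : Unit,
      (if σ (circ _ (bd j)) = 0 then (1 : ℤ) else 0) • Finsupp.single (stageLab s b b bd (j + 1)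
        (fun v => σ₁ (circ _ v)) fun i => τ (circ _ i)) 1 := by
    rw [runMap, LinearMap.comp_apply, h1]
    simp only [Finset.univ_unique, Finset.sum_singleton, one_smul]
    ext μ
    rw [stepMap_apply rfl hlt]
    split_ifs with h0
    · rw [saddleCoeff_merge_eq hne hsame (κ := stageLab s b b bd (j + 1)
        (fun v => σ₁ (circ _ v)) fun i => τ (circ _ i)), one_smul, Finsupp.single_apply]
      · simp only [eq_comm]
      · rintro (v | i) hp hq'
        · rw [hl, hl₁]
          simp only [stageFun, σ₁]
          rw [if_neg]
          intro hv
          exact hp (stage_of_closeUp hv)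
        · rw [hl, hl₁]
          have hk : low b i ≠ j := by
            intro hi
            rcases low_eq_iff.1 (hi.trans hlow.symm) with rfl | rfl
            · exact hq' e1
            · exact hq' rfl
          have hk' : low b i < j + 1 ↔ low b i < j := by omega
          simp only [stageFun, low_partner, σ₁, hk']
          split_ifs with h3 h4
          · have e : circ (stageRel s bd b b j) (Sum.inl (bd i)) = circ _ (Sum.inr i) :=
              circ_of ⟨rfl, h3⟩
            exact absurd (e.symm.trans (stage_of_closeUp h4)) hp
          · rfl
          · rfl
      · rw [hl, hl, hl₁, hq]
        simp [stageFun, σ₁, h0]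
    · rw [saddleCoeff_merge_eq_zero hne hsame]
      · simp
      · rw [hl]
        simp only [stageFun]
        omega
      · rw [hl, hq]
  have h3 := runMap_stageLab (fun _ => rfl) h2 (show (j : ℕ) + 1 ≤ 2 * n from j.2)
    (fun _ k _ _ => stageOK_self k σ₁ τ) (fun k hk _ => hτ' k (by omega))
  rw [actMap_single (fun _ => rfl) σ τ (σ' := fun _ => σ₁) h3]
  simp only [Finset.univ_unique, Finset.sum_singleton, Finsupp.smul_single, smul_eq_mul, mul_one,
    Finsupp.single_apply]
  have hσ₁ : ∀ v, σ₁ (circ _ v) = if circ _ v = circ _ (bd j) then 1 else σ (circ _ v) :=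
    fun _ => rfl
  rw [← ite_and]
  congr 1
  rw [eq_iff_iff]
  constructor
  · rintro ⟨rfl, h0⟩
    exact ⟨fun v hv => by rw [hσ₁, if_neg hv], by rw [hσ₁, if_pos rfl, h0]; rfl⟩
  · rintro ⟨h1, h2⟩
    refine ⟨lab_ext fun v => ?_, by simp at h2; omega⟩
    rw [hσ₁]
    split_ifs with hv
    · rw [hv]; simp at h2; omega
    · exact h1 v hv

end Action

/-! ### The action of the labelling by `1` when two arcs are reconnected -/

section Surgery

variable {n : ℕ} {V : Type} {s : V → V → Prop} {bd : Fin (2 * n) → V} {b c : Matching n}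

/-- `c` arises from `b` by a surgery along the arcs of `b` through `j` and `c.partner j`. -/
structure IsSurgery (b c : Matching n) (j : Fin (2 * n)) : Prop where
  comm : ∀ i, b.partner (c.partner i) = c.partner (b.partner i)
  ne : c.partner j ≠ b.partner j
  other : ∀ i, i ≠ j → i ≠ b.partner j → i ≠ c.partner j → i ≠ c.partner (b.partner j) →
    c.partner i = b.partner i

theorem IsSurgery.low_or (h : IsSurgery b c j) (i : Fin (2 * n)) : c.partner i = b.partner i ∨
    (low b i = low b j ∧ low b (c.partner i) = low b (c.partner j)) ∨
    (low b i = low b (c.partner j) ∧ low b (c.partner i) = low b j) := by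
  have h1 := h.other i
  have h2 := low_partner b j
  have h3 := low_partner b (c.partner j)
  have h4 := h.comm j
  have h5 := c.invol
  grind

theorem IsSurgery.low_ne (h : IsSurgery b c j) : low b j ≠ low b (c.partner j) := by
  intro he
  rcases low_eq_iff.1 he.symm with h' | h'
  · exact c.ne_self j h'
  · exact h.ne h'

theorem IsSurgery.stageOK_before (h : IsSurgery b c j) {k : ℕ}
    (hk : k ≤ low b j ∨ k ≤ low b (c.partner j)) {α : Type} {f : V → α}
    (hf : ∀ u v, closeUp s bd b u v → f u = f v) (a : α) : StageOK s b c bd k f fun _ => a where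
  rel _ _ h := hf _ _ (Or.inl h)
  arcb j _ := hf _ _ (Or.inr ⟨j, rfl, rfl⟩)
  arcc i h1 h2 := by
    rcases h.low_or i with h' | h' | h'
    · rw [h']; exact hf _ _ (Or.inr ⟨i, rfl, rfl⟩)
    · omega
    · omega
  tb _ := rfl
  tc _ := rfl

theorem IsSurgery.stageOK_after (h : IsSurgery b c j) {k : ℕ}
    (hk : low b j < k) (hk' : low b (c.partner j) < k) {α : Type} {f : V → α}
    (hf : ∀ u v, closeUp s bd c u v → f u = f v) (a : α) : StageOK s b c bd k f fun _ => a where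
  rel _ _ h := hf _ _ (Or.inl h)
  arcb i hi := by
    rcases h.low_or i with h' | h' | h'
    · rw [← h']; exact hf _ _ (Or.inr ⟨i, rfl, rfl⟩)
    · omega
    · omega
  arcc i _ _ := hf _ _ (Or.inr ⟨i, rfl, rfl⟩)
  tb _ := rfl
  tc _ := rfl

/-- The first of the two arcs involved only merges an isolated circle into the left part, so the
circles on the left remain those of the closure by `b` until the second arc is replaced. From then
on `stage_after` describes them by `c`. -/
theorem IsSurgery.stage_before (h : IsSurgery b c j) {k : ℕ}
    (hk : k ≤ low b j ∨ k ≤ low b (c.partner j)) (u v : V) :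
    circ (stageRel s bd b c k) (.inl u) = circ _ (.inl v) ↔
      circ (closeUp s bd b) u = circ _ v := by
  constructor
  · intro hc
    -- The class in the closure serves as the invariant; `none` is the value on circles of the right
    -- part that have no connection to the left yet.
    have := circ_lift _ ((h.stageOK_before hk (f := fun v => some (circ (closeUp s bd b) v))
      (fun u v h => congrArg some (circ_of h)) none).stageFun_eq h.comm) hc
    simpa [stageFun] using this
  · refine circ_map Sum.inl ?_
    rintro u v (h' | ⟨i, rfl, rfl⟩)
    · exact circ_of (Or.inl h')
    by_cases hi : k ≤ low b i
    · exact circ_of (Or.inr ⟨i, hi, rfl, rfl⟩)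
    have e : ∀ i, low b i < k → circ (stageRel s bd b c k) (Sum.inl (bd i)) = circ _ (Sum.inr i) :=
      fun i hi => circ_of ⟨rfl, hi⟩
    have e' : ∀ i, circ (stageRel s bd b c k) (Sum.inr i) = circ _ (Sum.inr (c.partner i)) :=
      fun i => circ_of (Or.inl rfl)
    rw [e i (not_le.1 hi), e (b.partner i) (by rw [low_partner]; exact not_le.1 hi), e' i]
    by_cases h' : c.partner i = b.partner i
    · rw [h']
    have hk' : k ≤ low b (c.partner i) := by have := h.low_or i; omega
    rw [e' (b.partner i), ← h.comm]
    exact circ_of (Or.inr ⟨hk', rfl⟩)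

theorem IsSurgery.stage_after (h : IsSurgery b c j) {k : ℕ}
    (hk : low b j < k) (hk' : low b (c.partner j) < k) (u v : V) :
    circ (stageRel s bd b c k) (.inl u) = circ _ (.inl v) ↔
      circ (closeUp s bd c) u = circ _ v := by
  constructor
  · intro hc
    have := circ_lift _ ((h.stageOK_after hk hk' (f := fun v => some (circ (closeUp s bd c) v))
      (fun u v h => congrArg some (circ_of h)) none).stageFun_eq h.comm) hc
    simpa [stageFun] using this
  · refine circ_map Sum.inl ?_
    rintro u v (h' | ⟨i, rfl, rfl⟩)
    · exact circ_of (Or.inl h')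
    by_cases hi : k ≤ low b i
    · rcases h.low_or i with h' | h' | h'
      · rw [h']; exact circ_of (Or.inr ⟨i, hi, rfl, rfl⟩)
      · omega
      · omega
    · have e : ∀ i, low b i < k → circ (stageRel s bd b c k) (Sum.inl (bd i)) = circ _ (Sum.inr i) :=
        fun i hi => circ_of ⟨rfl, hi⟩
      rw [e i (not_le.1 hi), e (c.partner i) (by have := h.low_or i; have := low_partner b i; grind)]
      exact circ_of (Or.inl rfl)

theorem IsSurgery.partner_left (h : IsSurgery b c j) : IsSurgery b c (b.partner j) := by
  have h1 := h.comm
  have h2 := h.ne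
  have h3 := h.other
  have h4 := b.invol
  have h5 := c.invol
  exact ⟨h1, by grind, by grind⟩

theorem IsSurgery.partner_right (h : IsSurgery b c j) : IsSurgery b c (c.partner j) := by
  have h1 := h.comm
  have h2 := h.ne
  have h3 := h.other
  have h4 := b.invol
  have h5 := c.invol
  exact ⟨h1, by grind, by grind⟩

variable [Finite V]

/-- The end point `j` is chosen as the lower end of the later of the two arcs. Every earlier step is
a unit step (the earlier arc of the pair included), the step at `j` is the genuine saddle from the
closure by `b` to the closure by `c`, and all later steps are unit steps again. -/
theorem actMap_surgery_aux (h : IsSurgery b c j) (hlt : j < b.partner j)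
    (hc : low b (c.partner j) < low b j)
    (σ : Lab (closeUp s bd b)) (σ' : Lab (closeUp s bd c)) {τ : Lab (arcRel b c)}
    (hτ : ∀ i, τ (circ _ i) = 0) :
    actMap s bd b c (Finsupp.single σ 1) (Finsupp.single τ 1) σ' =
      saddleCoeff (closeUp s bd b) (closeUp s bd c) (bd j) (bd (c.partner (b.partner j))) σ σ' := by
  classical
  have hlow := low_of_lt hlt
  have hlowb := low_partner b j
  have hlowcb : low b (c.partner (b.partner j)) = low b (c.partner j) := by
    rw [← h.comm, low_partner]
  have hτ' : (fun i => τ (circ _ i)) = fun _ => 0 := funext hτ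
  have := Fintype.ofFinite (Lab (closeUp s bd c))
  have hσ : ∀ u v, closeUp s bd b u v → σ (circ _ u) = σ (circ _ v) :=
    fun u v h => congrArg σ (circ_of h)
  have hσ' : ∀ (σ' : Lab (closeUp s bd c)) u v, closeUp s bd c u v →
    σ' (circ _ u) = σ' (circ _ v) := fun σ' u v h => congrArg σ' (circ_of h)
  have hr := runMap_zero_actInit σ τ
  rw [hτ'] at hr
  have h1 := runMap_stageLab h.comm hr (Nat.zero_le (j : ℕ))
    (fun _ k _ hk => h.stageOK_before (Or.inl (hk.trans hlow.ge)) hσ 0)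
    (fun k _ hk i hi hilt => ⟨by
      have := h.low_or i
      have := low_of_lt hilt
      have := low_partner b i
      grind, rfl⟩)
  let κ : Lab (closeUp s bd c) → Lab (stageRel s bd b c (j + 1)) := fun σ' =>
    stageLab s b c bd (j + 1) (fun v => σ' (circ _ v)) fun _ => 0
  have hl := stageLab_circ h.comm (h.stageOK_before (bd := bd) (k := j) (Or.inl hlow.ge) hσ 0)
  have hκ : ∀ σ' x, κ σ' (circ _ x) = stageFun b c bd (j + 1) (fun v => σ' (circ _ v)) _ x :=
    fun σ' => stageLab_circ h.comm
      (h.stageOK_after (bd := bd) (k := j + 1) (by omega) (by omega) (hσ' σ') 0)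
  have hκinj : ∀ σ₁ σ₂, κ σ₁ = κ σ₂ → σ₁ = σ₂ := by
    intro σ₁ σ₂ he
    refine lab_ext fun v => ?_
    have := congrFun he (circ _ (Sum.inl v))
    rwa [hκ, hκ] at this
  have hbefore := h.stage_before (s := s) (bd := bd) (k := j) (Or.inl hlow.ge)
  have hafter := h.stage_after (s := s) (bd := bd) (k := j + 1) (by omega) (by omega)
  have e0 : ∀ i, circ (stageRel s bd b c j) (Sum.inr i) = circ _ (Sum.inr (c.partner i)) :=
    fun i => circ_of (Or.inl rfl)
  have e1 : ∀ i, circ (stageRel s bd b c (j + 1)) (Sum.inr i) = circ _ (Sum.inr (c.partner i)) :=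
    fun i => circ_of (Or.inl rfl)
  have d0 : ∀ i, low b i < j → circ (stageRel s bd b c j) (Sum.inl (bd i)) = circ _ (Sum.inr i) :=
    fun i hi => circ_of ⟨rfl, hi⟩
  have d1 : ∀ i, low b i < j + 1 →
      circ (stageRel s bd b c (j + 1)) (Sum.inl (bd i)) = circ _ (Sum.inr i) :=
    fun i hi => circ_of ⟨rfl, hi⟩
  -- The earlier arc has already been replaced, so the marked point on the right can be moved along
  -- an arc of `c` to a point on the left.
  have hq0 : circ (stageRel s bd b c j) (Sum.inr (b.partner j)) =
      circ _ (Sum.inl (bd (c.partner (b.partner j)))) := by rw [e0, d0 _ (by omega)]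
  have hq1 : circ (stageRel s bd b c (j + 1)) (Sum.inr (b.partner j)) =
      circ _ (Sum.inl (bd (c.partner (b.partner j)))) := by rw [e1, d1 _ (by omega)]
  have hbj : circ (stageRel s bd b c j) (Sum.inr j) = circ _ (Sum.inr (b.partner j)) :=
    circ_of (Or.inr ⟨hlow.ge, rfl⟩)
  have hA : ∀ σ' : Lab (closeUp s bd c), saddleCoeff _ _ (Sum.inl (bd j)) (Sum.inr (b.partner j))
      (stageLab s b c bd j (fun v => σ (circ _ v)) fun _ => 0) (κ σ') =
        saddleCoeff (closeUp s bd b) (closeUp s bd c) (bd j) (bd (c.partner (b.partner j))) σ σ' := by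
    intro σ'
    rw [saddleCoeff_mark (p := Sum.inl (bd j)) (q := Sum.inl (bd (c.partner (b.partner j))))
      (Or.inl ⟨rfl, hq0⟩) (Or.inl ⟨rfl, hq1⟩)]
    symm
    refine saddleCoeff_congr (hbefore _ _).symm (hafter _ _).symm ?_ ?_ ?_ ?_ ?_
    · rw [hl]; rfl
    · rw [hl]; rfl
    · rw [hκ]; rfl
    · rw [hκ]; rfl
    constructor
    · rintro hv (v | i) hp hq
      · rw [hl, hκ]
        exact hv v (fun k => hp ((hbefore _ _).2 k)) (fun k => hq ((hbefore _ _).2 k))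
      · rw [hl, hκ]
        have hi : low b i ≠ j := by
          intro hi
          rcases low_eq_iff.1 (hi.trans hlow.symm) with rfl | rfl
          · exact hq (hbj.trans hq0)
          · exact hq hq0
        by_cases hi' : low b i < j
        · rw [stageFun, if_pos hi', stageFun, if_pos (by omega)]
          rw [← d0 i hi'] at hp hq
          exact hv _ (fun k => hp ((hbefore _ _).2 k)) (fun k => hq ((hbefore _ _).2 k))
        · have hci : low b (c.partner i) = low b i := by
            have := h.low_or i
            have := low_partner b i
            grind
          rw [stageFun, stageFun, if_neg (by omega), if_neg (by omega), if_neg (by omega),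
            if_neg (by omega)]
    · intro hv v hp hq
      have := hv (Sum.inl v) (fun k => hp ((hbefore _ _).1 k)) (fun k => hq ((hbefore _ _).1 k))
      rwa [hl, hκ] at this
  -- A labelling reached with nonzero coefficient is determined by its left part: every circle still
  -- confined to the right is away from the saddle and keeps its label `1`.
  have hB : ∀ μ, saddleCoeff _ _ (Sum.inl (bd j)) (Sum.inr (b.partner j))
      (stageLab s b c bd j (fun v => σ (circ _ v)) fun _ => 0) μ ≠ 0 → ∃ σ', μ = κ σ' := by
    intro μ hμ
    have hrest := rest_of_saddleCoeff_ne_zero hμ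
    let f : V → Fin 2 := fun v => μ (circ _ (Sum.inl v))
    have hf : ∀ v, labOf (closeUp s bd c) f (circ _ v) = f v := labOf_circ fun u v huv =>
      congrArg μ ((hafter u v).2 (circ_of huv))
    refine ⟨labOf _ f, lab_ext ?_⟩
    rintro (v | i)
    · rw [hκ, stageFun, hf]
    · rw [hκ, stageFun]
      split_ifs with h2 h3
      · rw [hf, ← d1 i h2]
      · exfalso
        have := h.low_or i
        have := low_partner b i
        grind
      · have hij : c.partner i = b.partner i := by
          have := h.low_or i
          have := low_partner b i
          grind
        have hcirc : ∀ x, circ (stageRel s bd b c j) x = circ _ (Sum.inr i) →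
            x = .inr i ∨ x = .inr (b.partner i) := by
          intro x hx
          have := stage_circ_inr h.comm (by omega) (by omega) hx
          rw [hij, ← hij, c.invol] at this
          grind
        have hib : low b (b.partner i) = low b i := low_partner b i
        rw [← hrest, hl, stageFun, if_neg (by omega), if_neg (by omega)]
        · intro he
          have := hcirc _ he.symm
          simp at this
        · intro he
          rcases hcirc _ he.symm with h4 | h4
          · obtain rfl := Sum.inr.inj h4
            omega
          · have := partner_inj (Sum.inr.inj h4)
            subst this
            omega
  have h2 : runMap s bd b c (j + 1) (actInit s bd b c σ τ) = ∑ σ' : Lab (closeUp s bd c),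
      saddleCoeff (closeUp s bd b) (closeUp s bd c) (bd j) (bd (c.partner (b.partner j))) σ σ' •
        Finsupp.single (κ σ') 1 := by
    rw [runMap, LinearMap.comp_apply, h1]
    simp only [Finset.univ_unique, Finset.sum_singleton, one_smul]
    ext μ
    rw [stepMap_apply rfl hlt, Finsupp.finsetSum_apply]
    by_cases hμ : ∃ σ', μ = κ σ'
    · obtain ⟨σ₁, rfl⟩ := hμ
      rw [hA, Finset.sum_eq_single σ₁]
      · simp
      · intro σ₂ _ hne
        rw [Finsupp.smul_apply, Finsupp.single_apply, if_neg fun he => hne (hκinj _ _ he), smul_zero]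
      · simp
    · rw [Finset.sum_eq_zero]
      · by_contra hne
        exact hμ (hB μ hne)
      · intro σ₂ _
        rw [Finsupp.smul_apply, Finsupp.single_apply, if_neg fun he => hμ ⟨σ₂, he.symm⟩, smul_zero]
  have h3 := runMap_stageLab h.comm h2 (show (j : ℕ) + 1 ≤ 2 * n from j.2)
    (fun σ' k hk _ => h.stageOK_after (by omega) (by omega) (hσ' σ') 0)
    (fun k hk _ i hi hilt => ⟨by
      have := h.low_or i
      have := low_of_lt hilt
      have := low_partner b i
      grind, rfl⟩)
  rw [actMap_single h.comm σ τ (σ' := id) (by rw [hτ']; exact h3), Finsupp.finsetSum_apply,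
    Finset.sum_eq_single σ']
  · simp
  · intro σ₂ _ hne
    rw [Finsupp.smul_apply, id, Finsupp.single_apply, if_neg hne, smul_zero]
  · simp

/-- The action of the labelling of `W(b) c` by `1`, if `c` arises from `b` by a surgery. -/
theorem actMap_surgery (h : IsSurgery b c j)
    (σ : Lab (closeUp s bd b)) (σ' : Lab (closeUp s bd c)) {τ : Lab (arcRel b c)}
    (hτ : ∀ i, τ (circ _ i) = 0) :
    actMap s bd b c (Finsupp.single σ 1) (Finsupp.single τ 1) σ' =
      saddleCoeff (closeUp s bd b) (closeUp s bd c) (bd j) (bd (c.partner (b.partner j))) σ σ' := by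
  -- Passing to `b.partner j` or `c.partner j` permutes the four ends and arranges the normalization
  -- of `actMap_surgery_aux`. The marked points then move only within their circles, or the two
  -- trade places, which does not affect the coefficient.
  have key : ∀ j, IsSurgery b c j → low b (c.partner j) < low b j →
      actMap s bd b c (Finsupp.single σ 1) (Finsupp.single τ 1) σ' =
      saddleCoeff (closeUp s bd b) (closeUp s bd c) (bd j) (bd (c.partner (b.partner j))) σ σ' := by
    intro j h hc
    rcases lt_or_gt_of_ne (b.ne_self j) with hlt | hlt
    · rw [actMap_surgery_aux h.partner_left (by rwa [b.invol])
        (by rwa [← h.comm, low_partner, low_partner]) σ σ' hτ, b.invol]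
      refine saddleCoeff_mark (Or.inl ⟨(closeUp_arc j).symm, ?_⟩) (Or.inr ⟨closeUp_arc _, ?_⟩) σ σ'
      · rw [← h.comm, ← closeUp_arc]
      · exact (closeUp_arc j).symm
    · exact actMap_surgery_aux h hlt hc σ σ' hτ
  rcases lt_or_gt_of_ne h.low_ne with hlt | hlt
  · rw [key _ h.partner_right (by rwa [c.invol]), h.comm, c.invol]
    refine saddleCoeff_mark (Or.inr ⟨?_, (closeUp_arc j).symm⟩)
      (Or.inl ⟨(closeUp_arc j).symm, closeUp_arc _⟩) σ σ'
    rw [← h.comm, ← closeUp_arc]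
  · exact key j h hlt

end Surgery

/-! ### Gluing a 1-manifold to one whose components realize a matching -/

section Glue

variable {n : ℕ} {V₁ V₂ α : Type} {s s' : V₂ → V₂ → Prop} {r r' : V₁ → V₁ → Prop}
  {bd₂ : Fin (2 * n) → V₂} {bd₁ : Fin (2 * n) → V₁} {b b' : Matching n}

/-- The union of two 1-manifolds, glued at the boundary points. -/
def glueRel (s : V₂ → V₂ → Prop) (bd₂ : Fin (2 * n) → V₂) (r : V₁ → V₁ → Prop)
    (bd₁ : Fin (2 * n) → V₁) : V₂ ⊕ V₁ → V₂ ⊕ V₁ → Prop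
  | .inl u, .inl v => s u v
  | .inr u, .inr v => r u v
  | .inl u, .inr v => ∃ j, u = bd₂ j ∧ v = bd₁ j
  | .inr _, .inl _ => False

/-- The component of `v` touches the boundary. -/
def Touch (r : V₁ → V₁ → Prop) (bd₁ : Fin (2 * n) → V₁) (v : V₁) : Prop :=
  ∃ j, circ r v = circ r (bd₁ j)

/-- The components of `r` connect the boundary points as the matching `b`. -/
def IsMatch (r : V₁ → V₁ → Prop) (bd₁ : Fin (2 * n) → V₁) (b : Matching n) : Prop :=
  ∀ j k, circ r (bd₁ j) = circ r (bd₁ k) ↔ k = j ∨ k = b.partner j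

theorem IsMatch.arc (h : IsMatch r bd₁ b) (j : Fin (2 * n)) :
    circ r (bd₁ j) = circ r (bd₁ (b.partner j)) := (h _ _).2 (Or.inr rfl)

theorem IsMatch.closeUp_same (h : IsMatch r bd₁ b) : Same (closeUp r bd₁ b) r :=
  same_of (by
    rintro u v (h' | ⟨j, rfl, rfl⟩)
    · exact circ_of h'
    · exact h.arc j) fun u v h' => circ_of (Or.inl h')

theorem Matching.eq_of_partner (h : ∀ j, b.partner j = b'.partner j) : b = b' := by
  cases b; cases b'
  congr
  exact funext h

/-- The classes of `r'` may be coarser than those of `r`. Hence a saddle that only merges or only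
splits components does not change the matching. -/
theorem IsMatch.unique (h : IsMatch r bd₁ b) (h' : IsMatch r' bd₁ b')
    (hr : ∀ u v, circ r u = circ r v → circ r' u = circ r' v) : b = b' :=
  Matching.eq_of_partner fun j =>
    ((h' j _).1 (hr _ _ (h.arc j))).resolve_left (b.ne_self j)

theorem touch_congr {u v : V₁} (h : circ r u = circ r v) : Touch r bd₁ u ↔ Touch r bd₁ v := by
  simp only [Touch, h]

open Classical in
/-- A function on the points of a glued 1-manifold, given by one on the left part and one on the
components of the right part that do not touch the boundary. -/
def glueFun (bd₂ : Fin (2 * n) → V₂) (r : V₁ → V₁ → Prop) (bd₁ : Fin (2 * n) → V₁)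
    (f : V₂ → α) (x : V₁ → α) : V₂ ⊕ V₁ → α
  | .inl u => f u
  | .inr v => if h : Touch r bd₁ v then f (bd₂ h.choose) else x v

theorem glueFun_touch (hm : IsMatch r bd₁ b) {f : V₂ → α} {x : V₁ → α}
    (hf : ∀ j, f (bd₂ j) = f (bd₂ (b.partner j))) {v : V₁} {j : Fin (2 * n)}
    (h : circ r v = circ r (bd₁ j)) : glueFun bd₂ r bd₁ f x (.inr v) = f (bd₂ j) := by
  have ht : Touch r bd₁ v := ⟨j, h⟩
  rw [glueFun, dif_pos ht]
  rcases (hm _ _).1 (ht.choose_spec.symm.trans h) with h' | h'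
  · rw [← h']
  · rw [hf, ← h']

theorem glueFun_free {f : V₂ → α} {x : V₁ → α} {v : V₁} (h : ¬Touch r bd₁ v) :
    glueFun bd₂ r bd₁ f x (.inr v) = x v := by
  rw [glueFun, dif_neg h]

theorem glueFun_eq (hm : IsMatch r bd₁ b) {f : V₂ → α} {x : V₁ → α}
    (hf : ∀ u v, closeUp s bd₂ b u v → f u = f v) (hx : ∀ u v, circ r u = circ r v → x u = x v)
    (u v : V₂ ⊕ V₁) (h : glueRel s bd₂ r bd₁ u v) :
    glueFun bd₂ r bd₁ f x u = glueFun bd₂ r bd₁ f x v := by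
  have hf' : ∀ j, f (bd₂ j) = f (bd₂ (b.partner j)) := fun j => hf _ _ (Or.inr ⟨j, rfl, rfl⟩)
  rcases u with u | u <;> rcases v with v | v
  · exact hf _ _ (Or.inl h)
  · obtain ⟨j, rfl, rfl⟩ := h
    exact (glueFun_touch hm hf' rfl).symm
  · exact h.elim
  · have hc : circ r u = circ r v := circ_of h
    by_cases ht : Touch r bd₁ v
    · obtain ⟨j, hj⟩ := ht
      rw [glueFun_touch hm hf' hj, glueFun_touch hm hf' (hc.trans hj)]
    · rw [glueFun_free ht, glueFun_free (fun h => ht ((touch_congr hc).1 h)), hx u v hc]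

theorem glue_circ_inr {u v : V₁} (h : circ r u = circ r v) :
    circ (glueRel s bd₂ r bd₁) (.inr u) = circ _ (.inr v) :=
  circ_map Sum.inr (fun u v h => circ_of (show glueRel s bd₂ r bd₁ (.inr u) (.inr v) from h)) h

theorem glue_circ_bd (j : Fin (2 * n)) :
    circ (glueRel s bd₂ r bd₁) (.inl (bd₂ j)) = circ _ (.inr (bd₁ j)) :=
  circ_of (show glueRel s bd₂ r bd₁ (.inl (bd₂ j)) (.inr (bd₁ j)) from ⟨j, rfl, rfl⟩)

theorem glue_circ_touch {v : V₁} {j : Fin (2 * n)} (h : circ r v = circ r (bd₁ j)) :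
    circ (glueRel s bd₂ r bd₁) (.inr v) = circ _ (.inl (bd₂ j)) :=
  (glue_circ_inr h).trans (glue_circ_bd j).symm

/-- Seen from the left, the right part is nothing but the arcs of `b`. In the converse direction
`glueFun` extends the class map by reading a component that touches the boundary at one of its two
ends. -/
theorem glue_circ_inl (hm : IsMatch r bd₁ b) (u v : V₂) :
    circ (glueRel s bd₂ r bd₁) (.inl u) = circ _ (.inl v) ↔
      circ (closeUp s bd₂ b) u = circ _ v := by
  constructor
  · intro h
    have := circ_lift _ (glueFun_eq hm (f := fun v => some (circ (closeUp s bd₂ b) v))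
      (x := fun _ => none) (fun u v h => congrArg some (circ_of h)) (fun _ _ _ => rfl)) h
    simpa [glueFun] using this
  · refine circ_map Sum.inl ?_
    rintro u v (h | ⟨j, rfl, rfl⟩)
    · exact circ_of (show glueRel s bd₂ r bd₁ (.inl u) (.inl v) from h)
    · rw [glue_circ_bd, glue_circ_bd]
      exact glue_circ_inr (hm.arc j)

theorem glue_circ_free (hm : IsMatch r bd₁ b) {v : V₁} (hv : ¬Touch r bd₁ v) (w : V₂ ⊕ V₁)
    (h : circ (glueRel s bd₂ r bd₁) w = circ _ (.inr v)) : ∃ u, w = .inr u ∧ circ r u = circ r v := by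
  have := circ_lift _ (glueFun_eq (s := s) (bd₂ := bd₂) hm (f := fun _ => none)
    (x := fun v => some (circ r v)) (fun _ _ _ => rfl) (fun u v h => congrArg some h)) h
  rw [glueFun_free hv] at this
  rcases w with u | u
  · simp [glueFun] at this
  · refine ⟨u, rfl, ?_⟩
    by_cases hu : Touch r bd₁ u
    · simp [glueFun, hu] at this
    · rw [glueFun_free hu] at this
      exact Option.some.inj this

/-- The labelling `Λ` of the circles of a glued 1-manifold restricts to the labelling `σ` of
the left part, and to `x` on the components of the right part that do not touch the boundary. -/
structure IsGlue (b : Matching n) (Λ : Lab (glueRel s bd₂ r bd₁)) (σ : Lab (closeUp s bd₂ b))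
    (x : Lab (closeUp r bd₁ b)) : Prop where
  left : ∀ u, Λ (circ _ (.inl u)) = σ (circ _ u)
  free : ∀ v, ¬Touch r bd₁ v → Λ (circ _ (.inr v)) = x (circ _ v)

theorem IsGlue.touch {Λ : Lab (glueRel s bd₂ r bd₁)} {σ : Lab (closeUp s bd₂ b)}
    {x : Lab (closeUp r bd₁ b)} (h : IsGlue b Λ σ x) {v : V₁} {j : Fin (2 * n)}
    (hj : circ r v = circ r (bd₁ j)) : Λ (circ _ (.inr v)) = σ (circ _ (bd₂ j)) := by
  rw [glue_circ_touch hj, h.left]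

open Classical in
/-- A saddle in the left part of a glued 1-manifold. -/
theorem saddleCoeff_left (hm : IsMatch r bd₁ b) {p q : V₂} {Λ : Lab (glueRel s bd₂ r bd₁)}
    {Λ' : Lab (glueRel s' bd₂ r bd₁)} {σ : Lab (closeUp s bd₂ b)} {σ' : Lab (closeUp s' bd₂ b)}
    {x x' : Lab (closeUp r bd₁ b)} (h : IsGlue b Λ σ x) (h' : IsGlue b Λ' σ' x') :
    saddleCoeff _ _ (.inl p) (.inl q) Λ Λ' =
      if ∀ v, ¬Touch r bd₁ v → x (circ _ v) = x' (circ _ v) then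
        saddleCoeff _ _ p q σ σ' else 0 := by
  have hne : ∀ v, ¬Touch r bd₁ v → ∀ u, circ (glueRel s bd₂ r bd₁) (.inr v) ≠ circ _ (.inl u) := by
    intro v hv u he
    obtain ⟨w, hw, -⟩ := glue_circ_free hm hv _ he.symm
    cases hw
  split_ifs with hx
  · symm
    refine saddleCoeff_congr (glue_circ_inl hm _ _).symm (glue_circ_inl hm _ _).symm
      (h.left p).symm (h.left q).symm (h'.left p).symm (h'.left q).symm ?_
    have hl : ∀ u, (circ (closeUp s bd₂ b) u ≠ circ _ p → circ (closeUp s bd₂ b) u ≠ circ _ q →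
        σ (circ _ u) = σ' (circ _ u)) ↔ (circ (glueRel s bd₂ r bd₁) (.inl u) ≠ circ _ (.inl p) →
        circ (glueRel s bd₂ r bd₁) (.inl u) ≠ circ _ (.inl q) →
          Λ (circ _ (.inl u)) = Λ' (circ _ (.inl u))) := by
      intro u
      rw [ne_eq, ne_eq, ne_eq, ne_eq, glue_circ_inl hm, glue_circ_inl hm, h.left, h'.left]
    constructor
    · rintro hv (u | v)
      · exact (hl u).1 (hv u)
      · by_cases ht : Touch r bd₁ v
        · obtain ⟨j, hj⟩ := ht
          rw [glue_circ_touch hj, glue_circ_touch hj]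
          exact (hl _).1 (hv _)
        · intro _ _
          rw [h.free v ht, h'.free v ht, hx v ht]
    · exact fun hw u => (hl u).2 (hw _)
  · by_contra hc
    refine hx fun v hv => ?_
    rw [← h.free v hv, ← h'.free v hv]
    exact rest_of_saddleCoeff_ne_zero hc _ (hne v hv _) (hne v hv _)

end Glue

/-! ### Saddles in the right part: reduction to a single term of the Type D operation -/

section RightSaddle

variable {n : ℕ} {V₁ V₂ : Type} {s : V₂ → V₂ → Prop} {r r' : V₁ → V₁ → Prop}
  {bd₂ : Fin (2 * n) → V₂} {bd₁ : Fin (2 * n) → V₁} {b b' : Matching n} {p q : V₁}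

/-- The saddle from `r` to `r'` replaces two strands, on which `p` and `q` lie. -/
structure IsSaddle (r r' : V₁ → V₁ → Prop) (bd₁ : Fin (2 * n) → V₁) (p q : V₁) : Prop where
  same : Same (addE r p q) (addE r' p q)
  ends : circ r p ≠ circ r q → circ r' p ≠ circ r' q → ∃ a a' d d',
    (circ r p = circ r (bd₁ a) ∧ circ r p = circ r (bd₁ a') ∧
      circ r q = circ r (bd₁ d) ∧ circ r q = circ r (bd₁ d')) ∧
    circ r' p = circ r' (bd₁ a) ∧ circ r' p = circ r' (bd₁ d) ∧
      circ r' q = circ r' (bd₁ a') ∧ circ r' q = circ r' (bd₁ d')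

theorem IsSaddle.off (h : IsSaddle r r' bd₁ p q) {u v : V₁} (hp : circ r u ≠ circ r p)
    (hq : circ r u ≠ circ r q) : circ r' u = circ r' v ↔ circ r u = circ r v := by
  have h1 := h.same u v
  have h2 := h.same u p
  rw [circ_addE, circ_addE] at h1 h2
  grind

/-- The labelling `x'` of the circles that do not touch the boundary, extended by labels at the
boundary points. -/
structure IsExt (bd₁ : Fin (2 * n) → V₁) (b b' : Matching n) (τ₀ : Fin (2 * n) → Fin 2)
    (x' : Lab (closeUp r' bd₁ b')) (y : Lab (closeUp r' bd₁ b)) : Prop where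
  bd : ∀ i, y (circ _ (bd₁ i)) = τ₀ i
  free : ∀ v, ¬Touch r' bd₁ v → y (circ _ v) = x' (circ _ v)

theorem closeUp_circ_of {u v : V₁} (h : circ r u = circ r v) :
    circ (closeUp r bd₁ b) u = circ (closeUp r bd₁ b) v :=
  circ_map (R := closeUp r bd₁ b) id (fun _ _ h => circ_of (Or.inl h)) h

theorem IsExt.touch {τ₀ : Fin (2 * n) → Fin 2} {x' : Lab (closeUp r' bd₁ b')}
    {y : Lab (closeUp r' bd₁ b)} (h : IsExt bd₁ b b' τ₀ x' y) {v : V₁} {j : Fin (2 * n)}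
    (hj : circ r' v = circ r' (bd₁ j)) : y (circ _ v) = τ₀ j := by
  rw [closeUp_circ_of hj, h.bd]

theorem IsExt.unique {τ₀ : Fin (2 * n) → Fin 2} {x' : Lab (closeUp r' bd₁ b')}
    {y y₁ : Lab (closeUp r' bd₁ b)} (h : IsExt bd₁ b b' τ₀ x' y) (h₁ : IsExt bd₁ b b' τ₀ x' y₁) :
    y = y₁ := by
  refine lab_ext fun v => ?_
  by_cases ht : Touch r' bd₁ v
  · obtain ⟨j, hj⟩ := ht
    rw [h.touch hj, h₁.touch hj]
  · rw [h.free v ht, h₁.free v ht]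

open Classical in
theorem exists_isExt (hm' : IsMatch r' bd₁ b') {τ₀ : Fin (2 * n) → Fin 2}
    (hb : ∀ j, τ₀ j = τ₀ (b.partner j)) (hb' : ∀ j, τ₀ j = τ₀ (b'.partner j))
    (x' : Lab (closeUp r' bd₁ b')) : ∃ y : Lab (closeUp r' bd₁ b), IsExt bd₁ b b' τ₀ x' y := by
  let f : V₁ → Fin 2 := fun v => if h : Touch r' bd₁ v then τ₀ h.choose else x' (circ _ v)
  have hft : ∀ v j, circ r' v = circ r' (bd₁ j) → f v = τ₀ j := by
    intro v j hj
    have ht : Touch r' bd₁ v := ⟨j, hj⟩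
    simp only [f, dif_pos ht]
    rcases (hm' _ _).1 (ht.choose_spec.symm.trans hj) with h' | h'
    · rw [← h']
    · rw [hb', ← h']
  have hff : ∀ v, ¬Touch r' bd₁ v → f v = x' (circ _ v) := fun v hv => dif_neg hv
  have hf : ∀ v, labOf (closeUp r' bd₁ b) f (circ _ v) = f v := by
    refine labOf_circ ?_
    rintro u v (h | ⟨j, rfl, rfl⟩)
    · have hc : circ r' u = circ r' v := circ_of h
      by_cases ht : Touch r' bd₁ v
      · obtain ⟨j, hj⟩ := ht
        rw [hft v j hj, hft u j (hc.trans hj)]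
      · rw [hff v ht, hff u fun h => ht ((touch_congr hc).1 h), closeUp_circ_of hc]
    · rw [hft _ _ rfl, hft _ _ rfl, hb]
  exact ⟨labOf _ f, fun i => (hf _).trans (hft _ _ rfl), fun v hv => (hf _).trans (hff v hv)⟩

/-- The labels at the boundary points, as an element of the arc algebra. -/
def bdLab (bd₁ : Fin (2 * n) → V₁) (b b' : Matching n) (y : Lab (closeUp r' bd₁ b)) :
    Lab (arcRel b b') := labOf _ fun i => y (circ _ (bd₁ i))

theorem bdLab_circ (hm' : IsMatch r' bd₁ b') (y : Lab (closeUp r' bd₁ b)) (i : Fin (2 * n)) :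
    bdLab bd₁ b b' y (circ _ i) = y (circ _ (bd₁ i)) := by
  refine labOf_circ ?_ i
  rintro i j (rfl | ⟨k, rfl, rfl⟩)
  · exact congrArg y (closeUp_arc i)
  · exact congrArg y (closeUp_circ_of (hm'.arc i))

/-- The condition that a saddle preserves the labels of uninvolved circles separates into one on the
right part, which belongs to `δ`, and one on the left part, which belongs to the action. Components
of `r` away from `p` and `q` survive in `r'`, and those of them that touch the line have label `1`
in `x` and, by `hτ`, in `y`. -/
theorem rest_iff (hm : IsMatch r bd₁ b) (hs : IsSaddle r r' bd₁ p q)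
    {Λ : Lab (glueRel s bd₂ r bd₁)} {Λ' : Lab (glueRel s bd₂ r' bd₁)} {σ : Lab (closeUp s bd₂ b)}
    {σ' : Lab (closeUp s bd₂ b')} {x : Lab (closeUp r bd₁ b)} {x' : Lab (closeUp r' bd₁ b')}
    (hx : ∀ j, x (circ _ (bd₁ j)) = 0) (h : IsGlue b Λ σ x) (h' : IsGlue b' Λ' σ' x')
    {τ₀ : Fin (2 * n) → Fin 2} {y : Lab (closeUp r' bd₁ b)} (hy : IsExt bd₁ b b' τ₀ x' y)
    (hτ : ∀ j, circ r (bd₁ j) ≠ circ r p → circ r (bd₁ j) ≠ circ r q → τ₀ j = 0) :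
    (∀ w, circ (glueRel s bd₂ r bd₁) w ≠ circ _ (.inr p) →
      circ (glueRel s bd₂ r bd₁) w ≠ circ _ (.inr q) →
        Λ (circ _ w) = Λ' (circ _ w)) ↔
      (∀ v, circ (closeUp r bd₁ b) v ≠ circ _ p → circ (closeUp r bd₁ b) v ≠ circ _ q →
        x (circ _ v) = y (circ _ v)) ∧
      ∀ u, circ (glueRel s bd₂ r bd₁) (.inl u) ≠ circ _ (.inr p) →
        circ (glueRel s bd₂ r bd₁) (.inl u) ≠ circ _ (.inr q) →
          σ (circ _ u) = σ' (circ _ u) := by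
  have hc := hm.closeUp_same
  have hG : ∀ u v, circ r u = circ r v →
      circ (glueRel s bd₂ r bd₁) (.inr u) = circ _ (.inr v) := fun u v => glue_circ_inr
  have hfree : ∀ v, circ r v ≠ circ r p → circ r v ≠ circ r q → ¬Touch r bd₁ v →
      ¬Touch r' bd₁ v := by
    rintro v hp hq hv ⟨j, hj⟩
    exact hv ⟨j, (hs.off hp hq).1 hj⟩
  constructor
  · intro hw
    constructor
    · intro v hp hq
      have hp' := fun e => hp ((hc _ _).2 e)
      have hq' := fun e => hq ((hc _ _).2 e)
      by_cases ht : Touch r bd₁ v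
      · obtain ⟨j, hj⟩ := ht
        rw [hy.touch ((hs.off hp' hq').2 hj), closeUp_circ_of hj, hx, hτ j]
        · rwa [← hj]
        · rwa [← hj]
      · have hne : ∀ w, circ r v ≠ circ r w →
            circ (glueRel s bd₂ r bd₁) (.inr v) ≠ circ _ (.inr w) := by
          intro w hvw he
          obtain ⟨w', h1, h2⟩ := glue_circ_free hm ht _ he.symm
          cases h1
          exact hvw h2.symm
        have hv' := hfree v hp' hq' ht
        have := hw (.inr v) (hne p hp') (hne q hq')
        rwa [h.free v ht, h'.free v hv', ← hy.free v hv'] at this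
    · intro u hp hq
      have := hw (.inl u) hp hq
      rwa [h.left, h'.left] at this
  · rintro ⟨h1, h2⟩ (u | v) hp hq
    · rw [h.left, h'.left]
      exact h2 u hp hq
    · have hp' := fun e => hp (hG _ _ e)
      have hq' := fun e => hq (hG _ _ e)
      by_cases ht : Touch r bd₁ v
      · obtain ⟨j, hj⟩ := ht
        rw [h.touch hj, h'.touch ((hs.off hp' hq').2 hj)]
        rw [glue_circ_touch hj] at hp hq
        exact h2 _ hp hq
      · have hv' := hfree v hp' hq' ht
        rw [h.free v ht, h'.free v hv', ← hy.free v hv']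
        exact h1 v (fun e => hp' ((hc _ _).1 e)) (fun e => hq' ((hc _ _).1 e))

variable [Finite V₂]

open Classical in
/-- The sum over the labellings that occur in the type D operation. -/
def rightSum (s : V₂ → V₂ → Prop) (bd₂ : Fin (2 * n) → V₂) (bd₁ : Fin (2 * n) → V₁) (p q : V₁)
    (σ : Lab (closeUp s bd₂ b)) (σ' : Lab (closeUp s bd₂ b')) (x : Lab (closeUp r bd₁ b))
    (x' : Lab (closeUp r' bd₁ b')) : ℤ :=
  ∑ᶠ y : Lab (closeUp r' bd₁ b), saddleCoeff _ _ p q x y *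
    if ∀ v, ¬Touch r' bd₁ v → y (circ _ v) = x' (circ _ v) then
      actMap s bd₂ b b' (Finsupp.single σ 1) (Finsupp.single (bdLab bd₁ b b' y) 1) σ' else 0

/-- A contributing `y` has its free labels fixed by `x'`. Once its labels at the end points are
forced to be `τ₀` as well, only one term of the sum survives. -/
theorem rightSum_eq (hm' : IsMatch r' bd₁ b')
    (σ : Lab (closeUp s bd₂ b)) (σ' : Lab (closeUp s bd₂ b')) (x : Lab (closeUp r bd₁ b))
    (x' : Lab (closeUp r' bd₁ b')) {τ₀ : Fin (2 * n) → Fin 2}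
    (hb : ∀ j, τ₀ j = τ₀ (b.partner j)) (hb' : ∀ j, τ₀ j = τ₀ (b'.partner j))
    (hτ : ∀ y : Lab (closeUp r' bd₁ b), saddleCoeff _ _ p q x y ≠ 0 →
      (∀ v, ¬Touch r' bd₁ v → y (circ _ v) = x' (circ _ v)) → ∀ i, y (circ _ (bd₁ i)) = τ₀ i) :
    ∃ (y : Lab (closeUp r' bd₁ b)) (τ : Lab (arcRel b b')), IsExt bd₁ b b' τ₀ x' y ∧
      (∀ i, τ (circ _ i) = τ₀ i) ∧
      rightSum s bd₂ bd₁ p q σ σ' x x' = saddleCoeff _ _ p q x y *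
        actMap s bd₂ b b' (Finsupp.single σ 1) (Finsupp.single τ 1) σ' := by
  classical
  obtain ⟨y, hy⟩ := exists_isExt hm' hb hb' x'
  refine ⟨y, bdLab bd₁ b b' y, hy, fun i => (bdLab_circ hm' y i).trans (hy.bd i), ?_⟩
  rw [rightSum, finsum_eq_single _ y, if_pos hy.free]
  intro y₁ hne
  by_contra hc
  have h1 := left_ne_zero_of_mul hc
  have h2 := right_ne_zero_of_mul hc
  rw [ne_eq, ite_eq_right_iff, Classical.not_imp] at h2
  exact hne (IsExt.unique (⟨hτ y₁ h1 h2.1, h2.1⟩ : IsExt bd₁ b b' τ₀ x' y₁) hy)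

end RightSaddle

/-! ### Saddles in the right part: merge, split and surgery -/

section RightSaddleCases

variable {n : ℕ} {V₁ V₂ : Type} {s : V₂ → V₂ → Prop}
  {r r' : V₁ → V₁ → Prop}
  {bd₂ : Fin (2 * n) → V₂} {bd₁ : Fin (2 * n) → V₁} {b b' : Matching n} {p q : V₁}

theorem addE_same {V : Type} {r : V → V → Prop} {p q : V} (h : circ r p = circ r q) :
    Same (addE r p q) r := by
  intro u v
  rw [circ_addE]
  grind

theorem ite_partner (j : Fin (2 * n)) (t : Fin 2) (i : Fin (2 * n)) :
    (if i = j ∨ i = b.partner j then t else 0) =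
      if b.partner i = j ∨ b.partner i = b.partner j then t else 0 := by
  congr 1
  rw [eq_iff_iff]
  have := b.invol
  grind

theorem IsSaddle.swap (h : IsSaddle r r' bd₁ p q) : IsSaddle r r' bd₁ q p where
  same u v := by
    have := h.same u v
    rw [circ_addE, circ_addE] at this ⊢
    grind
  ends h1 h2 := by
    obtain ⟨a, a', d, d', ⟨h3, h4, h5, h6⟩, h7, h8, h9, h10⟩ := h.ends h1.symm h2.symm
    exact ⟨d', d, a', a, ⟨h6, h5, h4, h3⟩, h10, h9, h8, h7⟩

variable [Finite V₂]

theorem rightSum_comm (σ : Lab (closeUp s bd₂ b)) (σ' : Lab (closeUp s bd₂ b'))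
    (x : Lab (closeUp r bd₁ b)) (x' : Lab (closeUp r' bd₁ b')) :
    rightSum s bd₂ bd₁ p q σ σ' x x' = rightSum s bd₂ bd₁ q p σ σ' x x' := by
  simp only [rightSum, saddleCoeff_comm (p := p)]

/-- If the component of `p` touches the line, merging the free circle of `q` into it multiplies by
the label of `q`; in `δ` that label becomes the dot on the arc through `j`, which then acts on the
left. If both components are free, the algebra element is `1_b`. -/
theorem rightSum_merge (hm : IsMatch r bd₁ b) (hm' : IsMatch r' bd₁ b)
    (hs : IsSaddle r r' bd₁ p q) (hpq : circ r p ≠ circ r q) (hpq' : circ r' p = circ r' q)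
    (hq : ¬Touch r bd₁ q)
    {Λ : Lab (glueRel s bd₂ r bd₁)} {Λ' : Lab (glueRel s bd₂ r' bd₁)} {σ : Lab (closeUp s bd₂ b)}
    {σ' : Lab (closeUp s bd₂ b)} {x : Lab (closeUp r bd₁ b)} {x' : Lab (closeUp r' bd₁ b)}
    (hx : ∀ j, x (circ _ (bd₁ j)) = 0) (h : IsGlue b Λ σ x) (h' : IsGlue b Λ' σ' x') :
    rightSum s bd₂ bd₁ p q σ σ' x x' = saddleCoeff _ _ (.inr p) (.inr q) Λ Λ' := by
  classical
  have hc := hm.closeUp_same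
  have hc' := hm'.closeUp_same
  have hE : Same r' (addE r p q) := (addE_same hpq').symm.trans hs.same.symm
  have hsub : ∀ u v, circ r u = circ r v → circ r' u = circ r' v :=
    fun u v e => (hE u v).2 (circ_addE.2 (Or.inl e))
  have hcpq : circ (closeUp r bd₁ b) p ≠ circ _ q := fun e => hpq ((hc _ _).1 e)
  have hcpq' : circ (closeUp r' bd₁ b) p = circ _ q := (hc' _ _).2 hpq'
  have hGq : ∀ u, circ (glueRel s bd₂ r bd₁) (.inl u) ≠ circ _ (.inr q) := by
    intro u he
    obtain ⟨w, hw, -⟩ := glue_circ_free hm hq _ he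
    cases hw
  have hGpq : circ (glueRel s bd₂ r bd₁) (.inr p) ≠ circ _ (.inr q) := by
    intro he
    obtain ⟨w, hw, hw'⟩ := glue_circ_free hm hq _ he
    cases hw
    exact hpq hw'
  have hGpq' : circ (glueRel s bd₂ r' bd₁) (.inr p) = circ _ (.inr q) := glue_circ_inr hpq'
  by_cases hp : Touch r bd₁ p
  · obtain ⟨j, hj⟩ := hp
    obtain ⟨y, τ, hy, hτ, hsum⟩ := rightSum_eq (p := p) (q := q) hm' σ σ' x x'
      (τ₀ := fun i => if i = j ∨ i = b.partner j then x (circ _ q) else 0)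
      (ite_partner _ _) (ite_partner _ _) (by
        intro y hy _ i
        have hrest := rest_of_saddleCoeff_ne_zero hy
        rw [saddleCoeff_merge hcpq hcpq', ne_eq, ite_eq_right_iff, Classical.not_imp] at hy
        have hsum := hy.1.2
        rw [closeUp_circ_of hj, hx, closeUp_circ_of (hsub _ _ hj)] at hsum
        split_ifs with hi
        · rw [closeUp_circ_of (hsub _ _ ((hm j i).2 hi).symm)]
          refine Fin.ext ?_
          simpa using hsum.symm
        · rw [← hrest, hx]
          · intro e
            exact hi ((hm j i).1 (hj.symm.trans ((hc _ _).1 e).symm))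
          · intro e
            exact hq ⟨i, ((hc _ _).1 e).symm⟩)
    have hr := rest_iff hm hs hx h h' hy (fun i hi _ => if_neg fun hi' =>
      hi (((hm j i).2 hi').symm.trans hj.symm))
    have hu : ∀ u, circ (glueRel s bd₂ r bd₁) (.inl u) = circ _ (.inr p) ↔
        circ (closeUp s bd₂ b) u = circ _ (bd₂ j) := by
      intro u
      rw [glue_circ_touch hj, glue_circ_inl hm]
    rw [hsum, actMap_dot σ σ' j _ hτ, saddleCoeff_merge hcpq hcpq', saddleCoeff_merge hGpq hGpq', hr,
      h.touch hj, h.free q hq, h'.touch (hsub _ _ hj), hy.touch (hsub _ _ hj), if_pos (Or.inl rfl),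
      closeUp_circ_of hj, hx]
    simp only [ne_eq, hu, hGq, not_false_eq_true, forall_true_left, Fin.val_zero, zero_add, and_true,
      mul_ite, mul_one, mul_zero, ← ite_and]
    congr 1
    rw [eq_iff_iff]
    tauto
  · have hfree : ¬Touch r' bd₁ p := by
      rintro ⟨j, hj⟩
      rcases circ_addE.1 ((hE _ _).1 hj) with h1 | ⟨h1, h2⟩ | ⟨h1, h2⟩
      · exact hp ⟨j, h1⟩
      · exact hq ⟨j, h2.symm⟩
      · exact hpq h1
    obtain ⟨y, τ, hy, hτ, hsum⟩ := rightSum_eq (p := p) (q := q) hm' σ σ' x x'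
      (τ₀ := fun i => 0) (fun i => rfl) (fun i => rfl) (by
        intro y hy _ i
        rw [← rest_of_saddleCoeff_ne_zero hy, hx]
        · exact fun e => hp ⟨i, ((hc _ _).1 e).symm⟩
        · exact fun e => hq ⟨i, ((hc _ _).1 e).symm⟩)
    have hr := rest_iff hm hs hx h h' hy (fun _ _ _ => rfl)
    have hGp : ∀ u, circ (glueRel s bd₂ r bd₁) (.inl u) ≠ circ _ (.inr p) := by
      intro u he
      obtain ⟨w, hw, -⟩ := glue_circ_free hm hp _ he
      cases hw
    have hσ : σ = σ' ↔ ∀ u, σ (circ _ u) = σ' (circ _ u) := ⟨fun e u => by rw [e], lab_ext⟩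
    rw [hsum, actMap_one σ hτ, saddleCoeff_merge hcpq hcpq', saddleCoeff_merge hGpq hGpq', hr,
      h.free p hp, h.free q hq, h'.free p hfree, hy.free p hfree, Finsupp.single_apply, hσ]
    simp only [ne_eq, hGp, hGq, not_false_eq_true, forall_true_left, mul_ite, mul_one, mul_zero,
      ← ite_and]
    congr 1
    rw [eq_iff_iff]
    tauto

/-- If the component of `p` touches the line, then `Δ 1 = 1 ⊗ X + X ⊗ 1` forces the label `X ^ (1 -
x' q)` at the line. That this dot acts as the split of the glued circle expresses that `Δ a` is `a`
times `Δ 1`. If both pieces are free, the algebra element is `1_b`. -/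
theorem rightSum_split (hm : IsMatch r bd₁ b) (hm' : IsMatch r' bd₁ b)
    (hs : IsSaddle r r' bd₁ p q) (hpq : circ r p = circ r q) (hpq' : circ r' p ≠ circ r' q)
    (hq : ¬Touch r' bd₁ q)
    {Λ : Lab (glueRel s bd₂ r bd₁)} {Λ' : Lab (glueRel s bd₂ r' bd₁)} {σ : Lab (closeUp s bd₂ b)}
    {σ' : Lab (closeUp s bd₂ b)} {x : Lab (closeUp r bd₁ b)} {x' : Lab (closeUp r' bd₁ b)}
    (hx : ∀ j, x (circ _ (bd₁ j)) = 0) (h : IsGlue b Λ σ x) (h' : IsGlue b Λ' σ' x') :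
    rightSum s bd₂ bd₁ p q σ σ' x x' = saddleCoeff _ _ (.inr p) (.inr q) Λ Λ' := by
  classical
  have hc := hm.closeUp_same
  have hc' := hm'.closeUp_same
  have hE : Same r (addE r' p q) := (addE_same hpq).symm.trans hs.same
  have hsub : ∀ u v, circ r' u = circ r' v → circ r u = circ r v :=
    fun u v e => (hE u v).2 (circ_addE.2 (Or.inl e))
  have hcpq : circ (closeUp r bd₁ b) p = circ _ q := (hc _ _).2 hpq
  have hcpq' : circ (closeUp r' bd₁ b) p ≠ circ _ q := fun e => hpq' ((hc' _ _).1 e)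
  have hGpq : circ (glueRel s bd₂ r bd₁) (.inr p) = circ _ (.inr q) := glue_circ_inr hpq
  have hGpq' : circ (glueRel s bd₂ r' bd₁) (.inr p) ≠ circ _ (.inr q) := by
    intro he
    obtain ⟨w, hw, hw'⟩ := glue_circ_free hm' hq _ he
    cases hw
    exact hpq' hw'
  by_cases hp : Touch r' bd₁ p
  · obtain ⟨j, hj'⟩ := hp
    have hj := hsub _ _ hj'
    obtain ⟨y, τ, hy, hτ, hsum⟩ := rightSum_eq (p := p) (q := q) hm' σ σ' x x'
      (τ₀ := fun i => if i = j ∨ i = b.partner j then 1 - x' (circ _ q) else 0)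
      (ite_partner _ _) (ite_partner _ _) (by
        intro y hy hfree i
        have hrest := rest_of_saddleCoeff_ne_zero hy
        rw [saddleCoeff_split hcpq hcpq', ne_eq, ite_eq_right_iff, Classical.not_imp] at hy
        have hsum := hy.1.2
        rw [closeUp_circ_of hj, hx, closeUp_circ_of hj', hfree q hq] at hsum
        split_ifs with hi
        · rw [closeUp_circ_of ((hm' j i).2 hi).symm]
          simp only [Fin.val_zero] at hsum
          omega
        · have hij : circ (closeUp r bd₁ b) (bd₁ i) ≠ circ _ p := fun e =>
            hi ((hm j i).1 (hj.symm.trans ((hc _ _).1 e).symm))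
          rw [← hrest _ hij (by rwa [← hcpq]), hx])
    have hr := rest_iff hm hs hx h h' hy (fun i hi _ => if_neg fun hi' =>
      hi (((hm j i).2 hi').symm.trans hj.symm))
    have hu : ∀ u, circ (glueRel s bd₂ r bd₁) (.inl u) = circ _ (.inr p) ↔
        circ (closeUp s bd₂ b) u = circ _ (bd₂ j) := by
      intro u
      rw [glue_circ_touch hj, glue_circ_inl hm]
    rw [hsum, actMap_dot σ σ' j _ hτ, saddleCoeff_split hcpq hcpq', saddleCoeff_split hGpq hGpq', hr,
      h.touch hj, h'.free q hq, h'.touch hj', hy.touch hj', if_pos (Or.inl rfl), hy.free q hq,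
      closeUp_circ_of hj, hx, ← hGpq]
    have hn : ((1 - x' (circ _ q) : Fin 2) : ℕ) + x' (circ _ q) = (0 : Fin 2) + 1 := by
      simp only [Fin.val_zero]
      omega
    have hn' : (σ (circ _ (bd₂ j)) : ℕ) + (1 - x' (circ _ q) : Fin 2) = σ' (circ _ (bd₂ j)) ↔
        (σ' (circ _ (bd₂ j)) : ℕ) + x' (circ _ q) = σ (circ _ (bd₂ j)) + 1 := by
      simp only [Fin.val_zero] at hn
      omega
    simp only [ne_eq, hu, hn, hn', mul_ite, mul_one, mul_zero, ← ite_and, and_true]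
    congr 1
    rw [eq_iff_iff]
    tauto
  · have hfree : ∀ i, circ r (bd₁ i) ≠ circ r p := by
      intro i hi
      rcases circ_addE.1 ((hE _ _).1 hi) with h1 | ⟨h1, h2⟩ | ⟨h1, h2⟩
      · exact hp ⟨i, h1.symm⟩
      · exact hpq' h2
      · exact hq ⟨i, h1.symm⟩
    have hp0 : ¬Touch r bd₁ p := fun ⟨i, hi⟩ => hfree i hi.symm
    obtain ⟨y, τ, hy, hτ, hsum⟩ := rightSum_eq (p := p) (q := q) hm' σ σ' x x'
      (τ₀ := fun i => 0) (fun i => rfl) (fun i => rfl) (by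
        intro y hy _ i
        rw [← rest_of_saddleCoeff_ne_zero hy, hx]
        · exact fun e => hfree i ((hc _ _).1 e)
        · exact fun e => hfree i (((hc _ _).1 e).trans hpq.symm))
    have hr := rest_iff hm hs hx h h' hy (fun _ _ _ => rfl)
    have hGp : ∀ u, circ (glueRel s bd₂ r bd₁) (.inl u) ≠ circ _ (.inr p) := by
      intro u he
      obtain ⟨w, hw, -⟩ := glue_circ_free hm hp0 _ he
      cases hw
    have hσ : σ = σ' ↔ ∀ u, σ (circ _ u) = σ' (circ _ u) := ⟨fun e u => by rw [e], lab_ext⟩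
    rw [hsum, actMap_one σ hτ, saddleCoeff_split hcpq hcpq', saddleCoeff_split hGpq hGpq', hr,
      h.free p hp0, h'.free q hq, h'.free p hp, hy.free p hp, hy.free q hq, Finsupp.single_apply, hσ,
      ← hGpq]
    simp only [ne_eq, hGp, not_false_eq_true, forall_true_left, mul_ite, mul_one, mul_zero,
      ← ite_and]
    congr 1
    rw [eq_iff_iff]
    tauto

/-- Closed up by the old matching `b`, the saddle merges two circles that touch the line, both
labelled `1`. The product is `1`, so the algebra element is the labelling of `W(b) b'` by `1`, whose
action is the saddle of `actMap_surgery`. -/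
theorem rightSum_surgery (hm : IsMatch r bd₁ b) (hm' : IsMatch r' bd₁ b')
    (hs : IsSaddle r r' bd₁ p q) (hpq : circ r p ≠ circ r q) (hpq' : circ r' p ≠ circ r' q)
    {Λ : Lab (glueRel s bd₂ r bd₁)} {Λ' : Lab (glueRel s bd₂ r' bd₁)} {σ : Lab (closeUp s bd₂ b)}
    {σ' : Lab (closeUp s bd₂ b')} {x : Lab (closeUp r bd₁ b)} {x' : Lab (closeUp r' bd₁ b')}
    (hx : ∀ j, x (circ _ (bd₁ j)) = 0) (h : IsGlue b Λ σ x) (h' : IsGlue b' Λ' σ' x') :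
    rightSum s bd₂ bd₁ p q σ σ' x x' = saddleCoeff _ _ (.inr p) (.inr q) Λ Λ' := by
  classical
  have hc := hm.closeUp_same
  obtain ⟨a, a', d, d', ⟨e1, e2, e3, e4⟩, e1', e3', e2', e4'⟩ := hs.ends hpq hpq'
  have haa' : b.partner a = a' := by
    refine (((hm a a').1 (e1.symm.trans e2)).resolve_left ?_).symm
    rintro rfl
    exact hpq' (e1'.trans e2'.symm)
  have hdd' : b.partner d = d' := by
    refine (((hm d d').1 (e3.symm.trans e4)).resolve_left ?_).symm
    rintro rfl
    exact hpq' (e3'.trans e4'.symm)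
  have had : b'.partner a = d := by
    refine (((hm' a d).1 (e1'.symm.trans e3')).resolve_left ?_).symm
    rintro rfl
    exact hpq (e1.trans e3.symm)
  have had' : b'.partner a' = d' := by
    refine (((hm' a' d').1 (e2'.symm.trans e4')).resolve_left ?_).symm
    rintro rfl
    exact hpq (e2.trans e4.symm)
  have hp4 : ∀ i, circ r (bd₁ i) = circ r p ↔ i = a ∨ i = a' := by
    intro i
    rw [e1, eq_comm, hm, haa']
  have hq4 : ∀ i, circ r (bd₁ i) = circ r q ↔ i = d ∨ i = d' := by
    intro i
    rw [e3, eq_comm, hm, hdd']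
  have hother : ∀ i, i ≠ a → i ≠ a' → i ≠ d → i ≠ d' → b'.partner i = b.partner i := by
    intro i h1 h2 h3 h4
    have h5 := (hs.off (v := bd₁ (b.partner i)) (fun e => ((hp4 i).1 e).elim h1 h2)
      (fun e => ((hq4 i).1 e).elim h3 h4)).2 (hm.arc i)
    exact (((hm' _ _).1 h5).resolve_left (b.ne_self i)).symm
  have hdist : a ≠ d ∧ a ≠ d' ∧ a' ≠ d ∧ a' ≠ d' := by
    have h1 := (hp4 a).2 (Or.inl rfl)
    have h2 := (hp4 a').2 (Or.inr rfl)
    have h3 := (hq4 d).2 (Or.inl rfl)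
    have h4 := (hq4 d').2 (Or.inr rfl)
    refine ⟨?_, ?_, ?_, ?_⟩ <;> rintro rfl <;> grind
  have hsurg : IsSurgery b b' a := by
    have h1 := b.invol
    have h2 := b'.invol
    refine ⟨fun i => ?_, by rw [haa', had]; exact fun h => hdist.2.2.1 h.symm,
      fun i h1 h2 h3 h4 => hother i h1 (by rwa [← haa']) (by rwa [← had])
        (by rwa [← had', ← haa'])⟩
    by_cases k1 : i = a
    · grind
    by_cases k2 : i = a'
    · grind
    by_cases k3 : i = d
    · grind
    by_cases k4 : i = d'
    · grind
    rw [hother i k1 k2 k3 k4, hother (b.partner i)] <;> grind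
  have hcpq : circ (closeUp r bd₁ b) p ≠ circ _ q := fun e => hpq ((hc _ _).1 e)
  have hcpq' : circ (closeUp r' bd₁ b) p = circ _ q := by
    rw [closeUp_circ_of e1', closeUp_circ_of e2', ← haa']
    exact closeUp_arc a
  obtain ⟨y, τ, hy, hτ, hsum⟩ := rightSum_eq (p := p) (q := q) hm' σ σ' x x'
    (τ₀ := fun i => 0) (fun i => rfl) (fun i => rfl) (by
      intro y hy _ i
      have hrest := rest_of_saddleCoeff_ne_zero hy
      rw [saddleCoeff_merge hcpq hcpq', ne_eq, ite_eq_right_iff, Classical.not_imp] at hy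
      have hsum := hy.1.2
      rw [closeUp_circ_of e1, hx, closeUp_circ_of e3, hx] at hsum
      have hyp : y (circ _ p) = 0 := Fin.ext hsum.symm
      by_cases h1 : circ r (bd₁ i) = circ r p
      · rcases (hp4 i).1 h1 with rfl | rfl
        · rw [← closeUp_circ_of e1', hyp]
        · rw [← closeUp_circ_of e2', ← hcpq', hyp]
      by_cases h2 : circ r (bd₁ i) = circ r q
      · rcases (hq4 i).1 h2 with rfl | rfl
        · rw [← closeUp_circ_of e3', hyp]
        · rw [← closeUp_circ_of e4', ← hcpq', hyp]
      rw [← hrest _ (fun e => h1 ((hc _ _).1 e)) (fun e => h2 ((hc _ _).1 e)), hx])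
  have hr := rest_iff hm hs hx h h' hy (fun _ _ _ => rfl)
  rw [hsum, actMap_surgery hsurg σ σ' hτ, saddleCoeff_merge hcpq hcpq', haa', had',
    -- The end points `a` and `d'` stay on the strands of `p` and `q` both before and after the
    -- saddle, so they can serve as marked points on the left.
    saddleCoeff_mark (p := Sum.inl (bd₂ a)) (q := Sum.inl (bd₂ d'))
      (Or.inl ⟨glue_circ_touch e1, glue_circ_touch e4⟩)
      (Or.inl ⟨glue_circ_touch e1', glue_circ_touch e4'⟩),
    closeUp_circ_of e1, hx, closeUp_circ_of e3, hx, hy.touch e1']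
  rw [glue_circ_touch e1, glue_circ_touch e4] at hr
  by_cases hA : ∀ v, circ (closeUp r bd₁ b) v ≠ circ _ (bd₁ a) →
    circ (closeUp r bd₁ b) v ≠ circ _ (bd₁ d) → x (circ _ v) = y (circ _ v)
  · rw [if_pos ⟨hA, rfl⟩, one_mul]
    refine saddleCoeff_congr (glue_circ_inl hm _ _).symm (glue_circ_inl hm' _ _).symm
      (h.left _).symm (h.left _).symm (h'.left _).symm (h'.left _).symm ?_
    rw [hr, closeUp_circ_of e1, closeUp_circ_of e3]
    simp only [ne_eq, glue_circ_inl hm]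
    exact ⟨fun k => ⟨hA, k⟩, fun k => k.2⟩
  · rw [if_neg fun k => hA k.1, zero_mul]
    by_contra hne
    have := hr.1 (rest_of_saddleCoeff_ne_zero (Ne.symm hne))
    rw [closeUp_circ_of e1, closeUp_circ_of e3] at this
    exact hA this.1

/-- A saddle in the right part of a glued 1-manifold is the type D operation followed by the action
of the arc algebra on the left part. -/
theorem rightSum_eq_saddleCoeff (hm : IsMatch r bd₁ b) (hm' : IsMatch r' bd₁ b')
    (hs : IsSaddle r r' bd₁ p q)
    {Λ : Lab (glueRel s bd₂ r bd₁)} {Λ' : Lab (glueRel s bd₂ r' bd₁)} {σ : Lab (closeUp s bd₂ b)}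
    {σ' : Lab (closeUp s bd₂ b')} {x : Lab (closeUp r bd₁ b)} {x' : Lab (closeUp r' bd₁ b')}
    (hx : ∀ j, x (circ _ (bd₁ j)) = 0) (h : IsGlue b Λ σ x) (h' : IsGlue b' Λ' σ' x') :
    rightSum s bd₂ bd₁ p q σ σ' x x' = saddleCoeff _ _ (.inr p) (.inr q) Λ Λ' := by
  by_cases hpq : circ r p = circ r q <;> by_cases hpq' : circ r' p = circ r' q
  -- A saddle that neither merges nor splits has coefficient zero, in the glued manifold and in
  -- every term of the sum.
  · rw [saddleCoeff_zero (iff_of_true (glue_circ_inr hpq) (glue_circ_inr hpq')), rightSum]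
    refine finsum_eq_zero_of_forall_eq_zero fun y => ?_
    rw [saddleCoeff_zero (iff_of_true (closeUp_circ_of hpq) (closeUp_circ_of hpq')), zero_mul]
  · have hE : Same r (addE r' p q) := (addE_same hpq).symm.trans hs.same
    obtain rfl := hm'.unique hm fun u v e => (hE u v).2 (circ_addE.2 (Or.inl e))
    by_cases hq : Touch r' bd₁ q
    -- The two pieces of a split component cannot both touch the line: their ends would be ends of
    -- one component of `r`, hence equal or partners, and so joined in `r'` too.
    · have hp : ¬Touch r' bd₁ p := by
        rintro ⟨j, hj⟩
        obtain ⟨k, hk⟩ := hq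
        have hsub : ∀ u v, circ r' u = circ r' v → circ r u = circ r v :=
          fun u v e => (hE u v).2 (circ_addE.2 (Or.inl e))
        refine hpq' (hj.trans (Eq.trans ?_ hk.symm))
        exact (hm' _ _).2 ((hm _ _).1 ((hsub _ _ hj).symm.trans (hpq.trans (hsub _ _ hk))))
      rw [rightSum_comm, saddleCoeff_comm]
      exact rightSum_split hm hm' hs.swap hpq.symm (Ne.symm hpq') hp hx h h'
    · exact rightSum_split hm hm' hs hpq hpq' hq hx h h'
  · have hE : Same r' (addE r p q) := (addE_same hpq').symm.trans hs.same.symm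
    have hsub : ∀ u v, circ r u = circ r v → circ r' u = circ r' v :=
      fun u v e => (hE u v).2 (circ_addE.2 (Or.inl e))
    obtain rfl := hm.unique hm' hsub
    by_cases hq : Touch r bd₁ q
    · have hp : ¬Touch r bd₁ p := by
        rintro ⟨j, hj⟩
        obtain ⟨k, hk⟩ := hq
        refine hpq (hj.trans (Eq.trans ?_ hk.symm))
        exact (hm _ _).2 ((hm' _ _).1 ((hsub _ _ hj).symm.trans (hpq'.trans (hsub _ _ hk))))
      rw [rightSum_comm, saddleCoeff_comm]
      exact rightSum_merge hm hm' hs.swap (Ne.symm hpq) hpq'.symm hp hx h h'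
    · exact rightSum_merge hm hm' hs hpq hpq' hq hx h h'
  · exact rightSum_surgery hm hm' hs hpq hpq' hx h h'

end RightSaddleCases

/-! ### Arcs of a tangle diagram pair up its end points and crossing ends -/

section TangleEnds

/-- Passes to a larger diagram in which the old components are unchanged, the old ends are renamed
by `g`, and the new ends are paired among themselves. -/
theorem Good.extend {V V' E E' : Type} {r : V → V → Prop} {r' : V' → V' → Prop} {e : E → V}
    {e' : E' → V'} (h : Good r e Set.univ) (φ : V → V') (g : E → E') (hg : Function.Injective g)
    (hφ : ∀ u v, circ r' (φ u) = circ r' (φ v) ↔ circ r u = circ r v)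
    (he : ∀ i, e' (g i) = φ (e i))
    (hnew : ∀ i, (∀ i₀, i ≠ g i₀) → ∃ i', (∀ i₀, i' ≠ g i₀) ∧ i' ≠ i ∧
      ∀ k, circ r' (e' i) = circ r' (e' k) ↔ k = i ∨ k = i') : Good r' e' Set.univ := by
  intro i _
  by_cases hi : ∃ i₀, i = g i₀
  · obtain ⟨i, rfl⟩ := hi
    obtain ⟨i', -, hne, hk⟩ := h i trivial
    refine ⟨g i', trivial, hg.ne hne, fun k _ => ?_⟩
    by_cases hk' : ∃ k₀, k = g k₀
    · obtain ⟨k, rfl⟩ := hk'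
      rw [he, he, hφ, hk k trivial, hg.eq_iff, hg.eq_iff]
    · rw [not_exists] at hk'
      obtain ⟨k', h1, -, h3⟩ := hnew k hk'
      refine iff_of_false (fun hc => ?_) (by rintro (rfl | rfl) <;> exact hk' _ rfl)
      rcases (h3 _).1 hc.symm with h4 | h4
      · exact hk' _ h4.symm
      · exact h1 _ h4.symm
  · rw [not_exists] at hi
    obtain ⟨i', -, h2, h3⟩ := hnew i hi
    exact ⟨i', trivial, h2, fun k _ => h3 k⟩

variable {m : ℕ}

/-- The increasing map that omits `i` and `i + 1`. -/
def skip (i : Fin (m + 1)) (j : Fin m) : Fin (m + 2) := i.castSucc.succAbove (i.succAbove j)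

theorem skip_strictMono (i : Fin (m + 1)) : StrictMono (skip i) :=
  (Fin.strictMono_succAbove _).comp (Fin.strictMono_succAbove _)

theorem skip_ne_castSucc (i : Fin (m + 1)) (j : Fin m) : skip i j ≠ i.castSucc :=
  Fin.succAbove_ne _ _

theorem skip_ne_succ (i : Fin (m + 1)) (j : Fin m) : skip i j ≠ i.succ := by
  rw [skip, ← Fin.succAbove_castSucc_self]
  exact fun h => Fin.succAbove_ne i j (Fin.succAbove_right_injective h)

theorem skip_cases (i : Fin (m + 1)) (k : Fin (m + 2)) :
    k = i.castSucc ∨ k = i.succ ∨ ∃ j, k = skip i j := by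
  by_cases h : k = i.castSucc
  · exact Or.inl h
  obtain ⟨l, rfl⟩ := Fin.exists_succAbove_eq h
  by_cases h' : l = i
  · exact Or.inr (Or.inl (by rw [h', Fin.succAbove_castSucc_self]))
  obtain ⟨j, rfl⟩ := Fin.exists_succAbove_eq h'
  exact Or.inr (Or.inr ⟨j, rfl⟩)

/-- The four ends of a crossing. -/
def Code.endPt (C : Code m) (x : C.X) : Fin 4 → C.V :=
  ![C.nearLo x, C.nearHi x, C.farLo x, C.farHi x]

/-- The end points of a diagram and of its crossings. -/
def Code.ends (C : Code m) : Fin m ⊕ C.X × Fin 4 → C.V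
  | .inl j => C.bd j
  | .inr x => C.endPt x.1 x.2

section SumRel

variable {V : Type} {r : V → V → Prop} {R : V ⊕ Fin 2 → V ⊕ Fin 2 → Prop}

theorem circ_inl_iff (h : ∀ u v, R (.inl u) (.inl v) ↔ r u v)
    (h₁ : ∀ u k, ¬R (.inl u) (.inr k)) (h₂ : ∀ u k, ¬R (.inr k) (.inl u)) (u v : V) :
    circ R (.inl u) = circ R (.inl v) ↔ circ r u = circ r v := by
  constructor
  · intro hc
    have := circ_lift (Sum.elim (fun u => some (circ r u)) fun _ => none) (by
      rintro (u | k) (v | l) huv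
      · exact congrArg some (circ_of ((h u v).1 huv))
      · exact (h₁ _ _ huv).elim
      · exact (h₂ _ _ huv).elim
      · rfl) hc
    exact Option.some.inj this
  · exact circ_map Sum.inl fun u v huv => circ_of ((h u v).2 huv)

theorem circ_inr_ne (h₁ : ∀ u k, ¬R (.inl u) (.inr k)) (h₂ : ∀ u k, ¬R (.inr k) (.inl u)) (u : V)
    (k : Fin 2) : circ R (.inr k) ≠ circ R (.inl u) := by
  intro hc
  have := circ_lift (Sum.elim (fun _ => true) fun _ => false) (by
    rintro (u | k) (v | l) huv
    · rfl
    · exact (h₁ _ _ huv).elim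
    · exact (h₂ _ _ huv).elim
    · rfl) hc
  simp at this

end SumRel

theorem Code.cup_bd_castSucc (i : Fin (m + 1)) (C : Code m) :
    (Code.cup i C).bd i.castSucc = .inr 0 := by
  simp [Code.cup]

theorem Code.cup_bd_succ (i : Fin (m + 1)) (C : Code m) : (Code.cup i C).bd i.succ = .inr 1 := by
  rw [← Fin.succAbove_castSucc_self]
  simp only [Code.cup]
  rw [Fin.insertNth_apply_succAbove, Fin.insertNth_apply_same]

theorem Code.cup_bd_skip (i : Fin (m + 1)) (C : Code m) (j : Fin m) :
    (Code.cup i C).bd (skip i j) = .inl (C.bd j) := by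
  simp only [Code.cup, skip]
  rw [Fin.insertNth_apply_succAbove, Fin.insertNth_apply_succAbove]

theorem Code.cup_good (i : Fin (m + 1)) (C : Code m) (h : Good C.turn C.ends Set.univ) :
    Good (Code.cup i C).turn (Code.cup i C).ends Set.univ := by
  obtain ⟨R, hR⟩ : ∃ R : C.V ⊕ Fin 2 → C.V ⊕ Fin 2 → Prop, R = (Code.cup i C).turn := ⟨_, rfl⟩
  obtain ⟨e, he⟩ : ∃ e : Fin (m + 2) ⊕ C.X × Fin 4 → C.V ⊕ Fin 2, e = (Code.cup i C).ends :=
    ⟨_, rfl⟩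
  change Good (E := Fin (m + 2) ⊕ C.X × Fin 4) (V := C.V ⊕ Fin 2) _ _ _
  rw [← hR, ← he]
  have h₁ : ∀ u k, ¬R (.inl u) (.inr k) := by simp [hR, Code.cup]
  have h₂ : ∀ u k, ¬R (.inr k) (.inl u) := by simp [hR, Code.cup]
  have h₀ : circ R (.inr 0) = circ R (.inr 1) := circ_of (by rw [hR]; exact Or.inr ⟨rfl, rfl⟩)
  have hne := circ_inr_ne h₁ h₂
  have hE0 : e (.inl i.castSucc) = .inr 0 := he ▸ Code.cup_bd_castSucc i C
  have hE1 : e (.inl i.succ) = .inr 1 := he ▸ Code.cup_bd_succ i C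
  have hEg : ∀ a, e (Sum.map (skip i) id a) = .inl (C.ends a) := by
    rw [he]
    rintro (j | ⟨x, k⟩)
    · exact Code.cup_bd_skip i C j
    · fin_cases k <;> rfl
  refine h.extend Sum.inl (Sum.map (skip i) id) ?_
    (circ_inl_iff (by simp [hR, Code.cup]) h₁ h₂) hEg ?_
  · exact Function.Injective.sumMap (skip_strictMono i).injective Function.injective_id
  · have hcs := i.castSucc_lt_succ.ne
    have hcases : ∀ a : Fin (m + 2) ⊕ C.X × Fin 4, a = .inl i.castSucc ∨ a = .inl i.succ ∨
        ∃ a₀, a = Sum.map (skip i) id a₀ := by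
      rintro (k | x)
      · rcases skip_cases i k with rfl | rfl | ⟨j, rfl⟩
        · exact Or.inl rfl
        · exact Or.inr (Or.inl rfl)
        · exact Or.inr (Or.inr ⟨.inl j, rfl⟩)
      · exact Or.inr (Or.inr ⟨.inr x, rfl⟩)
    have hng : ∀ a : Fin (m + 2) ⊕ C.X × Fin 4, a = .inl i.castSucc ∨ a = .inl i.succ →
        ∀ a₀, a ≠ Sum.map (skip i) id a₀ := by
      rintro a ha a₀ rfl
      have := hEg a₀
      rcases ha with h | h <;> rw [h] at this <;> simp [hE0, hE1] at this
    have key : ∀ t k, circ R (.inr t) = circ R (e k) ↔ k = .inl i.castSucc ∨ k = .inl i.succ := by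
      intro t k
      have ht : circ R (.inr t) = circ R (.inr 0) := by
        fin_cases t
        · rfl
        · exact h₀.symm
      rw [ht]
      rcases hcases k with rfl | rfl | ⟨a₀, rfl⟩
      · simp [hE0]
      · simp [hE1, h₀]
      · rw [hEg]
        exact iff_of_false (hne _ _) fun h => hng _ h a₀ rfl
    intro a ha
    rcases hcases a with rfl | rfl | ⟨a₀, rfl⟩
    · exact ⟨.inl i.succ, hng _ (Or.inr rfl), by simpa using hcs.symm, by rw [hE0]; exact key 0⟩
    · exact ⟨.inl i.castSucc, hng _ (Or.inl rfl), by simpa using hcs,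
        by rw [hE1]; exact fun k => (key 1 k).trans or_comm⟩
    · exact absurd rfl (ha a₀)

theorem Code.cap_good (i : Fin (m + 1)) (C : Code (m + 2)) (h : Good C.turn C.ends Set.univ) :
    Good (Code.cap i C).turn (Code.cap i C).ends Set.univ := by
  have hg := h.addE (i₁ := .inl i.castSucc) (i₂ := .inl i.succ) trivial trivial
    (by simpa using i.castSucc_lt_succ.ne)
  let g : Fin m ⊕ C.X × Fin 4 → Fin (m + 2) ⊕ C.X × Fin 4 := Sum.map (skip i) id
  have hinj : Function.Injective g :=
    Function.Injective.sumMap (skip_strictMono i).injective Function.injective_id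
  have hgP : ∀ a, g a ∈ (Set.univ \ {.inl i.castSucc, .inl i.succ} : Set (Fin (m + 2) ⊕ C.X × Fin 4))
      := by
    rintro (j | x)
    · simpa [g] using ⟨skip_ne_castSucc i j, skip_ne_succ i j⟩
    · simp [g]
  have hge : ∀ a, (Code.cap i C).ends a = C.ends (g a) := by
    rintro (j | x) <;> rfl
  intro (a : Fin m ⊕ C.X × Fin 4) _
  obtain ⟨k, hk, hne, hkk⟩ := hg (g a) (hgP a)
  obtain ⟨a', rfl⟩ : ∃ a', k = g a' := by
    rcases k with k | x
    · rcases skip_cases i k with rfl | rfl | ⟨j, rfl⟩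
      · simp at hk
      · simp at hk
      · exact ⟨.inl j, rfl⟩
    · exact ⟨.inr x, rfl⟩
  refine ⟨a', trivial, fun h => hne (congrArg g h), fun (l : Fin m ⊕ C.X × Fin 4) _ => ?_⟩
  have := hkk (g l) (hgP l)
  rw [hinj.eq_iff, hinj.eq_iff] at this
  rw [← hge a, ← hge l] at this
  exact this

theorem Code.cross_bd (i : Fin (m + 1)) (b : Bool) (C : Code (m + 2)) :
    (Code.cross i b C).bd i.castSucc = .inr 0 ∧ (Code.cross i b C).bd i.succ = .inr 1 ∧
      ∀ k, k ≠ i.castSucc → k ≠ i.succ → (Code.cross i b C).bd k = .inl (C.bd k) := by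
  refine ⟨by simp [Code.cross], by simp [Code.cross, i.castSucc_lt_succ.ne'], fun k h h' => ?_⟩
  simp [Code.cross, h, h']

/-- The old end points `i` and `i + 1` turn into the far ends of the new crossing. Each of the two
new points is counted as two ends, a near end of the crossing and an end point of the diagram, and
so forms a trivial arc of its own. -/
theorem Code.cross_good (i : Fin (m + 1)) (b : Bool) (C : Code (m + 2))
    (h : Good C.turn C.ends Set.univ) :
    Good (Code.cross i b C).turn (Code.cross i b C).ends Set.univ := by
  obtain ⟨R, hR⟩ : ∃ R : C.V ⊕ Fin 2 → C.V ⊕ Fin 2 → Prop, R = (Code.cross i b C).turn := ⟨_, rfl⟩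
  obtain ⟨e, he⟩ : ∃ e : Fin (m + 2) ⊕ Option C.X × Fin 4 → C.V ⊕ Fin 2,
    e = (Code.cross i b C).ends := ⟨_, rfl⟩
  change Good (E := Fin (m + 2) ⊕ Option C.X × Fin 4) (V := C.V ⊕ Fin 2) _ _ _
  rw [← hR, ← he]
  have h₁ : ∀ u k, ¬R (.inl u) (.inr k) := by simp [hR, Code.cross]
  have h₂ : ∀ u k, ¬R (.inr k) (.inl u) := by simp [hR, Code.cross]
  have hinl := circ_inl_iff (R := R) (r := C.turn) (by simp [hR, Code.cross]) h₁ h₂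
  have hne := circ_inr_ne h₁ h₂
  have h01 : circ R (.inr 0) ≠ circ R (.inr 1) := by
    intro hc
    have := circ_lift (Sum.elim (fun _ => (0 : Fin 2)) id) (by
      rw [hR]; rintro u v ⟨u', v', rfl, rfl, -⟩; rfl) hc
    simp at this
  obtain ⟨hb0, hb1, hb2⟩ := Code.cross_bd i b C
  have hcs := i.castSucc_lt_succ.ne
  let g : Fin (m + 2) ⊕ C.X × Fin 4 → Fin (m + 2) ⊕ Option C.X × Fin 4 := fun a => a.elim
    (fun k => if k = i.castSucc then .inr (none, 2) else if k = i.succ then .inr (none, 3) else .inl k)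
    fun x => .inr (some x.1, x.2)
  refine h.extend Sum.inl g ?_ hinl ?_ ?_
  · rintro (k | ⟨x, k⟩) (l | ⟨y, l⟩) hkl
    · simp only [g, Sum.elim_inl] at hkl
      congr 1
      split_ifs at hkl <;> simp_all
    · simp only [g, Sum.elim_inl, Sum.elim_inr] at hkl
      split_ifs at hkl <;> simp_all
    · simp only [g, Sum.elim_inl, Sum.elim_inr] at hkl
      split_ifs at hkl <;> simp_all
    · simpa [g] using hkl
  · rw [he]
    rintro (k | ⟨x, k⟩)
    · simp only [g, Sum.elim_inl]
      split_ifs with h1 h2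
      · rw [h1]; rfl
      · rw [h2]; rfl
      · exact hb2 k h1 h2
    · fin_cases k <;> rfl
  · have hE0 : e (.inr (none, 0)) = .inr 0 := by rw [he]; rfl
    have hE1 : e (.inr (none, 1)) = .inr 1 := by rw [he]; rfl
    have hb0' : e (.inl i.castSucc) = .inr 0 := he ▸ hb0
    have hb1' : e (.inl i.succ) = .inr 1 := he ▸ hb1
    have hcases : ∀ a, (a = .inl i.castSucc ∨ a = .inr (none, 0)) ∨
        (a = .inl i.succ ∨ a = .inr (none, 1)) ∨ ∃ a₀, a = g a₀ := by
      rintro (k | ⟨_ | x, k⟩)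
      · by_cases h1 : k = i.castSucc
        · exact Or.inl (Or.inl (by rw [h1]))
        by_cases h2 : k = i.succ
        · exact Or.inr (Or.inl (Or.inl (by rw [h2])))
        exact Or.inr (Or.inr ⟨.inl k, by simp [g, h1, h2]⟩)
      · fin_cases k
        · simp
        · simp
        · exact Or.inr (Or.inr ⟨.inl i.castSucc, by simp [g]⟩)
        · exact Or.inr (Or.inr ⟨.inl i.succ, by simp [g, hcs.symm]⟩)
      · exact Or.inr (Or.inr ⟨.inr (x, k), rfl⟩)
    have hge : ∀ a₀, ∃ v, e (g a₀) = .inl v := by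
      rw [he]
      rintro (k | ⟨x, k⟩)
      · simp only [g, Sum.elim_inl]
        split_ifs with h1 h2
        · exact ⟨_, rfl⟩
        · exact ⟨_, rfl⟩
        · exact ⟨_, hb2 k h1 h2⟩
      · fin_cases k <;> exact ⟨_, rfl⟩
    have hng : ∀ a, (a = .inl i.castSucc ∨ a = .inr (none, 0)) ∨
        (a = .inl i.succ ∨ a = .inr (none, 1)) → ∀ a₀, a ≠ g a₀ := by
      rintro a ha a₀ rfl
      obtain ⟨v, hv⟩ := hge a₀
      rcases ha with (h | h) | (h | h) <;> rw [h] at hv <;> simp [hE0, hE1, hb0', hb1'] at hv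
    have key0 : ∀ k, circ R (.inr 0) =
        circ R (e k) ↔
          (k = .inl i.castSucc ∨ k = .inr (none, 0)) := by
      intro k
      rcases hcases k with (rfl | rfl) | (rfl | rfl) | ⟨a₀, rfl⟩
      · simp [hb0']
      · simp [hE0]
      · rw [hb1']
        exact iff_of_false h01 (by simp [hcs.symm])
      · rw [hE1]
        exact iff_of_false h01 (by simp)
      · obtain ⟨v, hv⟩ := hge a₀
        rw [hv]
        exact iff_of_false (hne _ _) fun h => hng _ (Or.inl h) a₀ rfl
    have key1 : ∀ k, circ R (.inr 1) =
        circ R (e k) ↔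
          (k = .inl i.succ ∨ k = .inr (none, 1)) := by
      intro k
      rcases hcases k with (rfl | rfl) | (rfl | rfl) | ⟨a₀, rfl⟩
      · rw [hb0']
        exact iff_of_false h01.symm (by simp [hcs])
      · rw [hE0]
        exact iff_of_false h01.symm (by simp)
      · simp [hb1']
      · simp [hE1]
      · obtain ⟨v, hv⟩ := hge a₀
        rw [hv]
        exact iff_of_false (hne _ _) fun h => hng _ (Or.inr h) a₀ rfl
    intro a ha
    rcases hcases a with (rfl | rfl) | (rfl | rfl) | ⟨a₀, rfl⟩
    · exact ⟨.inr (none, 0), hng _ (Or.inl (Or.inr rfl)), by simp, by rw [hb0']; exact key0⟩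
    · exact ⟨.inl i.castSucc, hng _ (Or.inl (Or.inl rfl)), by simp,
        by rw [hE0]; exact fun k => (key0 k).trans or_comm⟩
    · exact ⟨.inr (none, 1), hng _ (Or.inr (Or.inr rfl)), by simp, by rw [hb1']; exact key1⟩
    · exact ⟨.inl i.succ, hng _ (Or.inr (Or.inl rfl)), by simp,
        by rw [hE1]; exact fun k => (key1 k).trans or_comm⟩
    · exact absurd rfl (ha a₀)

theorem Tangle.good : ∀ {m : ℕ} (T : Tangle m), Good T.code.turn T.code.ends Set.univ
  | _, .empty => by
    rintro (j | x)
    · exact j.elim0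
    · exact x.1.elim
  | _, .cup i T => Code.cup_good i _ T.good
  | _, .cap i T => Code.cap_good i _ T.good
  | _, .cross i b T => Code.cross_good i b _ T.good

/-- Arcs that run through horizontally arise only on the line along which two diagrams are glued. -/
theorem Tangle.not_thru : ∀ {m : ℕ} (T : Tangle m) (u v : T.code.V), ¬T.code.thru u v
  | _, .empty, u, _ => u.elim
  | _, .cup _ T, _, _ => by
    rintro ⟨u, v, -, -, h⟩
    exact T.not_thru u v h
  | _, .cap _ T, u, v => T.not_thru u v
  | _, .cross _ _ T, _, _ => by
    rintro ⟨u, v, -, -, h⟩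
    exact T.not_thru u v h

end TangleEnds

/-! ### Resolving crossings one at a time; noncrossing pairings -/

section Resolutions

variable {m : ℕ}

/-- The 1-manifold obtained by resolving the crossings in `Y` according to `ρ`, and removing the
others. -/
def Code.res (C : Code m) (Y : Set C.X) (ρ : C.X → Bool) (u v : C.V) : Prop :=
  C.turn u v ∨ C.thru u v ∨
  (∃ x ∈ Y, C.rising x ≠ ρ x ∧
    ((u = C.nearLo x ∧ v = C.nearHi x) ∨ (u = C.farLo x ∧ v = C.farHi x))) ∨
  (∃ x ∈ Y, C.rising x = ρ x ∧
    ((u = C.nearLo x ∧ v = C.farLo x) ∨ (u = C.nearHi x ∧ v = C.farHi x)))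

theorem Code.res_insert (C : Code m) (Y : Set C.X) (ρ : C.X → Bool) (x : C.X) :
    Same (C.res (insert x Y) ρ) (if C.rising x ≠ ρ x then
        addE (addE (C.res Y ρ) (C.nearLo x) (C.nearHi x)) (C.farLo x) (C.farHi x) else
        addE (addE (C.res Y ρ) (C.nearLo x) (C.farLo x)) (C.nearHi x) (C.farHi x)) := by
  split_ifs with hx <;> refine same_of (fun u v k => circ_of ?_) (fun u v k => circ_of ?_)
  · rcases k with k | k | ⟨y, rfl | hy, h1, k⟩ | ⟨y, rfl | hy, h1, k⟩
    · exact Or.inl (Or.inl (Or.inl k))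
    · exact Or.inl (Or.inl (Or.inr (Or.inl k)))
    · rcases k with k | k
      · exact Or.inl (Or.inr k)
      · exact Or.inr k
    · exact Or.inl (Or.inl (Or.inr (Or.inr (Or.inl ⟨y, hy, h1, k⟩))))
    · exact absurd h1 hx
    · exact Or.inl (Or.inl (Or.inr (Or.inr (Or.inr ⟨y, hy, h1, k⟩))))
  · rcases k with (k | k) | k
    · rcases k with k | k | ⟨y, hy, k⟩ | ⟨y, hy, k⟩
      · exact Or.inl k
      · exact Or.inr (Or.inl k)
      · exact Or.inr (Or.inr (Or.inl ⟨y, Or.inr hy, k⟩))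
      · exact Or.inr (Or.inr (Or.inr ⟨y, Or.inr hy, k⟩))
    · exact Or.inr (Or.inr (Or.inl ⟨x, Or.inl rfl, hx, Or.inl k⟩))
    · exact Or.inr (Or.inr (Or.inl ⟨x, Or.inl rfl, hx, Or.inr k⟩))
  · rcases k with k | k | ⟨y, rfl | hy, h1, k⟩ | ⟨y, rfl | hy, h1, k⟩
    · exact Or.inl (Or.inl (Or.inl k))
    · exact Or.inl (Or.inl (Or.inr (Or.inl k)))
    · exact absurd h1 hx
    · exact Or.inl (Or.inl (Or.inr (Or.inr (Or.inl ⟨y, hy, h1, k⟩))))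
    · rcases k with k | k
      · exact Or.inl (Or.inr k)
      · exact Or.inr k
    · exact Or.inl (Or.inl (Or.inr (Or.inr (Or.inr ⟨y, hy, h1, k⟩))))
  · rcases k with (k | k) | k
    · rcases k with k | k | ⟨y, hy, k⟩ | ⟨y, hy, k⟩
      · exact Or.inl k
      · exact Or.inr (Or.inl k)
      · exact Or.inr (Or.inr (Or.inl ⟨y, Or.inr hy, k⟩))
      · exact Or.inr (Or.inr (Or.inr ⟨y, Or.inr hy, k⟩))
    · exact Or.inr (Or.inr (Or.inr ⟨x, Or.inl rfl, not_not.1 hx, Or.inl k⟩))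
    · exact Or.inr (Or.inr (Or.inr ⟨x, Or.inl rfl, not_not.1 hx, Or.inr k⟩))

/-- By induction on the set of resolved crossings: resolving a crossing adds two edges, which use up
its four ends, so `Good.addE` applies twice. When all crossings are resolved, only the end points of
the diagram are left. -/
theorem Code.res_good (C : Code m) (ht : ∀ u v, ¬C.thru u v) (h : Good C.turn C.ends Set.univ)
    (ρ : C.X → Bool) (Y : Set C.X) :
    Good (C.res Y ρ) C.ends {a | ∀ x k, a = .inr (x, k) → x ∉ Y} := by
  classical
  induction Y, Set.toFinite Y using Set.Finite.induction_on with
  | empty =>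
    have : {a : Fin m ⊕ C.X × Fin 4 | ∀ x k, a = .inr (x, k) → x ∉ (∅ : Set C.X)} = Set.univ := by
      ext; simp
    rw [this]
    exact h.congr (same_of (fun u v k => circ_of (Or.inl k)) fun u v k =>
      circ_of (by simpa [Code.res, ht] using k))
  | @insert x Y hx _ ih =>
    have hY : ∀ k : Fin 4, Sum.inr (x, k) ∈
        {a : Fin m ⊕ C.X × Fin 4 | ∀ x k, a = .inr (x, k) → x ∉ Y} := by
      rintro k y l h
      cases h
      exact hx
    refine Good.congr ?_ (C.res_insert Y ρ x).symm
    have hmem : ∀ k₀ k₁ k₂ k₃ : Fin 4, (∀ k, k = k₀ ∨ k = k₁ ∨ k = k₂ ∨ k = k₃) →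
        {a : Fin m ⊕ C.X × Fin 4 | ∀ y k, a = .inr (y, k) → y ∉ insert x Y} =
        ({a : Fin m ⊕ C.X × Fin 4 | ∀ y k, a = .inr (y, k) → y ∉ Y} \
          {.inr (x, k₀), .inr (x, k₁)}) \ {.inr (x, k₂), .inr (x, k₃)} := by
      intro k₀ k₁ k₂ k₃ hk
      ext a
      constructor
      · intro h
        refine ⟨⟨fun y k e hy => h y k e (Or.inr hy), ?_⟩, ?_⟩ <;>
        · rintro (e | e) <;> exact h x _ e (Or.inl rfl)
      · rintro ⟨⟨h1, h2⟩, h3⟩ y k rfl (rfl | hy)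
        · rcases hk k with rfl | rfl | rfl | rfl
          · exact h2 (Or.inl rfl)
          · exact h2 (Or.inr rfl)
          · exact h3 (Or.inl rfl)
          · exact h3 (Or.inr rfl)
        · exact h1 y k rfl hy
    split_ifs
    · rw [hmem 0 1 2 3 (by decide)]
      have h1 := ih.addE (hY 0) (hY 1) (by simp)
      exact h1.addE (i₁ := .inr (x, 2)) (i₂ := .inr (x, 3)) ⟨hY 2, by simp⟩ ⟨hY 3, by simp⟩
        (by simp)
    · rw [hmem 0 2 1 3 (by decide)]
      have h1 := ih.addE (hY 0) (hY 2) (by simp)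
      exact h1.addE (i₁ := .inr (x, 1)) (i₂ := .inr (x, 3)) ⟨hY 1, by simp⟩ ⟨hY 3, by simp⟩
        (by simp)

theorem Code.res_pair (C : Code m) (ht : ∀ u v, ¬C.thru u v) (h : Good C.turn C.ends Set.univ)
    (ρ : C.X → Bool) (i : Fin m) : ∃ i', i' ≠ i ∧ ∀ k,
      circ (C.res Set.univ ρ) (C.bd i) = circ (C.res Set.univ ρ) (C.bd k) ↔ k = i ∨ k = i' := by
  obtain ⟨a, ha, hne, hk⟩ := C.res_good ht h ρ Set.univ (.inl i) (by simp)
  rcases a with i' | ⟨x, k⟩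
  · refine ⟨i', fun e => hne (by rw [e]), fun k => ?_⟩
    have := hk (.inl k) (by simp)
    rwa [Sum.inl.injEq, Sum.inl.injEq] at this
  · exact absurd (Set.mem_univ x) (ha x k rfl)

/-- No two pairs of equal values are interleaved. -/
def NonCrossing {Q : Type} (f : Fin m → Q) : Prop :=
  ∀ i j k l, i < j → j < k → k < l → f i = f k → f j = f l → False

/-- A chord ending at `a` and one ending at the adjacent point `b` fuse into one chord. No point
lies between `a` and `b`, so whatever interleaves with the fused chord interleaves with one of its
two parts. By `h2`, two distinct further points cannot both be joined to `a`, so there is only one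
fused chord. -/
theorem NonCrossing.join {Q : Type} {f : Fin (m + 2) → Q} (h : NonCrossing f)
    (h2 : ∀ i j k, f i = f j → f i = f k → i = j ∨ i = k ∨ j = k) {a b : Fin (m + 2)}
    (hab : (b : ℕ) = a + 1) {i j k l : Fin (m + 2)} (hij : i < j) (hjk : j < k) (hkl : k < l)
    (hi : i ≠ a ∧ i ≠ b) (hj : j ≠ a ∧ j ≠ b) (hk : k ≠ a ∧ k ≠ b) (hl : l ≠ a ∧ l ≠ b)
    (hik : f i = f k ∨ (f i = f a ∧ f k = f b) ∨ (f i = f b ∧ f k = f a))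
    (hjl : f j = f l ∨ (f j = f a ∧ f l = f b) ∨ (f j = f b ∧ f l = f a)) : False := by
  -- One of the two pairs is an old chord and the other is the fused one; the position of `a`
  -- relative to the old chord decides which part crosses it. The statement is symmetric in `a` and
  -- `b`, to cover both orders of fusing.
  have key : ∀ a b : Fin (m + 2), ((b : ℕ) = a + 1 ∨ (a : ℕ) = b + 1) → i ≠ a → i ≠ b → j ≠ a →
      j ≠ b → k ≠ a → k ≠ b → l ≠ a → l ≠ b →
      ((f i = f k ∧ f j = f a ∧ f l = f b) ∨ (f i = f a ∧ f k = f b ∧ f j = f l)) → False := by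
    intro a b hab ia ib ja jb ka kb la lb hf
    rcases hf with ⟨h3, h4, h5⟩ | ⟨h3, h4, h5⟩
    · rcases lt_trichotomy a i with h6 | h6 | h6
      · exact h a i j k h6 hij hjk h4.symm h3
      · exact ia h6.symm
      · rcases lt_trichotomy a k with h7 | h7 | h7
        · exact h i b k l (by omega) (by omega) hkl h3 h5.symm
        · exact ka h7.symm
        · exact h i j k a hij hjk h7 h3 h4
    · rcases lt_trichotomy a j with h6 | h6 | h6
      · exact h b j k l (by omega) hjk hkl h4.symm h5
      · exact ja h6.symm
      · rcases lt_trichotomy a l with h7 | h7 | h7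
        · exact h i j a l hij h6 h7 h3 h5
        · exact la h7.symm
        · exact h j k l b hjk hkl (by omega) h5 h4
  have key₁ := key a b (Or.inl hab) hi.1 hi.2 hj.1 hj.2 hk.1 hk.2 hl.1 hl.2
  have key₂ := key b a (Or.inr hab) hi.2 hi.1 hj.2 hj.1 hk.2 hk.1 hl.2 hl.1
  have hi' := hi.1
  have hj' := hj.1
  have hk' := hk.1
  have hl' := hl.1
  rcases hik with h3 | ⟨h3, h4⟩ | ⟨h3, h4⟩ <;> rcases hjl with h5 | ⟨h5, h6⟩ | ⟨h5, h6⟩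
  · exact h i j k l hij hjk hkl h3 h5
  · exact key₁ (Or.inl ⟨h3, h5, h6⟩)
  · exact key₂ (Or.inl ⟨h3, h5, h6⟩)
  · exact key₁ (Or.inr ⟨h3, h4, h5⟩)
  · rcases h2 a i j h3.symm h5.symm with e | e | e
    · exact hi' e.symm
    · exact hj' e.symm
    · exact hij.ne e
  · rcases h2 a i l h3.symm h6.symm with e | e | e
    · exact hi' e.symm
    · exact hl' e.symm
    · exact (hij.trans (hjk.trans hkl)).ne e
  · exact key₂ (Or.inr ⟨h3, h4, h5⟩)
  · rcases h2 a k j h4.symm h5.symm with e | e | e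
    · exact hk' e.symm
    · exact hj' e.symm
    · exact hjk.ne e.symm
  · rcases h2 a k l h4.symm h6.symm with e | e | e
    · exact hk' e.symm
    · exact hl' e.symm
    · exact hkl.ne e

end Resolutions

/-! ### Resolutions of tangles induce crossingless matchings -/

section Planar

variable {m : ℕ}

/-- No chord leads from the adjacent points `a`, `b` to any other point, and a chord between
adjacent points encloses nothing, so these two points can be left out of any interleaving. -/
theorem NonCrossing.of_adjacent {Q : Type} {f : Fin (m + 2) → Q} {a b : Fin (m + 2)}
    (hab : (b : ℕ) = a + 1) (hne : ∀ k, k ≠ a → k ≠ b → f k ≠ f a ∧ f k ≠ f b)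
    (h : ∀ i j k l, i < j → j < k → k < l → (i ≠ a ∧ i ≠ b) → (j ≠ a ∧ j ≠ b) → (k ≠ a ∧ k ≠ b) →
      (l ≠ a ∧ l ≠ b) → f i = f k → f j = f l → False) : NonCrossing f := by
  intro i j k l hij hjk hkl hik hjl
  have key : ∀ x y z : Fin (m + 2), x < y → y < z → f x = f z →
      (x ≠ a ∧ x ≠ b) ∧ (z ≠ a ∧ z ≠ b) := by
    intro x y z hxy hyz hxz
    have hx : x ≠ a ∧ x ≠ b ∨ x = a ∨ x = b := by tauto
    have hz : z ≠ a ∧ z ≠ b ∨ z = a ∨ z = b := by tauto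
    rcases hx with hx | hx | hx <;> rcases hz with hz | hz | hz
    · exact ⟨hx, hz⟩
    · exact ((hne x hx.1 hx.2).1 (hz ▸ hxz)).elim
    · exact ((hne x hx.1 hx.2).2 (hz ▸ hxz)).elim
    · exact ((hne z hz.1 hz.2).1 (hx ▸ hxz.symm)).elim
    · omega
    · omega
    · exact ((hne z hz.1 hz.2).2 (hx ▸ hxz.symm)).elim
    · omega
    · omega
  obtain ⟨hi, hk⟩ := key i j k hij hjk hik
  obtain ⟨hj, hl⟩ := key j k l hjk hkl hjl
  exact h i j k l hij hjk hkl hi hj hk hl hik hjl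

theorem Code.cup_res_nonCrossing (i : Fin (m + 1)) (C : Code m) (ρ : C.X → Bool)
    (h : NonCrossing fun j => circ (C.res Set.univ ρ) (C.bd j)) :
    NonCrossing fun j => circ ((Code.cup i C).res Set.univ ρ) ((Code.cup i C).bd j) := by
  obtain ⟨R, hR⟩ : ∃ R : C.V ⊕ Fin 2 → C.V ⊕ Fin 2 → Prop, R = (Code.cup i C).res Set.univ ρ :=
    ⟨_, rfl⟩
  obtain ⟨e, he⟩ : ∃ e : Fin (m + 2) → C.V ⊕ Fin 2, e = (Code.cup i C).bd := ⟨_, rfl⟩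
  change NonCrossing fun j => circ (V := C.V ⊕ Fin 2) _ _
  rw [← hR, ← he]
  have h₁ : ∀ u k, ¬R (.inl u) (.inr k) := by simp [hR, Code.res, Code.cup]
  have h₂ : ∀ u k, ¬R (.inr k) (.inl u) := by simp [hR, Code.res, Code.cup]
  have hinl := circ_inl_iff (R := R) (r := C.res Set.univ ρ)
    (by simp [hR, Code.res, Code.cup]) h₁ h₂
  have hne := circ_inr_ne h₁ h₂
  have hE0 : e i.castSucc = .inr 0 := he ▸ Code.cup_bd_castSucc i C
  have hE1 : e i.succ = .inr 1 := he ▸ Code.cup_bd_succ i C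
  have hEs : ∀ j, e (skip i j) = .inl (C.bd j) := he ▸ Code.cup_bd_skip i C
  have hs : ∀ k, k ≠ i.castSucc → k ≠ i.succ → ∃ j, k = skip i j := by
    intro k h h'
    rcases skip_cases i k with h1 | h1 | h1
    · exact (h h1).elim
    · exact (h' h1).elim
    · exact h1
  refine NonCrossing.of_adjacent (a := i.castSucc) (b := i.succ) (by simp) ?_ ?_
  · intro k hk hk'
    obtain ⟨j, rfl⟩ := hs k hk hk'
    rw [hE0, hE1, hEs]
    exact ⟨(hne _ _).symm, (hne _ _).symm⟩
  · intro a b c d hab hbc hcd ha hb hc hd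
    obtain ⟨a, rfl⟩ := hs a ha.1 ha.2
    obtain ⟨b, rfl⟩ := hs b hb.1 hb.2
    obtain ⟨c, rfl⟩ := hs c hc.1 hc.2
    obtain ⟨d, rfl⟩ := hs d hd.1 hd.2
    have hm : ∀ {x y}, skip i x < skip i y ↔ x < y := (skip_strictMono i).lt_iff_lt
    rw [hEs, hEs, hEs, hEs, hinl, hinl]
    exact h a b c d (hm.1 hab) (hm.1 hbc) (hm.1 hcd)

theorem Code.cap_res_nonCrossing (i : Fin (m + 1)) (C : Code (m + 2)) (ρ : C.X → Bool)
    (h2 : ∀ j, ∃ j', j' ≠ j ∧ ∀ k,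
      circ (C.res Set.univ ρ) (C.bd j) = circ (C.res Set.univ ρ) (C.bd k) ↔ k = j ∨ k = j')
    (h : NonCrossing fun j => circ (C.res Set.univ ρ) (C.bd j)) :
    NonCrossing fun j => circ ((Code.cap i C).res Set.univ ρ) ((Code.cap i C).bd j) := by
  have hs : Same ((Code.cap i C).res Set.univ ρ)
      (addE (C.res Set.univ ρ) (C.bd i.castSucc) (C.bd i.succ)) := by
    refine same_of (fun u v k => circ_of ?_) (fun u v k => circ_of ?_)
    · rcases k with (k | k) | k | k
      · exact Or.inl (Or.inl k)
      · exact Or.inr k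
      · exact Or.inl (Or.inr (Or.inl k))
      · exact Or.inl (Or.inr (Or.inr k))
    · rcases k with (k | k | k) | k
      · exact Or.inl (Or.inl k)
      · exact Or.inr (Or.inl k)
      · exact Or.inr (Or.inr k)
      · exact Or.inl (Or.inr k)
  intro a b c d hab hbc hcd hac hbd
  have hm : ∀ {x y}, skip i x < skip i y ↔ x < y := (skip_strictMono i).lt_iff_lt
  have hsk : ∀ j, skip i j ≠ i.castSucc ∧ skip i j ≠ i.succ :=
    fun j => ⟨skip_ne_castSucc i j, skip_ne_succ i j⟩
  refine h.join ?_ (a := i.castSucc) (b := i.succ) (by simp) (hm.2 hab) (hm.2 hbc) (hm.2 hcd)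
    (hsk _) (hsk _) (hsk _) (hsk _) (circ_addE.1 ((hs _ _).1 hac)) (circ_addE.1 ((hs _ _).1 hbd))
  intro x y z hxy hxz
  obtain ⟨x', -, hx⟩ := h2 x
  have := (hx y).1 hxy
  have := (hx z).1 hxz
  grind

theorem Code.cross_res_nonCrossing (i : Fin (m + 1)) (b : Bool) (C : Code (m + 2))
    (ρ : Option C.X → Bool)
    (h2 : ∀ j, ∃ j', j' ≠ j ∧ ∀ k, circ (C.res Set.univ fun x => ρ (some x)) (C.bd j) =
      circ (C.res Set.univ fun x => ρ (some x)) (C.bd k) ↔ k = j ∨ k = j')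
    (h : NonCrossing fun j => circ (C.res Set.univ fun x => ρ (some x)) (C.bd j)) :
    NonCrossing fun j => circ ((Code.cross i b C).res Set.univ ρ) ((Code.cross i b C).bd j) := by
  obtain ⟨R, hR⟩ : ∃ R : C.V ⊕ Fin 2 → C.V ⊕ Fin 2 → Prop,
    R = (Code.cross i b C).res Set.univ ρ := ⟨_, rfl⟩
  obtain ⟨e, he⟩ : ∃ e : Fin (m + 2) → C.V ⊕ Fin 2, e = (Code.cross i b C).bd := ⟨_, rfl⟩
  change NonCrossing fun j => circ (V := C.V ⊕ Fin 2) _ _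
  rw [← hR, ← he]
  obtain ⟨hb0, hb1, hb2⟩ : e i.castSucc = .inr 0 ∧ e i.succ = .inr 1 ∧
    ∀ k, k ≠ i.castSucc → k ≠ i.succ → e k = .inl (C.bd k) := he ▸ Code.cross_bd i b C
  have hR' : ∀ u v, R u v ↔
      (∃ u' v', u = .inl u' ∧ v = .inl v' ∧ C.res Set.univ (fun x => ρ (some x)) u' v') ∨
      (b ≠ ρ none ∧ ((u = .inr 0 ∧ v = .inr 1) ∨
        (u = .inl (C.bd i.castSucc) ∧ v = .inl (C.bd i.succ)))) ∨
      (b = ρ none ∧ ((u = .inr 0 ∧ v = .inl (C.bd i.castSucc)) ∨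
        (u = .inr 1 ∧ v = .inl (C.bd i.succ)))) := by
    intro u v
    rw [hR]
    constructor
    · rintro (⟨u, v, rfl, rfl, k⟩ | ⟨u, v, rfl, rfl, k⟩ | ⟨_ | x, -, h1, k⟩ | ⟨_ | x, -, h1, k⟩)
      · exact Or.inl ⟨u, v, rfl, rfl, Or.inl k⟩
      · exact Or.inl ⟨u, v, rfl, rfl, Or.inr (Or.inl k)⟩
      · exact Or.inr (Or.inl ⟨h1, k⟩)
      · rcases k with ⟨rfl, rfl⟩ | ⟨rfl, rfl⟩
        · exact Or.inl ⟨_, _, rfl, rfl, Or.inr (Or.inr (Or.inl ⟨x, trivial, h1, Or.inl ⟨rfl, rfl⟩⟩))⟩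
        · exact Or.inl ⟨_, _, rfl, rfl, Or.inr (Or.inr (Or.inl ⟨x, trivial, h1, Or.inr ⟨rfl, rfl⟩⟩))⟩
      · exact Or.inr (Or.inr ⟨h1, k⟩)
      · rcases k with ⟨rfl, rfl⟩ | ⟨rfl, rfl⟩
        · exact Or.inl ⟨_, _, rfl, rfl, Or.inr (Or.inr (Or.inr ⟨x, trivial, h1, Or.inl ⟨rfl, rfl⟩⟩))⟩
        · exact Or.inl ⟨_, _, rfl, rfl, Or.inr (Or.inr (Or.inr ⟨x, trivial, h1, Or.inr ⟨rfl, rfl⟩⟩))⟩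
    · rintro (⟨u, v, rfl, rfl, k | k | ⟨x, -, h1, k⟩ | ⟨x, -, h1, k⟩⟩ | ⟨h1, k⟩ | ⟨h1, k⟩)
      · exact Or.inl ⟨u, v, rfl, rfl, k⟩
      · exact Or.inr (Or.inl ⟨u, v, rfl, rfl, k⟩)
      · refine Or.inr (Or.inr (Or.inl ⟨some x, trivial, h1, ?_⟩))
        rcases k with ⟨rfl, rfl⟩ | ⟨rfl, rfl⟩
        · exact Or.inl ⟨rfl, rfl⟩
        · exact Or.inr ⟨rfl, rfl⟩
      · refine Or.inr (Or.inr (Or.inr ⟨some x, trivial, h1, ?_⟩))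
        rcases k with ⟨rfl, rfl⟩ | ⟨rfl, rfl⟩
        · exact Or.inl ⟨rfl, rfl⟩
        · exact Or.inr ⟨rfl, rfl⟩
      · exact Or.inr (Or.inr (Or.inl ⟨none, trivial, h1, k⟩))
      · exact Or.inr (Or.inr (Or.inr ⟨none, trivial, h1, k⟩))
  clear hR
  generalize C.res Set.univ (fun x => ρ (some x)) = r at *
  -- One resolution continues both strands straight on and leaves the pairing unchanged; the other
  -- is a cap on the old strands followed by a new cup.
  by_cases hb : b = ρ none
  · have hR₀ : R (.inr 0) (.inl (C.bd i.castSucc)) :=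
      (hR' _ _).2 (Or.inr (Or.inr ⟨hb, Or.inl ⟨rfl, rfl⟩⟩))
    have hR₁ : R (.inr 1) (.inl (C.bd i.succ)) :=
      (hR' _ _).2 (Or.inr (Or.inr ⟨hb, Or.inr ⟨rfl, rfl⟩⟩))
    have hinl : ∀ u v, circ R (.inl u) = circ R (.inl v) → circ r u = circ r v := by
      intro u v huv
      refine circ_lift (Sum.elim (circ r) ![circ r (C.bd i.castSucc), circ r (C.bd i.succ)]) ?_ huv
      intro u v k
      rcases (hR' _ _).1 k with ⟨u, v, rfl, rfl, k'⟩ | ⟨h1, -⟩ | ⟨-, ⟨rfl, rfl⟩ | ⟨rfl, rfl⟩⟩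
      · exact circ_of k'
      · exact (h1 hb).elim
      · rfl
      · rfl
    have hbd : ∀ k, circ R (e k) = circ R (.inl (C.bd k)) := by
      intro k
      by_cases h1 : k = i.castSucc
      · rw [h1, hb0]
        exact circ_of hR₀
      by_cases h2 : k = i.succ
      · rw [h2, hb1]
        exact circ_of hR₁
      rw [hb2 k h1 h2]
    intro j k l p hjk hkl hlp
    simp only [hbd]
    exact fun h3 h4 => h j k l p hjk hkl hlp (hinl _ _ h3) (hinl _ _ h4)
  · have h₁ : ∀ u k, ¬R (.inl u) (.inr k) := by simp [hR', hb]
    have h₂ : ∀ u k, ¬R (.inr k) (.inl u) := by simp [hR', hb]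
    have hinl := circ_inl_iff (R := R) (r := addE r (C.bd i.castSucc) (C.bd i.succ))
      (by simp [hR', hb, addE]) h₁ h₂
    have hne := circ_inr_ne h₁ h₂
    refine NonCrossing.of_adjacent (a := i.castSucc) (b := i.succ) (by simp) ?_ ?_
    · intro k hk hk'
      rw [hb0, hb1, hb2 k hk hk']
      exact ⟨(hne _ _).symm, (hne _ _).symm⟩
    · intro j k l p hjk hkl hlp hj hk hl hp
      rw [hb2 j hj.1 hj.2, hb2 k hk.1 hk.2, hb2 l hl.1 hl.2, hb2 p hp.1 hp.2, hinl, hinl, circ_addE,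
        circ_addE]
      refine h.join ?_ (a := i.castSucc) (b := i.succ) (by simp) hjk hkl hlp hj hk hl hp
      intro x y z hxy hxz
      obtain ⟨x', -, hx⟩ := h2 x
      have := (hx y).1 hxy
      have := (hx z).1 hxz
      grind

theorem Tangle.res_nonCrossing : ∀ {m : ℕ} (T : Tangle m) (ρ : T.code.X → Bool),
    NonCrossing fun j => circ (T.code.res Set.univ ρ) (T.code.bd j)
  | _, .empty, _ => fun i => i.elim0
  | _, .cup i T, ρ => Code.cup_res_nonCrossing i T.code ρ (T.res_nonCrossing ρ)
  | _, .cap i T, ρ => Code.cap_res_nonCrossing i T.code ρ (T.code.res_pair T.not_thru T.good ρ)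
      (T.res_nonCrossing ρ)
  | _, .cross i b T, ρ => Code.cross_res_nonCrossing i b T.code ρ
      (T.code.res_pair T.not_thru T.good _) (T.res_nonCrossing _)

theorem exists_isMatch {n : ℕ} {V : Type} {r : V → V → Prop} {bd : Fin (2 * n) → V}
    (h2 : ∀ i, ∃ i', i' ≠ i ∧ ∀ k, circ r (bd i) = circ r (bd k) ↔ k = i ∨ k = i')
    (h : NonCrossing fun j => circ r (bd j)) : ∃ b : Matching n, IsMatch r bd b := by
  choose f hf hk using h2
  have hc : ∀ i, circ r (bd i) = circ r (bd (f i)) := fun i => (hk i _).2 (Or.inr rfl)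
  refine ⟨⟨f, fun i => ?_, hf, fun i j hij hj hfj => ?_⟩, hk⟩
  · exact (((hk (f i) i).1 (hc i).symm).resolve_left (hf i).symm).symm
  · exact h i j (f i) (f j) hij hj hfj (hc i) (hc j)

end Planar

/-! ### Changing one resolution is a saddle -/

section Saddles

variable {n : ℕ}

theorem Diagram.resRel_eq {m : ℕ} (D : Diagram m) (ρ : D.Res) :
    D.resRel ρ = D.code.res Set.univ ρ := by
  funext u v
  simp only [Diagram.resRel, Code.res, Set.mem_univ, true_and]

theorem circ_edge {V : Type} {r : V → V → Prop} {a b : V} :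
    circ (addE r a b) a = circ (addE r a b) b := circ_of (Or.inr ⟨rfl, rfl⟩)

theorem circ_mono {V : Type} {r : V → V → Prop} {a b u v : V} (h : circ r u = circ r v) :
    circ (addE r a b) u = circ (addE r a b) v := circ_addE.2 (Or.inl h)

/-- Switching a pair of edges, `{p, s}` and `{q, t}`, to `{p, t}` and `{s, q}`. -/
theorem isSaddle_of {V : Type} {r r' g : V → V → Prop} {bd : Fin (2 * n) → V} {p q s t : V}
    (hr : Same r (addE (addE g p s) t q)) (hr' : Same r' (addE (addE g p t) s q))
    (hp : (∃ a, circ g p = circ g (bd a)) ∨ circ g p = circ g q ∨ circ g p = circ g s ∨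
      circ g p = circ g t)
    (hq : (∃ a, circ g q = circ g (bd a)) ∨ circ g q = circ g p ∨ circ g q = circ g s ∨
      circ g q = circ g t)
    (hs : (∃ a, circ g s = circ g (bd a)) ∨ circ g s = circ g p ∨ circ g s = circ g q ∨
      circ g s = circ g t)
    (ht : (∃ a, circ g t = circ g (bd a)) ∨ circ g t = circ g p ∨ circ g t = circ g q ∨
      circ g t = circ g s) : IsSaddle r r' bd p q := by
  have hc : ∀ u v, circ r u = circ r v ↔ _ := fun u v => (hr u v).trans circ_addE
  have hc' : ∀ u v, circ r' u = circ r' v ↔ _ := fun u v => (hr' u v).trans circ_addE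
  have hg : ∀ u v, circ g u = circ g v → circ r u = circ r v := fun u v h => by
    rw [hc, circ_addE]; exact Or.inl (Or.inl h)
  have hg' : ∀ u v, circ g u = circ g v → circ r' u = circ r' v := fun u v h => by
    rw [hc', circ_addE]; exact Or.inl (Or.inl h)
  have hps : circ r p = circ r s := by
    rw [hc, circ_addE]; exact Or.inl (Or.inr (Or.inl ⟨rfl, rfl⟩))
  have htq : circ r t = circ r q := by
    rw [hc]; exact Or.inr (Or.inl ⟨rfl, rfl⟩)
  have hpt : circ r' p = circ r' t := by
    rw [hc', circ_addE]; exact Or.inl (Or.inr (Or.inl ⟨rfl, rfl⟩))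
  have hsq : circ r' s = circ r' q := by
    rw [hc']; exact Or.inr (Or.inl ⟨rfl, rfl⟩)
  refine ⟨?_, fun h h' => ?_⟩
  · refine (hr.addE p q).trans (Same.trans (same_of ?_ ?_) (hr'.addE p q).symm)
    · rintro u v (((k | ⟨rfl, rfl⟩) | ⟨rfl, rfl⟩) | ⟨rfl, rfl⟩)
      · exact circ_of (Or.inl (Or.inl (Or.inl k)))
      · exact circ_edge.trans (circ_mono circ_edge).symm
      · exact (circ_mono (circ_mono circ_edge)).symm.trans circ_edge
      · exact circ_edge
    · rintro u v (((k | ⟨rfl, rfl⟩) | ⟨rfl, rfl⟩) | ⟨rfl, rfl⟩)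
      · exact circ_of (Or.inl (Or.inl (Or.inl k)))
      · exact circ_edge.trans (circ_mono circ_edge).symm
      · exact (circ_mono (circ_mono circ_edge)).symm.trans circ_edge
      · exact circ_edge
  · have h1 : ∃ a, circ g p = circ g (bd a) := by
      rcases hp with hp | hp | hp | hp
      · exact hp
      · exact (h (hg _ _ hp)).elim
      · exact (h' ((hg' _ _ hp).trans hsq)).elim
      · exact (h ((hg _ _ hp).trans htq)).elim
    have h2 : ∃ a, circ g q = circ g (bd a) := by
      rcases hq with hp | hp | hp | hp
      · exact hp
      · exact (h (hg _ _ hp).symm).elim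
      · exact (h (hps.trans (hg _ _ hp).symm)).elim
      · exact (h' (hpt.trans (hg' _ _ hp).symm)).elim
    have h3 : ∃ a, circ g s = circ g (bd a) := by
      rcases hs with hp | hp | hp | hp
      · exact hp
      · exact (h' ((hg' _ _ hp).symm.trans hsq)).elim
      · exact (h (hps.trans (hg _ _ hp))).elim
      · exact (h (hps.trans ((hg _ _ hp).trans htq))).elim
    have h4 : ∃ a, circ g t = circ g (bd a) := by
      rcases ht with hp | hp | hp | hp
      · exact hp
      · exact (h ((hg _ _ hp).symm.trans htq)).elim
      · exact (h' (hpt.trans (hg' _ _ hp))).elim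
      · exact (h (hps.trans ((hg _ _ hp).symm.trans htq))).elim
    obtain ⟨a, ha⟩ := h1
    obtain ⟨d', hd'⟩ := h2
    obtain ⟨a', ha'⟩ := h3
    obtain ⟨d, hd⟩ := h4
    exact ⟨a, a', d, d', ⟨hg _ _ ha, hps.trans (hg _ _ ha'), htq.symm.trans (hg _ _ hd),
      hg _ _ hd'⟩, hg' _ _ ha, hpt.trans (hg' _ _ hd), hsq.symm.trans (hg' _ _ ha'), hg' _ _ hd'⟩

theorem Code.res_congr {m : ℕ} (C : Code m) {Y : Set C.X} {ρ ρ' : C.X → Bool}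
    (h : ∀ x ∈ Y, ρ x = ρ' x) : C.res Y ρ = C.res Y ρ' := by
  funext u v
  simp only [Code.res, eq_iff_iff]
  refine or_congr Iff.rfl (or_congr Iff.rfl (or_congr ?_ ?_))
  · exact exists_congr fun x => and_congr_right fun hx => by rw [h x hx]
  · exact exists_congr fun x => and_congr_right fun hx => by rw [h x hx]

open Classical in
-- Let `g` be the manifold with all crossings but `x` resolved. The two resolutions of `x` add two
-- different pairs of edges between its four ends, and in both of them `nearLo` and `farHi` lie on
-- different edges. By `res_good`, a strand of `g` starting at one of these ends leads to a boundary
-- point or to another of them.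
theorem Code.isSaddle (C : Code (2 * n)) (ht : ∀ u v, ¬C.thru u v)
    (h : Good C.turn C.ends Set.univ) (ρ : C.X → Bool) {x : C.X} (hx : ρ x = false) :
    IsSaddle (C.res Set.univ ρ) (C.res Set.univ (Function.update ρ x true)) C.bd
      (C.nearLo x) (C.farHi x) := by
  have hY : insert x {x}ᶜ = (Set.univ : Set C.X) := by
    ext y
    simp [Classical.em]
  have h0 := C.res_insert {x}ᶜ ρ x
  have h1 := C.res_insert {x}ᶜ (Function.update ρ x true) x
  rw [hY] at h0 h1
  rw [Function.update_self, C.res_congr (Y := {x}ᶜ) (ρ' := ρ) fun y hy => Function.update_of_ne hy _ _] at h1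
  rw [hx] at h0
  have hg := C.res_good ht h ρ {x}ᶜ
  have hends : ∀ k : Fin 4, (∃ a, circ (C.res {x}ᶜ ρ) (C.endPt x k) = circ _ (C.bd a)) ∨
      ∃ l, l ≠ k ∧ circ (C.res {x}ᶜ ρ) (C.endPt x k) = circ _ (C.endPt x l) := by
    intro k
    obtain ⟨a, ha, hne, hk⟩ := hg (.inr (x, k)) (by rintro y l ⟨⟩; simp)
    have hc := (hk a ha).2 (Or.inr rfl)
    rcases a with j | ⟨y, l⟩
    · exact Or.inl ⟨j, hc⟩
    · have hy : y = x := by simpa using ha y l rfl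
      subst hy
      exact Or.inr ⟨l, fun e => hne (by rw [e]), hc⟩
  have hends' : ∀ k l₁ l₂ l₃ : Fin 4, (∀ l, l = k ∨ l = l₁ ∨ l = l₂ ∨ l = l₃) →
      (∃ a, circ (C.res {x}ᶜ ρ) (C.endPt x k) = circ _ (C.bd a)) ∨
      circ (C.res {x}ᶜ ρ) (C.endPt x k) = circ _ (C.endPt x l₁) ∨
      circ (C.res {x}ᶜ ρ) (C.endPt x k) = circ _ (C.endPt x l₂) ∨
      circ (C.res {x}ᶜ ρ) (C.endPt x k) = circ _ (C.endPt x l₃) := by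
    intro k l₁ l₂ l₃ hl
    rcases hends k with h | ⟨l, hne, hc⟩
    · exact Or.inl h
    rcases hl l with rfl | rfl | rfl | rfl
    · exact (hne rfl).elim
    · exact Or.inr (Or.inl hc)
    · exact Or.inr (Or.inr (Or.inl hc))
    · exact Or.inr (Or.inr (Or.inr hc))
  generalize C.res {x}ᶜ ρ = g at *
  -- `s` is the end joined to `nearLo x` by the `0`-resolution and `t` the one joined to it by the
  -- `1`-resolution.
  cases hr : C.rising x
  · rw [if_neg (by simp [hr])] at h0
    rw [if_pos (by simp [hr])] at h1
    refine isSaddle_of (g := g) (s := C.farLo x) (t := C.nearHi x) h0 h1 (hends' 0 3 2 1 ?_)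
      (hends' 3 0 2 1 ?_) (hends' 2 0 3 1 ?_) (hends' 1 0 3 2 ?_) <;> decide
  · rw [if_pos (by simp [hr])] at h0
    rw [if_neg (by simp [hr])] at h1
    refine isSaddle_of (g := g) (s := C.nearHi x) (t := C.farLo x) h0 h1 (hends' 0 3 1 2 ?_)
      (hends' 3 0 1 2 ?_) (hends' 1 0 3 2 ?_) (hends' 2 0 3 1 ?_) <;> decide

end Saddles

/-! ### Degrees of glued labellings -/

section Counting

variable {n : ℕ} {V₁ V₂ : Type} {s : V₂ → V₂ → Prop} {r : V₁ → V₁ → Prop}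
  {bd₂ : Fin (2 * n) → V₂} {bd₁ : Fin (2 * n) → V₁} {b : Matching n}

/-- Sum of the degrees of the labels of the circles that do not touch the boundary. -/
def freeDeg (r : V₁ → V₁ → Prop) (bd₁ : Fin (2 * n) → V₁) (x : Lab (closeUp r bd₁ b)) : ℤ :=
  ∑ᶠ c : {c : Quot (closeUp r bd₁ b) // ∀ j, c ≠ circ _ (bd₁ j)}, (1 - 2 * ((x c.1 : ℕ) : ℤ))

open Classical in
-- Each circle touching the line contains exactly two of the `2 * n` end points, so there are `n` of
-- them, and each contributes the degree `1` of its label `1`.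
theorem labDeg_eq_freeDeg [Finite V₁] (hm : IsMatch r bd₁ b) {x : Lab (closeUp r bd₁ b)}
    (hx : ∀ j, x (circ _ (bd₁ j)) = 0) : labDeg x = n + freeDeg r bd₁ x := by
  have := Fintype.ofFinite (Quot (closeUp r bd₁ b))
  let T : Quot (closeUp r bd₁ b) → Prop := fun c => ∀ j, c ≠ circ _ (bd₁ j)
  have hfib : ∀ c, ¬T c → (Finset.univ.filter fun j => circ (closeUp r bd₁ b) (bd₁ j) = c).card
      = 2 := by
    intro c hc
    simp only [T, not_forall, not_not] at hc
    obtain ⟨j, rfl⟩ := hc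
    have : (Finset.univ.filter fun k => circ (closeUp r bd₁ b) (bd₁ k) = circ _ (bd₁ j)) =
        {j, b.partner j} := by
      ext k
      rw [Finset.mem_filter, hm.closeUp_same _ _, eq_comm (a := circ r _), hm]
      simp
    rw [this, Finset.card_pair (b.ne_self j).symm]
  have hcard : (Finset.univ.filter fun c => ¬T c).card = n := by
    have h1 : (Finset.univ : Finset (Fin (2 * n))).card =
        ∑ c ∈ Finset.univ.filter fun c => ¬T c,
          (Finset.univ.filter fun j => circ (closeUp r bd₁ b) (bd₁ j) = c).card :=
      Finset.card_eq_sum_card_fiberwise fun j _ => by simpa [T] using ⟨j, rfl⟩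
    rw [Finset.sum_congr rfl fun c hc => hfib c (Finset.mem_filter.1 hc).2, Finset.sum_const,
      Finset.card_univ, Fintype.card_fin, smul_eq_mul] at h1
    omega
  rw [labDeg, freeDeg, finsum_eq_sum_of_fintype, finsum_eq_sum_of_fintype,
    ← Finset.sum_filter_add_sum_filter_not _ T, add_comm]
  congr 1
  · rw [Finset.sum_congr rfl (g := fun _ => (1 : ℤ)) ?_, Finset.sum_const, hcard]
    · simp
    · intro c hc
      have hc := (Finset.mem_filter.1 hc).2
      simp only [T, not_forall, not_not] at hc
      obtain ⟨j, rfl⟩ := hc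
      rw [hx]
      simp
  · exact (Finset.sum_subtype _ (by simp [T]) _)

theorem labDeg_glue [Finite V₁] [Finite V₂] (hm : IsMatch r bd₁ b) {Λ : Lab (glueRel s bd₂ r bd₁)}
    {σ : Lab (closeUp s bd₂ b)} {x : Lab (closeUp r bd₁ b)} (h : IsGlue b Λ σ x) :
    labDeg Λ = labDeg σ + freeDeg r bd₁ x := by
  have hs := hm.closeUp_same
  have hcl : ∀ u v, closeUp s bd₂ b u v →
      circ (glueRel s bd₂ r bd₁) (.inl u) = circ _ (.inl v) :=
    fun u v k => (glue_circ_inl hm u v).2 (circ_of k)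
  let φ : Quot (closeUp s bd₂ b) ⊕ {c : Quot (closeUp r bd₁ b) // ∀ j, c ≠ circ _ (bd₁ j)} →
      Quot (glueRel s bd₂ r bd₁) := Sum.elim (Quot.lift (fun u => circ _ (.inl u)) hcl)
        fun c => circ _ (.inr c.1.out)
  have hfree : ∀ c : {c : Quot (closeUp r bd₁ b) // ∀ j, c ≠ circ _ (bd₁ j)},
      ¬Touch r bd₁ c.1.out := by
    rintro ⟨c, hc⟩ ⟨j, hj⟩
    exact hc j ((Quot.out_eq c).symm.trans ((hs _ _).2 hj))
  have hφ : Function.Bijective φ := by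
    constructor
    · rintro (c | c) (d | d) hcd
      · induction c using Quot.ind with
        | mk u =>
          induction d using Quot.ind with
          | mk v => exact congrArg Sum.inl ((glue_circ_inl hm u v).1 hcd)
      · induction c using Quot.ind with
        | mk u =>
          obtain ⟨w, hw, -⟩ := glue_circ_free hm (hfree d) _ hcd
          cases hw
      · induction d using Quot.ind with
        | mk u =>
          obtain ⟨w, hw, -⟩ := glue_circ_free hm (hfree c) _ hcd.symm
          cases hw
      · obtain ⟨w, hw, hw'⟩ := glue_circ_free hm (hfree d) _ hcd
        cases hw
        congr 1
        apply Subtype.ext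
        rw [← Quot.out_eq c.1, ← Quot.out_eq d.1]
        exact (hs _ _).2 hw'
    · intro c
      induction c using Quot.ind with
      | mk v =>
        rcases v with u | v
        · exact ⟨.inl (circ _ u), rfl⟩
        · by_cases ht : Touch r bd₁ v
          · obtain ⟨j, hj⟩ := ht
            exact ⟨.inl (circ _ (bd₂ j)), (glue_circ_touch hj).symm⟩
          · refine ⟨.inr ⟨circ _ v, fun j hj => ht ⟨j, (hs _ _).1 hj⟩⟩, ?_⟩
            exact glue_circ_inr ((hs _ _).1 (Quot.out_eq (circ _ v)))
  have := Fintype.ofFinite (Quot (glueRel s bd₂ r bd₁))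
  have := Fintype.ofFinite (Quot (closeUp s bd₂ b))
  have := Fintype.ofFinite {c : Quot (closeUp r bd₁ b) // ∀ j, c ≠ circ _ (bd₁ j)}
  rw [labDeg, labDeg, freeDeg, finsum_eq_sum_of_fintype, finsum_eq_sum_of_fintype,
    finsum_eq_sum_of_fintype, ← Fintype.sum_bijective φ hφ _ _ fun _ => rfl, Fintype.sum_sum_type]
  congr 1
  · refine Finset.sum_congr rfl fun c _ => ?_
    induction c using Quot.ind with
    | mk u => rw [show φ (.inl (Quot.mk _ u)) = circ _ (.inl u) from rfl, h.left]
  · refine Finset.sum_congr rfl fun c _ => ?_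
    rw [show φ (.inr c) = circ _ (.inr c.1.out) from rfl, h.free _ (hfree c),
      show circ (closeUp r bd₁ b) c.1.out = c.1 from Quot.out_eq c.1]

end Counting

/-! ### Generators of the concatenation as pairs of generators -/

section GlueDiagrams

theorem card_lex {α β : Type} [Finite α] [Finite β] (P : Lex (α ⊕ β) → Prop) :
    Nat.card {x // P x} = Nat.card {x // P (toLex (.inl x))} + Nat.card {x // P (toLex (.inr x))} := by
  rw [← Nat.card_sum]
  exact Nat.card_congr (Equiv.subtypeSum (p := fun x : α ⊕ β => P (toLex x)))

theorem card_lex_eq {α β : Type} [Finite α] [Finite β] {P : Lex (α ⊕ β) → Prop} {Q₁ : α → Prop}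
    {Q₂ : β → Prop} (h₁ : ∀ x, P (toLex (.inl x)) ↔ Q₁ x) (h₂ : ∀ x, P (toLex (.inr x)) ↔ Q₂ x) :
    Nat.card {x // P x} = Nat.card {x // Q₁ x} + Nat.card {x // Q₂ x} := by
  rw [card_lex]
  simp only [h₁, h₂]

variable {n : ℕ} {D₂ D₁ : Diagram (2 * n)}
  {hc : ∀ j, D₂.ori.dir (D₂.code.bd j) = D₁.ori.dir (D₁.code.bd j)}

/-- A resolution of the concatenation, given by resolutions of the two parts. -/
def comb (hc : ∀ j, D₂.ori.dir (D₂.code.bd j) = D₁.ori.dir (D₁.code.bd j)) (ρ₁ : D₁.Res)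
    (ρ₂ : D₂.Res) : (D₂.glue D₁ hc).Res :=
  fun x => Sum.elim ρ₁ ρ₂ (ofLex x)

theorem comb_inj {ρ₁ ρ₁' : D₁.Res} {ρ₂ ρ₂' : D₂.Res} (h : comb hc ρ₁ ρ₂ = comb hc ρ₁' ρ₂') :
    ρ₁ = ρ₁' ∧ ρ₂ = ρ₂' :=
  ⟨funext fun x => congrFun h (toLex (.inl x)), funext fun x => congrFun h (toLex (.inr x))⟩

theorem exists_comb (ρ : (D₂.glue D₁ hc).Res) : ∃ ρ₁ ρ₂, ρ = comb hc ρ₁ ρ₂ := by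
  refine ⟨fun x => ρ (toLex (.inl x)), fun x => ρ (toLex (.inr x)), funext ?_⟩
  rintro (x | x) <;> rfl

theorem glue_resRel (ρ₁ : D₁.Res) (ρ₂ : D₂.Res) : (D₂.glue D₁ hc).resRel (comb hc ρ₁ ρ₂) =
    glueRel (D₂.resRel ρ₂) D₂.code.bd (D₁.resRel ρ₁) D₁.code.bd := by
  funext u v
  refine propext ⟨?_, ?_⟩
  · rintro ((⟨u, v, rfl, rfl, k⟩ | ⟨u, v, rfl, rfl, k⟩) | (⟨u, v, rfl, rfl, k⟩ | ⟨u, v, rfl, rfl, k⟩ |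
      ⟨j, rfl, rfl⟩) | ⟨x | x, h1, ⟨rfl, rfl⟩ | ⟨rfl, rfl⟩⟩ | ⟨x | x, h1, ⟨rfl, rfl⟩ | ⟨rfl, rfl⟩⟩)
    · exact Or.inl k
    · exact Or.inl k
    · exact Or.inr (Or.inl k)
    · exact Or.inr (Or.inl k)
    · exact ⟨j, rfl, rfl⟩
    · exact Or.inr (Or.inr (Or.inl ⟨x, h1, Or.inl ⟨rfl, rfl⟩⟩))
    · exact Or.inr (Or.inr (Or.inl ⟨x, h1, Or.inr ⟨rfl, rfl⟩⟩))
    · exact Or.inr (Or.inr (Or.inl ⟨x, h1, Or.inl ⟨rfl, rfl⟩⟩))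
    · exact Or.inr (Or.inr (Or.inl ⟨x, h1, Or.inr ⟨rfl, rfl⟩⟩))
    · exact Or.inr (Or.inr (Or.inr ⟨x, h1, Or.inl ⟨rfl, rfl⟩⟩))
    · exact Or.inr (Or.inr (Or.inr ⟨x, h1, Or.inr ⟨rfl, rfl⟩⟩))
    · exact Or.inr (Or.inr (Or.inr ⟨x, h1, Or.inl ⟨rfl, rfl⟩⟩))
    · exact Or.inr (Or.inr (Or.inr ⟨x, h1, Or.inr ⟨rfl, rfl⟩⟩))
  · intro h
    rcases u with u | u <;> rcases v with v | v
    · rcases h with k | k | ⟨x, h1, ⟨rfl, rfl⟩ | ⟨rfl, rfl⟩⟩ | ⟨x, h1, ⟨rfl, rfl⟩ | ⟨rfl, rfl⟩⟩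
      · exact Or.inl (Or.inl ⟨u, v, rfl, rfl, k⟩)
      · exact Or.inr (Or.inl (Or.inl ⟨u, v, rfl, rfl, k⟩))
      · exact Or.inr (Or.inr (Or.inl ⟨toLex (.inr x), h1, Or.inl ⟨rfl, rfl⟩⟩))
      · exact Or.inr (Or.inr (Or.inl ⟨toLex (.inr x), h1, Or.inr ⟨rfl, rfl⟩⟩))
      · exact Or.inr (Or.inr (Or.inr ⟨toLex (.inr x), h1, Or.inl ⟨rfl, rfl⟩⟩))
      · exact Or.inr (Or.inr (Or.inr ⟨toLex (.inr x), h1, Or.inr ⟨rfl, rfl⟩⟩))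
    · obtain ⟨j, rfl, rfl⟩ := h
      exact Or.inr (Or.inl (Or.inr (Or.inr ⟨j, rfl, rfl⟩)))
    · exact h.elim
    · rcases h with k | k | ⟨x, h1, ⟨rfl, rfl⟩ | ⟨rfl, rfl⟩⟩ | ⟨x, h1, ⟨rfl, rfl⟩ | ⟨rfl, rfl⟩⟩
      · exact Or.inl (Or.inr ⟨u, v, rfl, rfl, k⟩)
      · exact Or.inr (Or.inl (Or.inr (Or.inl ⟨u, v, rfl, rfl, k⟩)))
      · exact Or.inr (Or.inr (Or.inl ⟨toLex (.inl x), h1, Or.inl ⟨rfl, rfl⟩⟩))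
      · exact Or.inr (Or.inr (Or.inl ⟨toLex (.inl x), h1, Or.inr ⟨rfl, rfl⟩⟩))
      · exact Or.inr (Or.inr (Or.inr ⟨toLex (.inl x), h1, Or.inl ⟨rfl, rfl⟩⟩))
      · exact Or.inr (Or.inr (Or.inr ⟨toLex (.inl x), h1, Or.inr ⟨rfl, rfl⟩⟩))

theorem weight_comb (ρ₁ : D₁.Res) (ρ₂ : D₂.Res) :
    (D₂.glue D₁ hc).weight (comb hc ρ₁ ρ₂) = D₁.weight ρ₁ + D₂.weight ρ₂ :=
  card_lex (α := D₁.code.X) (β := D₂.code.X) _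

theorem nPos_glue : (D₂.glue D₁ hc).nPos = D₁.nPos + D₂.nPos :=
  card_lex (α := D₁.code.X) (β := D₂.code.X) _

theorem nNeg_glue : (D₂.glue D₁ hc).nNeg = D₁.nNeg + D₂.nNeg :=
  card_lex (α := D₁.code.X) (β := D₂.code.X) _

theorem before_inl (ρ₁ : D₁.Res) (ρ₂ : D₂.Res) (c : D₁.code.X) :
    (D₂.glue D₁ hc).before (comb hc ρ₁ ρ₂) (toLex (.inl c)) = D₁.before ρ₁ c := by
  let := D₁.ord
  let := D₂.ord
  refine (card_lex_eq (α := D₁.code.X) (β := D₂.code.X) (Q₁ := fun y => y < c ∧ ρ₁ y = true)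
    (Q₂ := fun _ => False) (fun y => and_congr Sum.Lex.inl_lt_inl_iff Iff.rfl)
    fun y => iff_false_intro fun h => Sum.Lex.not_inr_lt_inl h.1).trans ?_
  simp [Diagram.before]

/-- All crossings of `D₁` precede those of `D₂`; the term `D₁.weight ρ₁` is the part of the sign
that is compared with `|id|`. -/
theorem before_inr (ρ₁ : D₁.Res) (ρ₂ : D₂.Res) (c : D₂.code.X) :
    (D₂.glue D₁ hc).before (comb hc ρ₁ ρ₂) (toLex (.inr c)) = D₁.weight ρ₁ + D₂.before ρ₂ c := by
  let := D₁.ord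
  let := D₂.ord
  exact card_lex_eq (α := D₁.code.X) (β := D₂.code.X) (Q₁ := fun y => ρ₁ y = true)
    (Q₂ := fun y => y < c ∧ ρ₂ y = true)
    (fun y => and_iff_right (Sum.Lex.inl_lt_inr y c))
    fun y => and_congr Sum.Lex.inr_lt_inr_iff Iff.rfl

open Classical in
theorem update_comb_inl (ρ₁ : D₁.Res) (ρ₂ : D₂.Res) (c : D₁.code.X) (t : Bool) :
    (Function.update (comb hc ρ₁ ρ₂) (toLex (.inl c)) t : (D₂.glue D₁ hc).Res) =
      comb hc (Function.update ρ₁ c t) ρ₂ := by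
  funext x
  rcases x with x | x
  · by_cases h : x = c
    · subst h
      exact (Function.update_self (α := (D₂.glue D₁ hc).code.X) (β := fun _ => Bool)
        (toLex (.inl x)) t (comb hc ρ₁ ρ₂)).trans
        (Function.update_self (β := fun _ => Bool) x t ρ₁).symm
    · exact (Function.update_of_ne (α := (D₂.glue D₁ hc).code.X) (β := fun _ => Bool)
        (fun e => h (Sum.inl.inj e)) _ _).trans
        (Function.update_of_ne (β := fun _ => Bool) h t ρ₁).symm
  · exact Function.update_of_ne (α := (D₂.glue D₁ hc).code.X) (β := fun _ => Bool)
      (fun e => Sum.inr_ne_inl e) _ _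

open Classical in
theorem update_comb_inr (ρ₁ : D₁.Res) (ρ₂ : D₂.Res) (c : D₂.code.X) (t : Bool) :
    (Function.update (comb hc ρ₁ ρ₂) (toLex (.inr c)) t : (D₂.glue D₁ hc).Res) =
      comb hc ρ₁ (Function.update ρ₂ c t) := by
  funext x
  rcases x with x | x
  · exact Function.update_of_ne (α := (D₂.glue D₁ hc).code.X) (β := fun _ => Bool)
      (fun e => Sum.inl_ne_inr e) _ _
  · by_cases h : x = c
    · subst h
      exact (Function.update_self (α := (D₂.glue D₁ hc).code.X) (β := fun _ => Bool)
        (toLex (.inr x)) t (comb hc ρ₁ ρ₂)).trans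
        (Function.update_self (β := fun _ => Bool) x t ρ₂).symm
    · exact (Function.update_of_ne (α := (D₂.glue D₁ hc).code.X) (β := fun _ => Bool)
        (fun e => h (Sum.inr.inj e)) _ _).trans
        (Function.update_of_ne (β := fun _ => Bool) h t ρ₂).symm

open Classical in
theorem weight_update {m : ℕ} (D : Diagram m) {ρ : D.Res} {c : D.code.X} (h : ρ c = false) :
    D.weight (Function.update ρ c true) = D.weight ρ + 1 := by
  have : {y | Function.update ρ c true y = true} = insert c {y | ρ y = true} := by
    ext y
    by_cases hy : y = c
    · simp [hy]
    · simp [hy, Function.update_of_ne]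
  have h2 := Set.ncard_insert_of_notMem (a := c) (s := {y | ρ y = true}) (by simp [h])
  rw [← this] at h2
  exact h2

/-- A generator of the pairing: generators of the Type A and Type D structures with the same
idempotent. -/
abbrev PairGen (D₂ D₁ : Diagram (2 * n)) : Type := Σ b : Matching n, TGen D₂ b × DGen D₁ b

/-- The generator of the complex of the concatenation given by a generator of the pairing. -/
def glueGen (hc : ∀ j, D₂.ori.dir (D₂.code.bd j) = D₁.ori.dir (D₁.code.bd j))
    (z : PairGen D₂ D₁) : (D₂.glue D₁ hc).CubeGen (D₂.glue D₁ hc).resRel :=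
  ⟨comb hc z.2.2.1.1 z.2.1.1, labOf _ (glueFun D₂.code.bd (D₁.resRel z.2.2.1.1) D₁.code.bd
    (fun u => z.2.1.2 (circ _ u)) fun v => z.2.2.1.2 (circ _ v))⟩

/-- A generator only requires that partners under `b` are connected; this forces `b` to be the
matching realized by the resolution. -/
theorem DGen.isMatch (hM : ∀ ρ, ∃ b, IsMatch (D₁.resRel ρ) D₁.code.bd b) {b : Matching n}
    (x : DGen D₁ b) : IsMatch (D₁.resRel x.1.1) D₁.code.bd b := by
  obtain ⟨b', hb'⟩ := hM x.1.1
  have : b = b' := Matching.eq_of_partner fun j =>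
    ((hb' j _).1 (x.2.1 j)).resolve_left (b.ne_self j)
  subst this
  exact hb'

/-- The labelling `Λ` of a 1-manifold `R` that is the concatenation of two parts restricts to
given labellings of the parts. -/
structure IsGlue' {V₁ V₂ : Type} (R : V₂ ⊕ V₁ → V₂ ⊕ V₁ → Prop) (s : V₂ → V₂ → Prop)
    (bd₂ : Fin (2 * n) → V₂) (r : V₁ → V₁ → Prop) (bd₁ : Fin (2 * n) → V₁) (b : Matching n)
    (Λ : Lab R) (σ : Lab (closeUp s bd₂ b)) (x : Lab (closeUp r bd₁ b)) : Prop where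
  rel : R = glueRel s bd₂ r bd₁
  left : ∀ u, Λ (circ _ (.inl u)) = σ (circ _ u)
  free : ∀ v, ¬Touch r bd₁ v → Λ (circ _ (.inr v)) = x (circ _ v)

theorem IsGlue'.labDeg_eq {V₁ V₂ : Type} [Finite V₁] [Finite V₂] {R : V₂ ⊕ V₁ → V₂ ⊕ V₁ → Prop}
    {s : V₂ → V₂ → Prop}
    {bd₂ : Fin (2 * n) → V₂} {r : V₁ → V₁ → Prop} {bd₁ : Fin (2 * n) → V₁} {b : Matching n}
    {Λ : Lab R} {σ : Lab (closeUp s bd₂ b)} {x : Lab (closeUp r bd₁ b)} (hm : IsMatch r bd₁ b)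
    (h : IsGlue' R s bd₂ r bd₁ b Λ σ x) : labDeg Λ = labDeg σ + freeDeg r bd₁ x := by
  obtain ⟨rfl, hl, hf⟩ := h
  exact labDeg_glue hm ⟨hl, hf⟩

theorem isGlue'_labOf {V₁ V₂ : Type} {R : V₂ ⊕ V₁ → V₂ ⊕ V₁ → Prop} {s : V₂ → V₂ → Prop}
    {bd₂ : Fin (2 * n) → V₂} {r : V₁ → V₁ → Prop} {bd₁ : Fin (2 * n) → V₁} {b : Matching n}
    (hm : IsMatch r bd₁ b) (h : R = glueRel s bd₂ r bd₁)
    (σ : Lab (closeUp s bd₂ b)) (x : Lab (closeUp r bd₁ b)) :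
    IsGlue' R s bd₂ r bd₁ b
      (labOf R (glueFun bd₂ r bd₁ (fun u => σ (circ _ u)) fun v => x (circ _ v))) σ x := by
  subst h
  have := glueFun_eq (s := s) (bd₂ := bd₂) hm (f := fun u => σ (circ _ u))
    (x := fun v => x (circ _ v)) (fun u v k => congrArg σ (circ_of k))
    (fun u v k => congrArg x (closeUp_circ_of k))
  exact ⟨rfl, fun u => labOf_circ this _, fun v hv => (labOf_circ this _).trans (glueFun_free hv)⟩

/-- The resolved concatenation is equal to a `glueRel` only by `glue_resRel`, so the labelling is
kept on a separate relation together with that equality. -/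
theorem glueGen_isGlue' (hM : ∀ ρ, ∃ b, IsMatch (D₁.resRel ρ) D₁.code.bd b) (z : PairGen D₂ D₁) :
    IsGlue' ((D₂.glue D₁ hc).resRel (glueGen hc z).1) (D₂.resRel z.2.1.1) D₂.code.bd
      (D₁.resRel z.2.2.1.1) D₁.code.bd z.1 (glueGen hc z).2 z.2.1.2 z.2.2.1.2 :=
  isGlue'_labOf (DGen.isMatch hM z.2.2) (glue_resRel _ _) _ _

theorem IsGlue'.unique_right {V₁ V₂ : Type} {R : V₂ ⊕ V₁ → V₂ ⊕ V₁ → Prop} {s : V₂ → V₂ → Prop}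
    {bd₂ : Fin (2 * n) → V₂} {r : V₁ → V₁ → Prop} {bd₁ : Fin (2 * n) → V₁} {b : Matching n}
    {Λ : Lab R} {σ σ' : Lab (closeUp s bd₂ b)} {x x' : Lab (closeUp r bd₁ b)}
    (hx : ∀ j, x (circ _ (bd₁ j)) = 0) (hx' : ∀ j, x' (circ _ (bd₁ j)) = 0)
    (h : IsGlue' R s bd₂ r bd₁ b Λ σ x) (h' : IsGlue' R s bd₂ r bd₁ b Λ σ' x') :
    σ = σ' ∧ x = x' := by
  obtain ⟨rfl, hl, hf⟩ := h
  obtain ⟨-, hl', hf'⟩ := h'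
  refine ⟨lab_ext fun u => (hl u).symm.trans (hl' u), lab_ext fun v => ?_⟩
  by_cases ht : Touch r bd₁ v
  · obtain ⟨j, hj⟩ := ht
    rw [closeUp_circ_of hj, hx, hx']
  · exact (hf v ht).symm.trans (hf' v ht)

theorem IsGlue'.unique_left {V₁ V₂ : Type} {R : V₂ ⊕ V₁ → V₂ ⊕ V₁ → Prop} {s : V₂ → V₂ → Prop}
    {bd₂ : Fin (2 * n) → V₂} {r : V₁ → V₁ → Prop} {bd₁ : Fin (2 * n) → V₁} {b : Matching n}
    {Λ Λ' : Lab R} {σ : Lab (closeUp s bd₂ b)} {x : Lab (closeUp r bd₁ b)}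
    (h : IsGlue' R s bd₂ r bd₁ b Λ σ x) (h' : IsGlue' R s bd₂ r bd₁ b Λ' σ x) : Λ = Λ' := by
  obtain ⟨rfl, hl, hf⟩ := h
  obtain ⟨-, hl', hf'⟩ := h'
  refine lab_ext ?_
  rintro (u | v)
  · exact (hl u).trans (hl' u).symm
  by_cases ht : Touch r bd₁ v
  · obtain ⟨j, hj⟩ := ht
    rw [glue_circ_touch hj, hl, hl']
  · exact (hf v ht).trans (hf' v ht).symm

theorem exists_isGlue' {V₁ V₂ : Type} {R : V₂ ⊕ V₁ → V₂ ⊕ V₁ → Prop} {s : V₂ → V₂ → Prop}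
    {bd₂ : Fin (2 * n) → V₂} {r : V₁ → V₁ → Prop} {bd₁ : Fin (2 * n) → V₁} {b : Matching n}
    (hm : IsMatch r bd₁ b) (h : R = glueRel s bd₂ r bd₁) (Λ : Lab R) :
    ∃ (σ : Lab (closeUp s bd₂ b)) (x : Lab (closeUp r bd₁ b)),
      (∀ j, x (circ _ (bd₁ j)) = 0) ∧ IsGlue' R s bd₂ r bd₁ b Λ σ x := by
  classical
  subst h
  have hσ : ∀ u v, closeUp s bd₂ b u v → Λ (circ _ (.inl u)) = Λ (circ _ (.inl v)) :=
    fun u v k => congrArg Λ ((glue_circ_inl hm u v).2 (circ_of k))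
  have hx : ∀ u v, closeUp r bd₁ b u v → (if Touch r bd₁ u then 0 else Λ (circ _ (.inr u))) =
      if Touch r bd₁ v then 0 else Λ (circ _ (.inr v)) := by
    intro u v k
    have k' := (hm.closeUp_same _ _).1 (circ_of k)
    simp only [touch_congr k', glue_circ_inr k']
  -- Components on the right that touch the line are relabelled `1`, since their labels are already
  -- recorded by the left part.
  refine ⟨labOf _ fun u => Λ (circ _ (.inl u)),
    labOf _ fun u => if Touch r bd₁ u then 0 else Λ (circ _ (.inr u)), fun j => ?_, rfl, ?_, ?_⟩
  · rw [labOf_circ hx]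
    exact if_pos ⟨j, rfl⟩
  · exact fun u => (labOf_circ hσ u).symm
  · exact fun v hv => ((labOf_circ hx v).trans (if_neg hv)).symm

/-- The resolution of `T₁` determines the idempotent; the labels of a glued generator on the left
and on the free circles of the right part then determine both factors, and they can be prescribed
independently. -/
theorem glueGen_bijective (hM : ∀ ρ, ∃ b, IsMatch (D₁.resRel ρ) D₁.code.bd b) :
    Function.Bijective (glueGen (D₂ := D₂) (D₁ := D₁) hc) := by
  constructor
  · intro z z' h
    have hz := glueGen_isGlue' (hc := hc) hM z
    have hz' := glueGen_isGlue' (hc := hc) hM z'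
    rw [h] at hz
    have hm := DGen.isMatch hM z.2.2
    have hm' := DGen.isMatch hM z'.2.2
    obtain ⟨b, ⟨ρ₂, σ⟩, ⟨⟨ρ₁, x⟩, hx⟩⟩ := z
    obtain ⟨b', ⟨ρ₂', σ'⟩, ⟨⟨ρ₁', x'⟩, hx'⟩⟩ := z'
    obtain ⟨rfl, rfl⟩ := comb_inj (congrArg Sigma.fst h)
    obtain rfl := hm.unique hm' fun _ _ => id
    obtain ⟨rfl, rfl⟩ := hz.unique_right hx.2 hx'.2 hz'
    rfl
  · rintro ⟨ρ, Λ⟩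
    obtain ⟨ρ₁, ρ₂, rfl⟩ := exists_comb ρ
    obtain ⟨b, hb⟩ := hM ρ₁
    obtain ⟨σ, x, hx, h⟩ := exists_isGlue' hb (glue_resRel ρ₁ ρ₂) Λ
    refine ⟨⟨b, ⟨ρ₂, σ⟩, ⟨⟨ρ₁, x⟩, hb.arc, hx⟩⟩, ?_⟩
    exact Sigma.ext rfl (heq_of_eq ((glueGen_isGlue' hM _).unique_left h))

/-- The circles touching the line are counted on both sides; the `- n` removes the contribution of
their labels `1` in the Type D generator. -/
theorem qDeg_glueGen (hM : ∀ ρ, ∃ b, IsMatch (D₁.resRel ρ) D₁.code.bd b) (z : PairGen D₂ D₁) :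
    (D₂.glue D₁ hc).qDeg (glueGen hc z) = D₂.qDeg z.2.1 + D₁.qDeg z.2.2.1 - n := by
  have hm := DGen.isMatch hM z.2.2
  have h := glueGen_isGlue' (hc := hc) hM z
  have h1 := h.labDeg_eq hm
  have h2 : labDeg z.2.2.1.2 = _ := labDeg_eq_freeDeg hm z.2.2.2.2
  have h3 : (D₂.glue D₁ hc).weight (glueGen hc z).1 = _ := weight_comb z.2.2.1.1 z.2.1.1
  have aux : ∀ {A B C f m w w₁ w₂ p p₁ p₂ k k₁ k₂ : ℤ}, A = B + f → C = m + f → w = w₁ + w₂ →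
      p = p₁ + p₂ → k = k₁ + k₂ →
      A + w + p - 2 * k = (B + w₂ + p₂ - 2 * k₂) + (C + w₁ + p₁ - 2 * k₁) - m := by
    intros
    subst_vars
    ring
  exact aux h1 h2 (mod_cast h3) (mod_cast nPos_glue) (mod_cast nNeg_glue)

theorem hDeg_glueGen (z : PairGen D₂ D₁) :
    (D₂.glue D₁ hc).hDeg (glueGen hc z).1 = D₂.hDeg z.2.1.1 + D₁.hDeg z.2.2.1.1 := by
  rw [Diagram.hDeg, Diagram.hDeg, Diagram.hDeg, nNeg_glue,
    show (glueGen hc z).1 = comb hc z.2.2.1.1 z.2.1.1 from rfl, weight_comb]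
  push_cast
  ring

end GlueDiagrams

/-! ### The box differential on pure tensors -/

section BoxFormula

variable {ι : Type} {A N : ι → Type} {B : ι → ι → Type}
  [∀ i, AddCommGroup (A i)] [∀ i, AddCommGroup (N i)] [∀ i j, AddCommGroup (B i j)]

open Classical in
/-- The map `h ⊗ x ↦ (a h) ⊗ x`. -/
def boxRight (m₂ : ∀ i j, A i →ₗ[ℤ] B i j →ₗ[ℤ] A j) (i : ι) (a : A i) :
    (⨁ j, B i j ⊗[ℤ] N j) →ₗ[ℤ] ⨁ i, A i ⊗[ℤ] N i :=
  DirectSum.toModule ℤ ι (M := fun j => B i j ⊗[ℤ] N j) (⨁ i, A i ⊗[ℤ] N i) fun j =>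
    DirectSum.lof ℤ ι (fun i => A i ⊗[ℤ] N i) j ∘ₗ LinearMap.rTensor (N j) (m₂ i j a)

open Classical in
theorem boxRight_lof (m₂ : ∀ i j, A i →ₗ[ℤ] B i j →ₗ[ℤ] A j) (i j : ι) (a : A i) (h : B i j)
    (x : N j) : boxRight m₂ i a (DirectSum.lof ℤ ι (fun j => B i j ⊗[ℤ] N j) j (h ⊗ₜ x)) =
      DirectSum.lof ℤ ι (fun i => A i ⊗[ℤ] N i) j (m₂ i j a h ⊗ₜ x) := by
  exact DirectSum.toModule_lof ℤ j _

open Classical in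
theorem boxD_lof_tmul (m₁ : ∀ i, A i →ₗ[ℤ] A i) (m₂ : ∀ i j, A i →ₗ[ℤ] B i j →ₗ[ℤ] A j)
    (sgn : ∀ i, N i →ₗ[ℤ] N i) (δ : ∀ i, N i →ₗ[ℤ] ⨁ j, B i j ⊗[ℤ] N j) (i : ι) (a : A i)
    (x : N i) : boxD m₁ m₂ sgn δ (DirectSum.lof ℤ ι (fun i => A i ⊗[ℤ] N i) i (a ⊗ₜ x)) =
      DirectSum.lof ℤ ι (fun i => A i ⊗[ℤ] N i) i (m₁ i a ⊗ₜ sgn i x) +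
        boxRight m₂ i a (δ i x) := by
  refine (DirectSum.toModule_lof ℤ i _).trans ?_
  refine (LinearMap.add_apply _ _ _).trans (congrArg (_ + ·) ?_)
  change DirectSum.toModule ℤ ι _ _ (TensorProduct.directSumRight ℤ ℤ (A i) _ (a ⊗ₜ δ i x)) = _
  generalize δ i x = t
  induction t using DirectSum.induction_on with
  | zero => simp
  | add t t' h h' => rw [TensorProduct.tmul_add, map_add, map_add, map_add, h, h']
  | of j t =>
    change _ = boxRight m₂ i a (DirectSum.lof ℤ ι (fun j => B i j ⊗[ℤ] N j) j t)
    change DirectSum.toModule ℤ ι _ _ (TensorProduct.directSumRight ℤ ℤ (A i) _ (a ⊗ₜ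
      DirectSum.lof ℤ ι (fun j => B i j ⊗[ℤ] N j) j t)) = _
    rw [TensorProduct.directSumRight_tmul_lof, DirectSum.toModule_lof]
    induction t using TensorProduct.induction_on with
    | zero => simp
    | add t t' h h' => rw [TensorProduct.tmul_add, map_add, map_add, map_add, h, h']
    | tmul h x =>
      rw [boxRight_lof]
      rfl

end BoxFormula

instance {n : ℕ} : Finite (Matching n) :=
  Finite.of_injective Matching.partner fun _ _ h => Matching.eq_of_partner fun j => congrFun h j

/-! ### Coordinates on the pairing -/

section Pairing

variable {n : ℕ} {D₂ D₁ : Diagram (2 * n)}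

instance {b : Matching n} : Finite (DGen D₁ b) := inferInstanceAs (Finite {_x : TGen D₁ b // _})

open Classical in
/-- The pairing is free on pairs of generators with the same idempotent. -/
def pairEquiv (D₂ D₁ : Diagram (2 * n)) : Pairing D₂ D₁ ≃ₗ[ℤ] (PairGen D₂ D₁ →₀ ℤ) :=
  (DFinsupp.mapRange.linearEquiv fun b : Matching n =>
    finsuppTensorFinsupp' ℤ (TGen D₂ b) (DGen D₁ b)).trans (sigmaFinsuppLequivDFinsupp ℤ).symm

theorem pairEquiv_apply (t : Pairing D₂ D₁) (b : Matching n) (p : TGen D₂ b × DGen D₁ b) :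
    pairEquiv D₂ D₁ t ⟨b, p⟩ = finsuppTensorFinsupp' ℤ (TGen D₂ b) (DGen D₁ b) (t b) p := rfl

open Classical in
theorem pairEquiv_lof_same (b : Matching n) (a : TKh D₂ b) (x : DMod D₁ b) (y₂ : TGen D₂ b)
    (y₁ : DGen D₁ b) : pairEquiv D₂ D₁ (DirectSum.lof ℤ (Matching n)
      (fun b => TKh D₂ b ⊗[ℤ] DMod D₁ b) b (a ⊗ₜ x)) ⟨b, (y₂, y₁)⟩ = a y₂ * x y₁ := by
  rw [pairEquiv_apply, DirectSum.lof_apply, finsuppTensorFinsupp'_apply_apply]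

open Classical in
theorem pairEquiv_lof_ne {b c : Matching n} (h : c ≠ b) (t : TKh D₂ c ⊗[ℤ] DMod D₁ c)
    (p : TGen D₂ b × DGen D₁ b) : pairEquiv D₂ D₁ (DirectSum.lof ℤ (Matching n)
      (fun b => TKh D₂ b ⊗[ℤ] DMod D₁ b) c t) ⟨b, p⟩ = 0 := by
  rw [pairEquiv_apply, DirectSum.lof_eq_of, DirectSum.of_eq_of_ne _ _ _ h.symm, map_zero]
  rfl

open Classical in
theorem pairEquiv_single (b : Matching n) (y₂ : TGen D₂ b) (y₁ : DGen D₁ b) :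
    pairEquiv D₂ D₁ (DirectSum.lof ℤ (Matching n) (fun b => TKh D₂ b ⊗[ℤ] DMod D₁ b) b
      (Finsupp.single y₂ 1 ⊗ₜ Finsupp.single y₁ 1)) = Finsupp.single ⟨b, (y₂, y₁)⟩ 1 := by
  ext ⟨c, z₂, z₁⟩
  by_cases h : b = c
  · subst h
    rw [pairEquiv_lof_same, Finsupp.single_apply, Finsupp.single_apply, Finsupp.single_apply]
    by_cases h2 : y₂ = z₂ <;> by_cases h1 : y₁ = z₁ <;> simp [h1, h2]
  · rw [pairEquiv_lof_ne h, Finsupp.single_eq_of_ne]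
    exact fun e => h (congrArg Sigma.fst e).symm

theorem act_apply_same (b c : Matching n) (ρ : D₂.Res) (σ : Lab (clRel D₂ b ρ)) (t : H b c)
    (σ' : Lab (clRel D₂ c ρ)) : TKh.act D₂ b c (Finsupp.single ⟨ρ, σ⟩ 1) t ⟨ρ, σ'⟩ =
      actMap (D₂.resRel ρ) D₂.code.bd b c (Finsupp.single σ 1) t σ' := by
  rw [TKh.act, Finsupp.linearCombination_single, one_smul]
  exact Finsupp.mapDomain_apply sigma_mk_injective _ _

theorem act_apply_ne (b c : Matching n) {ρ ρ' : D₂.Res} (σ : Lab (clRel D₂ b ρ)) (t : H b c)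
    (σ' : Lab (clRel D₂ c ρ')) (h : ρ' ≠ ρ) :
    TKh.act D₂ b c (Finsupp.single ⟨ρ, σ⟩ 1) t ⟨ρ', σ'⟩ = 0 := by
  rw [TKh.act, Finsupp.linearCombination_single, one_smul]
  refine Finsupp.mapDomain_of_notMem_range _ _ ?_
  rintro ⟨σ'', e⟩
  exact h (congrArg Sigma.fst e).symm

open Classical in
-- A generator `y` factors as an algebra element times a Type D generator in only one way: the first
-- factor consists of its labels at the line, the second of its free labels. So at most one term of
-- `splitD` contributes to a given coordinate.
theorem pairEquiv_boxRight_splitD (hM : ∀ ρ, ∃ b, IsMatch (D₁.resRel ρ) D₁.code.bd b)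
    {b b' : Matching n} (a : TKh D₂ b) (y : TGen D₁ b) (x₂' : TGen D₂ b') (x₁' : DGen D₁ b') :
    pairEquiv D₂ D₁ (boxRight (TKh.act D₂) b a (splitD D₁ b (Finsupp.single y 1)))
      ⟨b', (x₂', x₁')⟩ =
    if x₁'.1.1 = y.1 ∧ ∀ v, ¬Touch (D₁.resRel y.1) D₁.code.bd v →
        y.2 (circ _ v) = x₁'.1.2 (circ _ v) then
      TKh.act D₂ b b' a (Finsupp.single (bdLab D₁.code.bd b b' y.2) 1) x₂' else 0 := by
  have hP : ∀ τ : Lab (arcRel b b'), IsProd D₁ y τ x₁' ↔ τ = bdLab D₁.code.bd b b' y.2 ∧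
      x₁'.1.1 = y.1 ∧ ∀ v, ¬Touch (D₁.resRel y.1) D₁.code.bd v →
        y.2 (circ _ v) = x₁'.1.2 (circ _ v) := by
    intro τ
    simp only [IsProd, Touch, not_exists]
    have hm := DGen.isMatch hM x₁'
    constructor
    · rintro ⟨h1, h2, h3⟩
      rw [h1] at hm
      exact ⟨lab_ext fun i => (h2 i).symm.trans (bdLab_circ hm y.2 i).symm, h1, h3⟩
    · rintro ⟨rfl, h1, h3⟩
      rw [h1] at hm
      exact ⟨h1, fun j => (bdLab_circ hm y.2 j).symm, h3⟩
  have := Fintype.ofFinite (Σ c : Matching n, Lab (arcRel b c) × DGen D₁ c)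
  rw [splitD, Finsupp.linearCombination_single, one_smul, finsum_eq_sum_of_fintype, map_sum,
    map_sum, Finsupp.finsetSum_apply,
    Finset.sum_eq_single ⟨b', (bdLab D₁.code.bd b b' y.2, x₁')⟩]
  · simp only [hP, true_and]
    split_ifs
    · rw [boxRight_lof, pairEquiv_lof_same, Finsupp.single_eq_same, mul_one]
    · simp
  · rintro ⟨c, τ, x⟩ - hne
    split_ifs with h
    · rw [boxRight_lof]
      by_cases hcb : c = b'
      · subst hcb
        rw [pairEquiv_lof_same]
        by_cases hx : x = x₁'
        · subst hx
          exact (hne (by rw [((hP τ).1 h).1])).elim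
        · rw [Finsupp.single_eq_of_ne (Ne.symm hx), mul_zero]
      · exact pairEquiv_lof_ne hcb _ _
    · simp
  · exact fun h => (h (Finset.mem_univ _)).elim

end Pairing

/-! ### The isomorphism, its signs and its gradings -/

section Isomorphism

variable {n : ℕ}

theorem IsGlue'.rightSum_eq {V₁ V₂ : Type} [Finite V₂] {R R' : V₂ ⊕ V₁ → V₂ ⊕ V₁ → Prop}
    {s : V₂ → V₂ → Prop} {bd₂ : Fin (2 * n) → V₂} {r r' : V₁ → V₁ → Prop}
    {bd₁ : Fin (2 * n) → V₁} {b b' : Matching n} {p q : V₁} {Λ : Lab R} {Λ' : Lab R'}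
    {σ : Lab (closeUp s bd₂ b)} {σ' : Lab (closeUp s bd₂ b')} {x : Lab (closeUp r bd₁ b)}
    {x' : Lab (closeUp r' bd₁ b')} (hm : IsMatch r bd₁ b) (hm' : IsMatch r' bd₁ b')
    (hs : IsSaddle r r' bd₁ p q) (hx : ∀ j, x (circ _ (bd₁ j)) = 0)
    (h : IsGlue' R s bd₂ r bd₁ b Λ σ x) (h' : IsGlue' R' s bd₂ r' bd₁ b' Λ' σ' x') :
    rightSum s bd₂ bd₁ p q σ σ' x x' = saddleCoeff R R' (.inr p) (.inr q) Λ Λ' := by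
  obtain ⟨rfl, hl, hf⟩ := h
  obtain ⟨rfl, hl', hf'⟩ := h'
  exact rightSum_eq_saddleCoeff hm hm' hs hx ⟨hl, hf⟩ ⟨hl', hf'⟩

open Classical in
theorem IsGlue'.saddleCoeff_left {V₁ V₂ : Type} {R R' : V₂ ⊕ V₁ → V₂ ⊕ V₁ → Prop}
    {s s' : V₂ → V₂ → Prop} {bd₂ : Fin (2 * n) → V₂} {r : V₁ → V₁ → Prop}
    {bd₁ : Fin (2 * n) → V₁} {b : Matching n} {p q : V₂} {Λ : Lab R} {Λ' : Lab R'}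
    {σ : Lab (closeUp s bd₂ b)} {σ' : Lab (closeUp s' bd₂ b)} {x x' : Lab (closeUp r bd₁ b)}
    (hm : IsMatch r bd₁ b) (hx : ∀ j, x (circ _ (bd₁ j)) = 0) (hx' : ∀ j, x' (circ _ (bd₁ j)) = 0)
    (h : IsGlue' R s bd₂ r bd₁ b Λ σ x) (h' : IsGlue' R' s' bd₂ r bd₁ b Λ' σ' x') :
    saddleCoeff R R' (.inl p) (.inl q) Λ Λ' = if x = x' then saddleCoeff _ _ p q σ σ' else 0 := by
  obtain ⟨rfl, hl, hf⟩ := h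
  obtain ⟨rfl, hl', hf'⟩ := h'
  rw [Khov.saddleCoeff_left hm ⟨hl, hf⟩ ⟨hl', hf'⟩]
  congr 1
  rw [eq_iff_iff]
  refine ⟨fun h => lab_ext fun v => ?_, fun h v _ => by rw [h]⟩
  by_cases ht : Touch r bd₁ v
  · obtain ⟨j, hj⟩ := ht
    rw [closeUp_circ_of hj, hx, hx']
  · exact h v ht

variable {D₂ D₁ : Diagram (2 * n)}
  {hc : ∀ j, D₂.ori.dir (D₂.code.bd j) = D₁.ori.dir (D₁.code.bd j)}

open Classical in
/-- The term of a crossing in the matrix coefficient of the differential. -/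
def cubeTerm {m : ℕ} (D : Diagram m) (R : D.Res → D.code.V → D.code.V → Prop) (x y : D.CubeGen R)
    (c : D.code.X) : ℤ :=
  if x.1 c = false ∧ y.1 = Function.update x.1 c true then
    (-1) ^ D.before x.1 c *
      saddleCoeff (R x.1) (R y.1) (D.code.nearLo c) (D.code.farHi c) x.2 y.2 else 0

theorem cubeCoeff_glue (x y : (D₂.glue D₁ hc).CubeGen (D₂.glue D₁ hc).resRel) :
    (D₂.glue D₁ hc).cubeCoeff (D₂.glue D₁ hc).resRel x y =
      ∑ᶠ c : D₂.code.X, cubeTerm (D₂.glue D₁ hc) _ x y (toLex (.inr c)) +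
      ∑ᶠ c : D₁.code.X, cubeTerm (D₂.glue D₁ hc) _ x y (toLex (.inl c)) := by
  have := Fintype.ofFinite D₁.code.X
  have := Fintype.ofFinite D₂.code.X
  change ∑ᶠ c : D₁.code.X ⊕ D₂.code.X, cubeTerm (D₂.glue D₁ hc) _ x y (toLex c) = _
  rw [finsum_eq_sum_of_fintype, finsum_eq_sum_of_fintype, finsum_eq_sum_of_fintype,
    Fintype.sum_sum_type, add_comm]

open Classical in
theorem cubeTerm_inl (z z' : PairGen D₂ D₁) (c : D₁.code.X) :
    cubeTerm (D₂.glue D₁ hc) _ (glueGen hc z) (glueGen hc z') (toLex (.inl c)) =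
      if z.2.2.1.1 c = false ∧ z'.2.2.1.1 = Function.update z.2.2.1.1 c true ∧
          z'.2.1.1 = z.2.1.1 then
        (-1) ^ D₁.before z.2.2.1.1 c * saddleCoeff (V := D₂.code.V ⊕ D₁.code.V) _ _
          (.inr (D₁.code.nearLo c)) (.inr (D₁.code.farHi c)) (glueGen hc z).2 (glueGen hc z').2
      else 0 := by
  have h1 : (glueGen hc z').1 = Function.update (glueGen hc z).1 (toLex (.inl c)) true ↔
      z'.2.2.1.1 = Function.update z.2.2.1.1 c true ∧ z'.2.1.1 = z.2.1.1 := by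
    rw [show Function.update (glueGen hc z).1 (toLex (.inl c)) true = _ from
      update_comb_inl z.2.2.1.1 z.2.1.1 c true]
    exact ⟨comb_inj, fun h => congrArg₂ (comb hc) h.1 h.2⟩
  have h2 : (D₂.glue D₁ hc).before (glueGen hc z).1 (toLex (.inl c)) = D₁.before z.2.2.1.1 c :=
    before_inl _ _ c
  exact if_congr (and_congr Iff.rfl h1) (congrArg (fun t : ℕ => (-1 : ℤ) ^ t * _) h2) rfl

open Classical in
theorem cubeTerm_inr (z z' : PairGen D₂ D₁) (c : D₂.code.X) :
    cubeTerm (D₂.glue D₁ hc) _ (glueGen hc z) (glueGen hc z') (toLex (.inr c)) =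
      if z.2.1.1 c = false ∧ z'.2.1.1 = Function.update z.2.1.1 c true ∧
          z'.2.2.1.1 = z.2.2.1.1 then
        (-1) ^ (D₁.weight z.2.2.1.1 + D₂.before z.2.1.1 c) *
          saddleCoeff (V := D₂.code.V ⊕ D₁.code.V) _ _
          (.inl (D₂.code.nearLo c)) (.inl (D₂.code.farHi c)) (glueGen hc z).2 (glueGen hc z').2
      else 0 := by
  have h1 : (glueGen hc z').1 = Function.update (glueGen hc z).1 (toLex (.inr c)) true ↔
      z'.2.1.1 = Function.update z.2.1.1 c true ∧ z'.2.2.1.1 = z.2.2.1.1 := by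
    rw [show Function.update (glueGen hc z).1 (toLex (.inr c)) true = _ from
      update_comb_inr z.2.2.1.1 z.2.1.1 c true]
    exact ⟨fun h => (comb_inj h).symm, fun h => congrArg₂ (comb hc) h.2 h.1⟩
  have h2 : (D₂.glue D₁ hc).before (glueGen hc z).1 (toLex (.inr c)) =
      D₁.weight z.2.2.1.1 + D₂.before z.2.1.1 c := before_inr _ _ c
  exact if_congr (and_congr Iff.rfl h1) (congrArg (fun t : ℕ => (-1 : ℤ) ^ t * _) h2) rfl

open Classical in
-- For each crossing of `D₁`, summing over the intermediate labellings `y` gives `rightSum`, which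
-- `rightSum_eq_saddleCoeff` identifies with the saddle in the concatenation. The signs agree
-- because no crossing of `D₂` comes earlier.
theorem right_coeff (hM : ∀ ρ, ∃ b, IsMatch (D₁.resRel ρ) D₁.code.bd b)
    (hS : ∀ (ρ : D₁.Res) c, ρ c = false → IsSaddle (D₁.resRel ρ)
      (D₁.resRel (Function.update ρ c true)) D₁.code.bd (D₁.code.nearLo c) (D₁.code.farHi c))
    (z z' : PairGen D₂ D₁) :
    ∑ᶠ y : TGen D₁ z.1, D₁.cubeCoeff (clRel D₁ z.1) z.2.2.1 y *
      (if z'.2.2.1.1 = y.1 ∧ ∀ v, ¬Touch (D₁.resRel y.1) D₁.code.bd v →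
        y.2 (circ _ v) = z'.2.2.1.2 (circ _ v) then
      TKh.act D₂ z.1 z'.1 (Finsupp.single z.2.1 1)
        (Finsupp.single (bdLab D₁.code.bd z.1 z'.1 y.2) 1) z'.2.1 else 0) =
    ∑ᶠ c : D₁.code.X, cubeTerm (D₂.glue D₁ hc) _ (glueGen hc z) (glueGen hc z') (toLex (.inl c)) := by
  simp only [cubeTerm_inl]
  have hz := glueGen_isGlue' (hc := hc) hM z
  have hz' := glueGen_isGlue' (hc := hc) hM z'
  have hm := DGen.isMatch hM z.2.2
  have hm' := DGen.isMatch hM z'.2.2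
  have hx := z.2.2.2.2
  generalize glueGen hc z = y at hz ⊢
  generalize glueGen hc z' = y' at hz' ⊢
  obtain ⟨b, ⟨ρ₂, σ⟩, ⟨⟨ρ₁, x⟩, hx⟩⟩ := z
  obtain ⟨b', ⟨ρ₂', σ'⟩, ⟨⟨ρ₁', x'⟩, hx'⟩⟩ := z'
  dsimp only at hz hz' hm hm' hx ⊢
  by_cases hρ : ρ₂' = ρ₂
  swap
  · simp only [hρ, and_false, if_false, finsum_zero]
    refine finsum_eq_zero_of_forall_eq_zero fun y => ?_
    rw [act_apply_ne _ _ _ _ _ hρ, ite_self, mul_zero]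
  subst hρ
  simp only [act_apply_same, and_true]
  have := Fintype.ofFinite D₁.code.X
  have := Fintype.ofFinite D₁.Res
  have inst : ∀ ρ, Fintype (Lab (closeUp (D₁.resRel ρ) D₁.code.bd b)) :=
    fun ρ => Fintype.ofFinite _
  let : ∀ ρ, Fintype (Lab (clRel D₁ b ρ)) := inst
  -- Only labellings of the target resolution `ρ₁'` can factor through the prescribed Type D
  -- generator.
  rw [finsum_eq_sum_of_fintype, finsum_eq_sum_of_fintype, Fintype.sum_sigma,
    Finset.sum_eq_single ρ₁']
  rotate_left
  · intro ρ _ hne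
    refine Finset.sum_eq_zero fun y _ => ?_
    rw [if_neg fun h => hne h.1.symm, mul_zero]
  · exact fun h => (h (Finset.mem_univ _)).elim
  simp only [true_and, Diagram.cubeCoeff, finsum_eq_sum_of_fintype, Finset.sum_mul]
  rw [Finset.sum_comm]
  refine Finset.sum_congr rfl fun c _ => ?_
  split_ifs with h
  · obtain ⟨h1, rfl⟩ := h
    have key := hz.rightSum_eq hm hm' (hS ρ₁ c h1) hx hz'
    unfold rightSum at key
    rw [← key, finsum_eq_sum_of_fintype, Finset.mul_sum]
    exact Finset.sum_congr rfl fun y _ => mul_assoc _ _ _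
  · simp

open Classical in
-- The sign of `|id|` is off from the cube sign `(-1) ^ D₁.weight` by `(-1) ^ D₁.nNeg`. Each
-- application of the differential at a crossing of `D₂` raises `D₂.weight` by one, so the rescaling
-- by `(-1) ^ (D₁.nNeg * D₂.weight)` supplies exactly this factor.
theorem left_coeff (hM : ∀ ρ, ∃ b, IsMatch (D₁.resRel ρ) D₁.code.bd b) (b : Matching n)
    (y₂ y₂' : TGen D₂ b) (y₁ y₁' : DGen D₁ b) :
    (-1) ^ (D₁.nNeg * D₂.weight y₂.1) * (D₂.cubeCoeff (clRel D₂ b) y₂ y₂' *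
      Finsupp.single y₁ (((D₁.hDeg y₁.1.1).negOnePow : ℤˣ) : ℤ) y₁') =
    (∑ᶠ c : D₂.code.X, cubeTerm (D₂.glue D₁ hc) _ (glueGen hc ⟨b, y₂, y₁⟩) (glueGen hc ⟨b, y₂', y₁'⟩)
      (toLex (.inr c))) * (-1) ^ (D₁.nNeg * D₂.weight y₂'.1) := by
  simp only [cubeTerm_inr]
  have hz := glueGen_isGlue' (hc := hc) hM ⟨b, y₂, y₁⟩
  have hz' := glueGen_isGlue' (hc := hc) hM ⟨b, y₂', y₁'⟩
  have hm := DGen.isMatch hM y₁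
  generalize glueGen hc ⟨b, y₂, y₁⟩ = y at hz ⊢
  generalize glueGen hc ⟨b, y₂', y₁'⟩ = y' at hz' ⊢
  obtain ⟨ρ₂, σ⟩ := y₂
  obtain ⟨ρ₂', σ'⟩ := y₂'
  have := Fintype.ofFinite D₂.code.X
  rw [Diagram.cubeCoeff, finsum_eq_sum_of_fintype, finsum_eq_sum_of_fintype, Finset.sum_mul,
    Finset.sum_mul, Finset.mul_sum]
  refine Finset.sum_congr rfl fun c _ => ?_
  by_cases hy : y₁ = y₁'
  · subst hy
    rw [Finsupp.single_eq_same]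
    simp only [and_true]
    split_ifs with h
    · obtain ⟨h1, rfl⟩ := h
      have key := (hz.saddleCoeff_left (p := D₂.code.nearLo c) (q := D₂.code.farHi c) hm y₁.2.2
        y₁.2.2 hz').trans (if_pos rfl)
      rw [key, weight_update D₂ h1, Diagram.hDeg, Int.negOnePow_sub, Units.val_mul,
        Int.coe_negOnePow_natCast, Int.coe_negOnePow_natCast, mul_add, pow_add, pow_add]
      simp only [clRel]
      ring
    · simp
  · rw [Finsupp.single_eq_of_ne (Ne.symm hy), mul_zero, mul_zero]
    obtain ⟨⟨ρ₁, x⟩, hx⟩ := y₁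
    obtain ⟨⟨ρ₁', x'⟩, hx'⟩ := y₁'
    dsimp only at hz hz' hm ⊢
    split_ifs with h
    · obtain ⟨-, -, rfl⟩ := h
      have key := hz.saddleCoeff_left (p := D₂.code.nearLo c) (q := D₂.code.farHi c) hm hx.2
        hx'.2 hz'
      rw [if_neg] at key
      · rw [key, mul_zero, zero_mul]
      · rintro h
        exact hy (Subtype.ext (Sigma.ext rfl (heq_of_eq h)))
    · rw [zero_mul]

open Classical in
/-- The basis of the pairing given by the generators, with signs. -/
def pairBasis (D₂ D₁ : Diagram (2 * n)) : Module.Basis (PairGen D₂ D₁) ℤ (Pairing D₂ D₁) :=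
  (Finsupp.basisSingleOne.unitsSMul fun z : PairGen D₂ D₁ =>
    (-1) ^ (D₁.nNeg * D₂.weight z.2.1.1)).map (pairEquiv D₂ D₁).symm

open Classical in
theorem pairBasis_apply (z : PairGen D₂ D₁) : pairBasis D₂ D₁ z =
    ((-1) ^ (D₁.nNeg * D₂.weight z.2.1.1) : ℤ) • DirectSum.lof ℤ (Matching n)
      (fun b => TKh D₂ b ⊗[ℤ] DMod D₁ b) z.1
        (Finsupp.single z.2.1 1 ⊗ₜ Finsupp.single z.2.2 1) := by
  rw [pairBasis, Module.Basis.map_apply, LinearEquiv.symm_apply_eq, map_smul, pairEquiv_single,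
    Module.Basis.unitsSMul_apply, Finsupp.coe_basisSingleOne, Units.smul_def]
  simp

/-- The isomorphism between the complex of the concatenation and the pairing. -/
def glueIso (hM : ∀ ρ, ∃ b, IsMatch (D₁.resRel ρ) D₁.code.bd b) :
    CKh (D₂.glue D₁ hc) ≃ₗ[ℤ] Pairing D₂ D₁ :=
  Finsupp.basisSingleOne.equiv (pairBasis D₂ D₁) (Equiv.ofBijective _ (glueGen_bijective hM)).symm

theorem glueIso_single (hM : ∀ ρ, ∃ b, IsMatch (D₁.resRel ρ) D₁.code.bd b) (z : PairGen D₂ D₁) :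
    glueIso hM (Finsupp.single (glueGen hc z) 1) = pairBasis D₂ D₁ z := by
  have h := Module.Basis.equiv_apply (R := ℤ) Finsupp.basisSingleOne (glueGen hc z) (pairBasis D₂ D₁)
    (Equiv.ofBijective _ (glueGen_bijective hM)).symm
  rw [Finsupp.coe_basisSingleOne] at h
  refine h.trans (congrArg _ ?_)
  exact (Equiv.symm_apply_eq _).2 rfl

theorem pairEquiv_glueIso (hM : ∀ ρ, ∃ b, IsMatch (D₁.resRel ρ) D₁.code.bd b)
    (v : CKh (D₂.glue D₁ hc)) (z : PairGen D₂ D₁) : pairEquiv D₂ D₁ (glueIso hM v) z =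
      v (glueGen hc z) * (-1) ^ (D₁.nNeg * D₂.weight z.2.1.1) := by
  classical
  induction v using Finsupp.induction_linear with
  | zero => simp
  | add v w hv hw => rw [map_add, map_add, Finsupp.add_apply, hv, hw, Finsupp.add_apply, add_mul]
  | single y a =>
    obtain ⟨z', rfl⟩ := (glueGen_bijective hM).2 y
    rw [← Finsupp.smul_single_one, map_smul, glueIso_single,
      pairBasis_apply, map_smul, map_smul, pairEquiv_single]
    by_cases h : z = z'
    · subst h
      simp
    · rw [Finsupp.smul_apply, Finsupp.smul_apply, Finsupp.smul_apply, Finsupp.single_eq_of_ne h,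
        Finsupp.single_eq_of_ne fun e => h ((glueGen_bijective hM).1 e)]
      simp

theorem cubeD_single {m : ℕ} (D : Diagram m) (R : D.Res → D.code.V → D.code.V → Prop)
    (x y : D.CubeGen R) : D.cubeD R (Finsupp.single x 1) y = D.cubeCoeff R x y :=
  matMap_single _ x y

open Classical in
theorem pairing_d_apply (hM : ∀ ρ, ∃ b, IsMatch (D₁.resRel ρ) D₁.code.bd b)
    (hS : ∀ (ρ : D₁.Res) c, ρ c = false → IsSaddle (D₁.resRel ρ)
      (D₁.resRel (Function.update ρ c true)) D₁.code.bd (D₁.code.nearLo c) (D₁.code.farHi c))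
    (z z' : PairGen D₂ D₁) :
    pairEquiv D₂ D₁ (Pairing.d D₂ D₁ (pairBasis D₂ D₁ z)) z' =
      (D₂.glue D₁ hc).cubeCoeff (D₂.glue D₁ hc).resRel (glueGen hc z) (glueGen hc z') *
        (-1) ^ (D₁.nNeg * D₂.weight z'.2.1.1) := by
  have hδ : pairEquiv D₂ D₁ (boxRight (TKh.act D₂) z.1 (Finsupp.single z.2.1 1)
      (deltaD D₁ z.1 (Finsupp.single z.2.2 1))) z' =
      ∑ᶠ c : D₁.code.X,
        cubeTerm (D₂.glue D₁ hc) _ (glueGen hc z) (glueGen hc z') (toLex (.inl c)) := by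
    rw [← right_coeff hM hS]
    have := Fintype.ofFinite (TGen D₁ z.1)
    have h : deltaD D₁ z.1 (Finsupp.single z.2.2 1) = ∑ y, D₁.cubeCoeff (clRel D₁ z.1) z.2.2.1 y •
        splitD D₁ z.1 (Finsupp.single y 1) := by
      have h1 : inclD D₁ z.1 (Finsupp.single z.2.2 1) = Finsupp.single z.2.2.1 1 :=
        Finsupp.mapDomain_single
      rw [deltaD, LinearMap.comp_apply, LinearMap.comp_apply, h1, TKh.d, Diagram.cubeD,
        matMap_single_sum, map_sum]
      simp only [map_smul]
    rw [h, map_sum, map_sum, Finsupp.finsetSum_apply, finsum_eq_sum_of_fintype]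
    refine Finset.sum_congr rfl fun y _ => ?_
    rw [map_smul, map_smul, Finsupp.smul_apply, smul_eq_mul]
    exact congrArg _ (pairEquiv_boxRight_splitD hM _ y z'.2.1 z'.2.2)
  have hsign : signD D₁ z.1 (Finsupp.single z.2.2 1) =
      Finsupp.single z.2.2 (((D₁.hDeg z.2.2.1.1).negOnePow : ℤˣ) : ℤ) := by
    rw [signD, Finsupp.linearCombination_single, one_smul]
    rfl
  rw [pairBasis_apply, map_smul, map_smul, Finsupp.smul_apply, Pairing.d, boxD_lof_tmul, map_add,
    Finsupp.add_apply, hδ, cubeCoeff_glue, smul_add, add_mul, hsign, smul_eq_mul, smul_eq_mul]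
  refine congrArg₂ (· + ·) ?_ ?_
  · obtain ⟨b, y₂, y₁⟩ := z
    obtain ⟨b', y₂', y₁'⟩ := z'
    by_cases hb : b = b'
    · subst hb
      rw [← left_coeff hM, pairEquiv_lof_same]
      congr 2
      exact cubeD_single _ _ _ _
    -- A crossing of `D₂` leaves the resolution of `D₁`, and with it the idempotent, unchanged.
    · rw [pairEquiv_lof_ne hb, mul_zero]
      rw [finsum_eq_zero_of_forall_eq_zero, zero_mul]
      intro c
      rw [cubeTerm_inr, if_neg]
      rintro ⟨-, -, h⟩
      have hm := DGen.isMatch hM y₁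
      have hm' := DGen.isMatch hM y₁'
      dsimp only at h
      rw [h] at hm'
      exact hb (hm.unique hm' fun _ _ => id)
  -- A crossing of `D₁` leaves the resolution of `D₂` unchanged, so source and target carry the same
  -- rescaling sign.
  · rw [mul_comm]
    have := Fintype.ofFinite D₁.code.X
    rw [finsum_eq_sum_of_fintype, Finset.sum_mul, Finset.sum_mul]
    refine Finset.sum_congr rfl fun c _ => ?_
    rw [cubeTerm_inl]
    split_ifs with h
    · rw [h.2.2]
    · rw [zero_mul, zero_mul]

theorem glueIso_d (hM : ∀ ρ, ∃ b, IsMatch (D₁.resRel ρ) D₁.code.bd b)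
    (hS : ∀ (ρ : D₁.Res) c, ρ c = false → IsSaddle (D₁.resRel ρ)
      (D₁.resRel (@Function.update _ _ (Classical.decEq _) ρ c true)) D₁.code.bd
        (D₁.code.nearLo c) (D₁.code.farHi c))
    (v : CKh (D₂.glue D₁ hc)) :
    glueIso hM (CKh.d _ v) = Pairing.d D₂ D₁ (glueIso hM v) := by
  induction v using Finsupp.induction_linear with
  | zero => simp
  | add v w hv hw => simp only [map_add, hv, hw]
  | single y a =>
    obtain ⟨z, rfl⟩ := (glueGen_bijective hM).2 y
    rw [← Finsupp.smul_single_one, map_smul, map_smul, map_smul, map_smul]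
    congr 1
    apply (pairEquiv D₂ D₁).injective
    ext z'
    rw [glueIso_single, pairing_d_apply hM (fun ρ c h => by convert hS ρ c h) z z',
      pairEquiv_glueIso]
    congr 1
    exact cubeD_single _ _ _ _

theorem glueIso_gr (hM : ∀ ρ, ∃ b, IsMatch (D₁.resRel ρ) D₁.code.bd b) (q h : ℤ) :
    (CKh.gr (D₂.glue D₁ hc) (q, h)).map ((glueIso hM : CKh (D₂.glue D₁ hc) ≃ₗ[ℤ] Pairing D₂ D₁) :
      CKh (D₂.glue D₁ hc) →ₗ[ℤ] Pairing D₂ D₁) =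
      Pairing.gr D₂ D₁ (-q, h) := by
  classical
  have hsign : ∀ k : ℕ, ((-1 : ℤ) ^ k) * (-1) ^ k = 1 := fun k => by
    rw [← mul_pow]
    simp
  apply le_antisymm
  · rw [CKh.gr, basisGr, Finsupp.supported_eq_span_single, Submodule.map_span, Submodule.span_le]
    rintro _ ⟨_, ⟨y, hy, rfl⟩, rfl⟩
    obtain ⟨z, rfl⟩ := (glueGen_bijective hM).2 y
    have hq := congrArg Prod.fst hy
    have hh := congrArg Prod.snd hy
    dsimp only at hq hh
    rw [qDeg_glueGen hM] at hq
    rw [hDeg_glueGen] at hh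
    change glueIso hM (Finsupp.single (glueGen hc z) 1) ∈ _
    rw [glueIso_single, pairBasis_apply]
    refine Submodule.smul_mem _ _ (Submodule.subset_span ⟨z.1, (n - D₂.qDeg z.2.1, D₂.hDeg z.2.1.1),
      degD D₁ z.2.2, _, _, ?_, ?_, ?_, rfl⟩)
    · exact Prod.ext (by simp only [degD, Prod.mk_add_mk]; linarith) hh
    · exact Finsupp.single_mem_supported ℤ 1 rfl
    · exact Finsupp.single_mem_supported ℤ 1 rfl
  · rw [Pairing.gr, boxGr, Submodule.span_le]
    rintro _ ⟨b, p₁, p₂, a, x, hp, ha, hx, rfl⟩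
    rw [grA, basisGr, Finsupp.supported_eq_span_single] at ha
    rw [grD, basisGr, Finsupp.supported_eq_span_single] at hx
    -- Homogeneous elements are combinations of generators of the same bidegree, so by bilinearity
    -- it suffices to treat tensors of two generators; these are images of glued generators up to
    -- sign.
    let f : TKh D₂ b →ₗ[ℤ] DMod D₁ b →ₗ[ℤ] Pairing D₂ D₁ := (TensorProduct.mk ℤ _ _).compr₂
      (DirectSum.lof ℤ (Matching n) (fun b => TKh D₂ b ⊗[ℤ] DMod D₁ b) b)
    have hf : f a x ∈ Submodule.map₂ f _ _ := Submodule.apply_mem_map₂ f ha hx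
    rw [Submodule.map₂_span_span] at hf
    refine (Submodule.span_le.2 ?_ : _ ≤ _) hf
    rintro _ ⟨_, ⟨y₂, hy₂, rfl⟩, _, ⟨y₁, hy₁, rfl⟩, rfl⟩
    refine ⟨((-1) ^ (D₁.nNeg * D₂.weight y₂.1) : ℤ) •
      Finsupp.single (glueGen hc ⟨b, y₂, y₁⟩) 1, Submodule.smul_mem _ _ ?_, ?_⟩
    · refine Finsupp.single_mem_supported ℤ 1 ?_
      change (_, _) = (_, _)
      rw [← hy₂, ← hy₁] at hp
      have hq := congrArg Prod.fst hp
      have hh := congrArg Prod.snd hp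
      simp only [degD, Prod.mk_add_mk] at hq hh
      rw [qDeg_glueGen hM, hDeg_glueGen]
      refine Prod.ext ?_ hh
      dsimp only
      linarith
    · change glueIso hM _ = _
      rw [map_smul, glueIso_single, pairBasis_apply, smul_smul, hsign, one_smul]
      rfl

end Isomorphism

end Khov

end

theorem mainTheorem7 (n : ℕ) (T₁ T₂ : Khov.Tangle (2 * n))
    (o₁ : Khov.Orientation T₁.code) (o₂ : Khov.Orientation T₂.code)
    (ord₁ : LinearOrder T₁.code.X) (ord₂ : LinearOrder T₂.code.X)
    (consistent : ∀ j, o₂.dir (T₂.code.bd j) = o₁.dir (T₁.code.bd j)) :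
    let D₁ : Khov.Diagram (2 * n) := ⟨T₁.code, o₁, ord₁⟩
    let D₂ : Khov.Diagram (2 * n) := ⟨T₂.code, o₂, ord₂⟩
    let L : Khov.Diagram 0 := D₂.glue D₁ consistent
    ∃ e : Khov.CKh L ≃ₗ[ℤ] Khov.Pairing D₂ D₁,
      (∀ x, e (Khov.CKh.d L x) = Khov.Pairing.d D₂ D₁ (e x)) ∧
      ∀ q h : ℤ, (Khov.CKh.gr L (q, h)).map (e : Khov.CKh L →ₗ[ℤ] Khov.Pairing D₂ D₁) =
        Khov.Pairing.gr D₂ D₁ (-q, h) := by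
  intro D₁ D₂ L
  -- Planarity of `T₁` enters here: every resolution realizes a crossingless matching, which is the
  -- idempotent of the corresponding summand.
  have hM : ∀ ρ, ∃ b, Khov.IsMatch (D₁.resRel ρ) D₁.code.bd b := fun ρ => by
    rw [Khov.Diagram.resRel_eq]
    exact Khov.exists_isMatch (T₁.code.res_pair T₁.not_thru T₁.good ρ) (T₁.res_nonCrossing ρ)
  refine ⟨Khov.glueIso hM, Khov.glueIso_d hM fun ρ c h => ?_, Khov.glueIso_gr hM⟩
  rw [Khov.Diagram.resRel_eq, Khov.Diagram.resRel_eq]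
  convert T₁.code.isSaddle T₁.not_thru T₁.good ρ h
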